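/- Let $L$ be a non-degenerate even lattice: a free abelian group of finite rank with a symmetric, non-degenerate, $\mathbb{Z}$-valued bilinear form $\langle\cdot,\cdot\rangle$ such that $\langle\alpha,\alpha\rangle\in 2\mathbb{Z}$ for all $\alpha\in L$. Let $\mathfrak{h}=\mathbb{C}\otimes_{\mathbb{Z}}L$, with the extended form, and let $L^\circ=\{\gamma\in\mathfrak{h}\mid\langle\gamma,\alpha\rangle\in\mathbb{Z}\text{ for all }\alpha\in L\}$ be the dual lattice. Let $s$ be a positive even integer, $\omega_s$ a primitive $s$-th root of unity, and $$1\to\langle\kappa\mid\kappa^s=1\rangle\to\widehat{L^\circ}\to L^\circ\to 1,\qquad a\mapsto\bar a,$$ a central extension whose commutator map $c_0$ (given by $ab=ba\,\kappa^{c_0(\bar a,\bar b)}$) satisfies $\omega_s^{c_0(\alpha,\beta)}=(-1)^{\langle\alpha,\beta\rangle}$ for $\alpha,\beta\in L$. Let $\gamma\mapsto e_\gamma$ be a section $L^\circ\to\widehat{L^\circ}$ with $e_0=1$ such that, writing $e_\alpha e_\beta=e_{\alpha+\beta}\kappa^{\varepsilon_0(\alpha,\beta)}$, one has $\omega_s^{\varepsilon_0(\alpha,\beta)}=\pm1$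 for all $\alpha,\beta\in L$. For $\beta\in L^\circ$ let $\mathbb{C}\{\beta+L\}$ be the complex vector space spanned by symbols $\iota(b)$, for $b\in\widehat{L^\circ}$ with $\bar b\in\beta+L$, subject to $\iota(\kappa b)=\omega_s\iota(b)$. Put $V_{\beta+L}=S(\mathfrak{h}\otimes t^{-1}\mathbb{C}[t^{-1}])\otimes\mathbb{C}\{\beta+L\}$ and $V_L=V_{0+L}$, and write $h(-n)$ for $h\otimes t^{-n}$ and $\iota(b)$ for $1\otimes\iota(b)$. For $n>0$, $h(-n)$ acts on $V_{\beta+L}$ by multiplication and $h(n)$ as the derivation of the symmetric algebra with $h(n)\,g(-m)=n\,\delta_{m,n}\langle h,g\rangle$, while $h(0)$ acts on $S(\cdot)\otimes\iota(b)$ as the scalar $\langle h,\bar b\rangle$. The space $V_L$ is the lattice (conformal) vertex algebra and $V_{\beta+L}$ is its module, with vacuum $\mathbf 1=\iota(1)$ and vertex operators $Y(u,x)w=\sum_{n\in\mathbb{Z}}u_nw\,x^{-n-1}$ determined as follows. For $\bar a\in L$, $$Y(\iota(a),x)=\exp\Big(\sum_{n>0}\tfrac{\bar a(-n)}{n}x^{n}\Big)\exp\Big(-\sum_{n>0}\tfrac{\bar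 a(n)}{n}x^{-n}\Big)\,a\,x^{\bar a},$$ where $a\,\iota(b)=\iota(ab)$ and $x^{\bar a}\iota(b)=x^{\langle\bar a,\bar b\rangle}\iota(b)$. Further, $Y(h_1(-m_1)\cdots h_k(-m_k)\iota(a),x)$ is the normally ordered product of the fields $\frac{1}{(m_i-1)!}\big(\frac{d}{dx}\big)^{m_i-1}h_i(x)$, with $h(x)=\sum_{n\in\mathbb{Z}} h(n)x^{-n-1}$, and of $Y(\iota(a),x)$. The conformal vector is $\omega=\frac12\sum_i a_i(-1)a_i'(-1)\mathbf 1$ for a basis $\{a_i\}$ of $\mathfrak{h}$ and its dual basis $\{a_i'\}$, and $L(0)=\omega_1$. For $\gamma\in\beta+L$ and $n\in\mathbb{C}$ let $V_n^\gamma\subseteq V_{\beta+L}$ be the $L(0)$-eigenspace with eigenvalue $n$ in $V^\gamma=S(\mathfrak{h}\otimes t^{-1}\mathbb{C}[t^{-1}])\otimes\iota(e_\gamma)$. Let $V_{L,\mathbb{Z}}$ be the vertex subring of $V_L$ generated by all $\iota(e_\alpha)$, $\alpha\in L$, that is, the smallest additive subgroup that contains $\mathbf 1$ and all $\iota(e_\alpha)$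 and is closed under all products $u_nv$. For $\beta\in L^\circ$ let $V_{\beta+L,\mathbb{Z}}$ be the $V_{L,\mathbb{Z}}$-submodule of $V_{\beta+L}$ generated by $\iota(e_\beta)$, that is, the smallest additive subgroup that contains $\iota(e_\beta)$ and is preserved by all $u_n$ with $u\in V_{L,\mathbb{Z}}$, $n\in\mathbb{Z}$. **Theorem.** $V_{L,\mathbb{Z}}$ is an integral form of $V_L$: it is a vertex subring, it is a free abelian group, the canonical map $\mathbb{C}\otimes_{\mathbb{Z}}V_{L,\mathbb{Z}}\to V_L$ is an isomorphism, and $$V_{L,\mathbb{Z}}=\coprod_{\alpha\in L,\;n\in\mathbb{Z}}V^\alpha_n\cap V_{L,\mathbb{Z}}.$$ For every $\beta\in L^\circ$, $V_{\beta+L,\mathbb{Z}}$ is an integral form of the module $V_{\beta+L}$: it is a $V_{L,\mathbb{Z}}$-submodule, it is a free abelian group, the canonical map $\mathbb{C}\otimes_{\mathbb{Z}}V_{\beta+L,\mathbb{Z}}\to V_{\beta+L}$ is an isomorphism, and $$V_{\beta+L,\mathbb{Z}}=\coprod_{\gamma\in\beta+L,\;n\in\mathbb{Q}}V^\gamma_n\cap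 V_{\beta+L,\mathbb{Z}}.$$ -/

import Mathlib

open scoped TensorProduct LaurentPolynomial

noncomputable section

namespace LatticeVertex

variable (L : Type*) [AddCommGroup L]

/-- The abelian Lie algebra `𝔥 = ℂ ⊗ L`. -/
abbrev Cartan : Type _ := ℂ ⊗[ℤ] L

/-- The space `𝔥 ⊗ t⁻¹ℂ[t⁻¹]`; `Finsupp.single n h` is `h ⊗ t⁻ⁿ`, for `n ≥ 1`. -/
abbrev HeisMinus : Type _ := ℕ+ →₀ Cartan L

/-- The symmetric algebra on `𝔥 ⊗ t⁻¹ℂ[t⁻¹]`, the underlying space of the Heisenberg vertex algebra. -/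
def Fock : Type _ := SymmetricAlgebra ℂ (HeisMinus L)

instance : CommRing (Fock L) := inferInstanceAs (CommRing (SymmetricAlgebra ℂ (HeisMinus L)))

instance : Algebra ℂ (Fock L) := inferInstanceAs (Algebra ℂ (SymmetricAlgebra ℂ (HeisMinus L)))

/-- Laurent polynomials in the formal variable `x` with coefficients in the Fock space
(the variable is called `T` in Mathlib). -/
abbrev FockPoly : Type _ := (Fock L)[T;T⁻¹]

/-- Formal Laurent series in `x` (finitely many negative powers) with coefficients in the
Fock space. -/
abbrev FockLaurent : Type _ := HahnSeries ℤ (Fock L)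

instance : Algebra ℂ (FockLaurent L) := HahnSeries.instAlgebra

variable {L}

/-- The inclusion of `𝔥 ⊗ t⁻¹ℂ[t⁻¹]` into its symmetric algebra. -/
def gen : HeisMinus L →ₗ[ℂ] Fock L := SymmetricAlgebra.ι ℂ (HeisMinus L)

/-- Universal property of the symmetric algebra, for commutative targets. -/
def fockLift {R : Type*} [CommRing R] [Algebra ℂ R] (f : HeisMinus L →ₗ[ℂ] R) : Fock L →ₐ[ℂ] R :=
  SymmetricAlgebra.lift f

lemma fockLift_gen {R : Type*} [CommRing R] [Algebra ℂ R] (f : HeisMinus L →ₗ[ℂ] R)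
    (y : HeisMinus L) : fockLift f (gen y) = f y :=
  SymmetricAlgebra.lift_ι_apply f y

lemma fock_induction {p : Fock L → Prop} (hc : ∀ c : ℂ, p (algebraMap ℂ _ c))
    (hg : ∀ y, p (gen y)) (hmul : ∀ a b, p a → p b → p (a * b))
    (hadd : ∀ a b, p a → p b → p (a + b)) (a : Fock L) : p a :=
  SymmetricAlgebra.induction (R := ℂ) (M := HeisMinus L) (motive := p) hc hg hmul hadd a

/-- `create n h` is the element `h(-n)`; as an operator `h(-n)` is multiplication by it. -/
def create (n : ℕ+) : Cartan L →ₗ[ℂ] Fock L :=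
  gen ∘ₗ Finsupp.lsingle n

section Poly

/-- The algebra map out of Laurent polynomials that is `f` on the generators `h(-n)` and sends
the variable to the unit `x`. -/
def polyLift {R : Type*} [CommRing R] [Algebra ℂ R] (f : HeisMinus L →ₗ[ℂ] R) (x : Rˣ) :
    FockPoly L →ₐ[ℂ] R :=
  AddMonoidAlgebra.liftNCAlgHom (fockLift f)
    ((Units.coeHom R).comp (zpowersHom Rˣ x)) (fun _ _ => Commute.all _ _)

lemma polyLift_C_ι {R : Type*} [CommRing R] [Algebra ℂ R] (f : HeisMinus L →ₗ[ℂ] R) (x : Rˣ)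
    (y : HeisMinus L) :
    polyLift f x (LaurentPolynomial.C (gen y)) = f y := by
  change AddMonoidAlgebra.liftNC _ _ (AddMonoidAlgebra.single _ _) = _
  rw [AddMonoidAlgebra.liftNC_single]
  simp [fockLift_gen]

lemma polyLift_T {R : Type*} [CommRing R] [Algebra ℂ R] (f : HeisMinus L →ₗ[ℂ] R) (x : Rˣ)
    (k : ℤ) :
    polyLift f x (LaurentPolynomial.T k) = ((x ^ k : Rˣ) : R) := by
  change AddMonoidAlgebra.liftNC _ _ (AddMonoidAlgebra.single _ _) = _
  rw [AddMonoidAlgebra.liftNC_single]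
  simp

lemma poly_induction {p : FockPoly L → Prop}
    (hι : ∀ y, p (LaurentPolynomial.C (gen y)))
    (hc : ∀ c : ℂ, p (algebraMap ℂ _ c))
    (hT : ∀ k, p (LaurentPolynomial.T k))
    (hadd : ∀ a b, p a → p b → p (a + b)) (hmul : ∀ a b, p a → p b → p (a * b))
    (a : FockPoly L) : p a := by
  have hC : ∀ Q : Fock L, p (LaurentPolynomial.C Q) := by
    intro Q
    induction Q using fock_induction with
    | hc r => exact hc r
    | hg x => exact hι x
    | hmul a b ha hb => rw [map_mul]; exact hmul _ _ ha hb
    | hadd a b ha hb => rw [map_add]; exact hadd _ _ ha hb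
  induction a using LaurentPolynomial.induction_on' with
  | add p q hp hq => exact hadd _ _ hp hq
  | C_mul_T n a => exact hmul _ _ (hC a) (hT n)

/-- The variable of the Laurent polynomials, as a unit. -/
def unitT (R : Type*) [CommRing R] : R[T;T⁻¹]ˣ where
  val := LaurentPolynomial.T 1
  inv := LaurentPolynomial.T (-1)
  val_inv := by rw [← LaurentPolynomial.T_add]; simp
  inv_val := by rw [← LaurentPolynomial.T_add]; simp

lemma unitT_zpow (R : Type*) [CommRing R] (k : ℤ) :
    ((unitT R ^ k : R[T;T⁻¹]ˣ) : R[T;T⁻¹]) = LaurentPolynomial.T k := by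
  induction k using Int.induction_on with
  | zero => simp
  | succ n ih => rw [zpow_add_one, Units.val_mul, ih, LaurentPolynomial.T_add]; rfl
  | pred n ih => rw [zpow_sub_one, Units.val_mul, ih, sub_eq_add_neg, LaurentPolynomial.T_add]; rfl

/-- Auxiliary: `a ↦ a + ε D a`, where `D` is the derivation `polyDeriv f`. -/
def polyDerivHom (f : HeisMinus L →ₗ[ℂ] FockPoly L) :
    FockPoly L →ₐ[ℂ] DualNumber (FockPoly L) :=
  polyLift (R := DualNumber (FockPoly L))
    ((TrivSqZeroExt.inlAlgHom ℂ (FockPoly L) (FockPoly L)).toLinearMap ∘ₗ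
      (AddMonoidAlgebra.singleZeroAlgHom (R := ℂ) (A := Fock L) (M := ℤ)).toLinearMap ∘ₗ
      gen
      + (TrivSqZeroExt.inrHom (FockPoly L) (FockPoly L)).restrictScalars ℂ ∘ₗ f)
    (Units.map (TrivSqZeroExt.inlHom (FockPoly L) (FockPoly L) : _ →* _) (unitT (Fock L)))

lemma polyDerivHom_fst (f : HeisMinus L →ₗ[ℂ] FockPoly L) (a : FockPoly L) :
    (polyDerivHom f a).fst = a := by
  induction a using poly_induction with
  | hι y => simp [polyDerivHom, polyLift_C_ι]
  | hc c => rw [AlgHom.commutes]; rfl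
  | hT k =>
    rw [polyDerivHom, polyLift_T, ← map_zpow]
    change ((unitT (Fock L) ^ k : (FockPoly L)ˣ) : FockPoly L) = _
    exact unitT_zpow _ _
  | hadd a b ha hb => rw [map_add, TrivSqZeroExt.fst_add, ha, hb]
  | hmul a b ha hb => rw [map_mul, TrivSqZeroExt.fst_mul, ha, hb]

/-- The derivation of the Laurent polynomials over the Fock space that kills the formal
variable and has the prescribed values `f` on the generators `h(-n)`. -/
def polyDeriv (f : HeisMinus L →ₗ[ℂ] FockPoly L) : Derivation ℂ (FockPoly L) (FockPoly L) :=
  Derivation.mk'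
    ((TrivSqZeroExt.sndHom (FockPoly L) (FockPoly L)).restrictScalars ℂ ∘ₗ
      (polyDerivHom f).toLinearMap) (by
    intro a b
    simp [polyDerivHom_fst, mul_comm])

lemma polyDeriv_C_ι (f : HeisMinus L →ₗ[ℂ] FockPoly L) (y : HeisMinus L) :
    polyDeriv f (LaurentPolynomial.C (gen y)) = f y := by
  change (polyDerivHom f _).snd = _
  rw [polyDerivHom, polyLift_C_ι]
  simp

lemma polyDeriv_T (f : HeisMinus L →ₗ[ℂ] FockPoly L) (k : ℤ) :
    polyDeriv f (LaurentPolynomial.T k) = 0 := by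
  change (polyDerivHom f _).snd = _
  rw [polyDerivHom, polyLift_T, ← map_zpow]
  rfl

lemma deriv_ext {D E : Derivation ℂ (FockPoly L) (FockPoly L)}
    (hι : ∀ y, D (LaurentPolynomial.C (gen y)) =
      E (LaurentPolynomial.C (gen y)))
    (hT : ∀ k, D (LaurentPolynomial.T k) = E (LaurentPolynomial.T k)) : D = E := by
  ext1 a
  induction a using poly_induction with
  | hι y => exact hι y
  | hc c => rw [Derivation.map_algebraMap, Derivation.map_algebraMap]
  | hT k => exact hT k
  | hadd a b ha hb => simp [ha, hb]
  | hmul a b ha hb => simp [ha, hb]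

end Poly

section Noncomm

variable {A : Type*} [Ring A] [Algebra ℂ A]

/-- Extension of a linear map with pairwise commuting values (in a possibly noncommutative
algebra) to the symmetric algebra. -/
def fockLiftOfComm (f : HeisMinus L →ₗ[ℂ] A) (hf : ∀ x y, f x * f y = f y * f x) :
    Fock L →ₐ[ℂ] A :=
  RingCon.liftₐ (TensorAlgebra.symRingCon ℂ (HeisMinus L)) (TensorAlgebra.lift ℂ f) (by
    refine RingCon.ringConGen_le.2 fun x y h => ?_
    induction h with
    | mul_comm x y => simpa [RingCon.ker_apply] using hf x y)

lemma fockLiftOfComm_gen (f : HeisMinus L →ₗ[ℂ] A) (hf : ∀ x y, f x * f y = f y * f x)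
    (y : HeisMinus L) : fockLiftOfComm f hf (gen y) = f y := by
  change TensorAlgebra.lift ℂ f (TensorAlgebra.ι ℂ y) = _
  simp

end Noncomm

variable (B : LinearMap.BilinForm ℤ L)

/-- The `ℂ`-bilinear extension to `𝔥` of the form of the lattice. -/
def form : LinearMap.BilinForm ℂ (Cartan L) := B.baseChange ℂ

/-- `annFun B c h` is the linear map `g(-n) ↦ n ⟨h, g⟩ c n`. -/
def annFun (c : ℕ+ → FockPoly L) : Cartan L →ₗ[ℂ] HeisMinus L →ₗ[ℂ] FockPoly L :=
  LinearMap.flip (Finsupp.lsum ℂ fun n : ℕ+ =>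
    (form B).flip.compr₂ (LinearMap.toSpanSingleton ℂ (FockPoly L) ((n : ℂ) • c n)))

lemma annFun_single (c : ℕ+ → FockPoly L) (h : Cartan L) (n : ℕ+) (g : Cartan L) :
    annFun B c h (Finsupp.single n g) = (n * form B h g : ℂ) • c n := by
  simp [annFun, smul_smul, mul_comm]

/-- `polyDeriv` as a linear map. -/
def polyDerivₗ :
    (HeisMinus L →ₗ[ℂ] FockPoly L) →ₗ[ℂ] Derivation ℂ (FockPoly L) (FockPoly L) where
  toFun := polyDeriv
  map_add' f g := deriv_ext (by simp [polyDeriv_C_ι]) (by simp [polyDeriv_T])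
  map_smul' r f := deriv_ext (by simp [polyDeriv_C_ι]) (by simp [polyDeriv_T])

/-- The operator series `∑_{n > 0} c n · h(n)`. Here `h(n)`, for `n > 0`, is the annihilation
operator on the Fock space, that is the derivation with `h(n) g(-m) = n δ_{m,n} ⟨h, g⟩`; so the
series is the derivation (linear over Laurent polynomials in `x`) with `g(-n) ↦ n ⟨h, g⟩ c n`. -/
def annSeries (c : ℕ+ → FockPoly L) : Cartan L →ₗ[ℂ] Derivation ℂ (FockPoly L) (FockPoly L) :=
  polyDerivₗ ∘ₗ annFun B c

/-- The integer `binom(-j-1, m-1)`, the coefficient of `h(j) x^{-j-m}` in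
`(1/(m-1)!) (d/dx)^{m-1} h(x)`, where `h(x) = ∑ⱼ h(j) x^{-j-1}`. -/
def modeCoeff (m : ℕ+) (j : ℤ) : ℂ := (Ring.choose (-j - 1) ((m : ℕ) - 1) : ℤ)

/-- For `y = h(-m)`: the part `∑_{n > 0} binom(-n-1, m-1) h(n) x^{-n-m}` of the field
`(1/(m-1)!) (d/dx)^{m-1} h(x)` (extended linearly in `y`). -/
def annField : HeisMinus L →ₗ[ℂ] Derivation ℂ (FockPoly L) (FockPoly L) :=
  Finsupp.lsum ℂ fun m : ℕ+ =>
    annSeries B fun n => modeCoeff m n • LaurentPolynomial.T (-(n : ℤ) - m)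

lemma annField_annField (D : Derivation ℂ (FockPoly L) (FockPoly L))
    (hD : ∀ k, D (LaurentPolynomial.T k) = 0) (y z : HeisMinus L) :
    D (annField B y (LaurentPolynomial.C (gen z))) = 0 := by
  induction y using Finsupp.induction_linear with
  | zero => simp
  | add y₁ y₂ h₁ h₂ => simp [h₁, h₂]
  | single m h =>
    rw [annField, Finsupp.lsum_single]
    change D (polyDeriv _ _) = 0
    rw [polyDeriv_C_ι]
    induction z using Finsupp.induction_linear with
    | zero => simp
    | add y₁ y₂ h₁ h₂ => rw [map_add, map_add, h₁, h₂, add_zero]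
    | single n g => rw [annFun_single, D.map_smul, D.map_smul, hD, smul_zero, smul_zero]

lemma annField_T (y : HeisMinus L) (k : ℤ) : annField B y (LaurentPolynomial.T k) = 0 := by
  induction y using Finsupp.induction_linear with
  | zero => simp
  | add y₁ y₂ h₁ h₂ => simp [h₁, h₂]
  | single m h =>
    rw [annField, Finsupp.lsum_single]
    exact polyDeriv_T _ _

lemma annField_comm (y z : HeisMinus L) (a : FockPoly L) :
    annField B y (annField B z a) = annField B z (annField B y a) := by
  have h : ⁅annField B y, annField B z⁆ = 0 := by
    apply deriv_ext
    · intro w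
      rw [Derivation.commutator_apply, annField_annField B _ (annField_T B y),
        annField_annField B _ (annField_T B z), sub_zero, Derivation.zero_apply]
    · intro k
      rw [Derivation.commutator_apply, annField_T, annField_T, map_zero, map_zero, sub_zero,
        Derivation.zero_apply]
  have := congrArg (fun D => D a) h
  simpa [Derivation.commutator_apply, sub_eq_zero] using this


/-- The creation part `∑_{j < 0} binom(-j-1, m-1) h(j) x^{-j-m}` of the field
`(1/(m-1)!) (d/dx)^{m-1} h(x)`, a power series in `x`: its coefficient at `x^i` has `j = -(i+m)`. -/
def createSeries (m : ℕ+) : Cartan L →ₗ[ℂ] PowerSeries (Fock L) where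
  toFun h := PowerSeries.mk fun i =>
    modeCoeff m (-(i + m : ℤ)) • create ⟨i + m, Nat.add_pos_right i m.pos⟩ h
  map_add' h₁ h₂ := by ext; simp
  map_smul' r h := by ext i; simp [smul_comm r]

/-- For `y = h(-m)`: the part `∑_{j ≤ 0} binom(-j-1, m-1) h(j) x^{-j-m}` of the field
`(1/(m-1)!) (d/dx)^{m-1} h(x)`, acting on `S ⊗ ι(g)`, on which the zero mode `h(0)` is the
scalar `l h`, where `l h = ⟨h, g⟩`. -/
def mulField (l : Cartan L →ₗ[ℂ] ℂ) : HeisMinus L →ₗ[ℂ] FockLaurent L :=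
  Finsupp.lsum ℂ fun m : ℕ+ =>
    (HahnSeries.ofPowerSeriesAlg ℤ ℂ : PowerSeries (Fock L) →ₐ[ℂ] FockLaurent L).toLinearMap ∘ₗ createSeries m +
      HahnSeries.single.linearMap (-(m : ℤ)) ∘ₗ Algebra.linearMap ℂ (Fock L) ∘ₗ (modeCoeff m 0 • l)

/-- For `y = h(-m)`: the operation `F ↦ ∘∘ ((1/(m-1)!) (d/dx)^{m-1} h(x)) F ∘∘` on fields, the
modes `h(j)` with `j < 0` being put to the left of `F` and those with `j ≥ 0` to the right.

A field is written here as a linear map from Laurent polynomials to Laurent series over the Fock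
space (all fields below are linear in the formal variable). The scalar `h(0)` acts on
the source of `F`, hence may be written on the left. -/
def normalStep (l : Cartan L →ₗ[ℂ] ℂ) :
    HeisMinus L →ₗ[ℂ] Module.End ℂ (FockPoly L →ₗ[ℂ] FockLaurent L) :=
  LinearMap.mk₂ ℂ
    (fun y F => LinearMap.mulLeft ℂ (mulField l y) ∘ₗ F + F ∘ₗ (annField B y).toLinearMap)
    (fun y z F => LinearMap.ext fun a => by
      simp only [map_add, LinearMap.add_apply, LinearMap.comp_apply, LinearMap.mulLeft_apply,
        add_mul, Derivation.coeFn_coe, Derivation.add_apply]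
      abel)
    (fun r y F => LinearMap.ext fun a => by
      simp)
    (fun y F G => LinearMap.ext fun a => by
      simp only [LinearMap.add_apply, LinearMap.comp_apply, LinearMap.mulLeft_apply, mul_add]
      abel)
    (fun r y F => LinearMap.ext fun a => by
      simp)

lemma normalStep_apply (l : Cartan L →ₗ[ℂ] ℂ) (y : HeisMinus L)
    (F : FockPoly L →ₗ[ℂ] FockLaurent L) (a : FockPoly L) :
    normalStep B l y F a = mulField l y * F a + F (annField B y a) := rfl

lemma normalStep_comm (l : Cartan L →ₗ[ℂ] ℂ) (y z : HeisMinus L) :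
    normalStep B l y * normalStep B l z = normalStep B l z * normalStep B l y := by
  refine LinearMap.ext fun F => LinearMap.ext fun a => ?_
  simp only [Module.End.mul_apply, normalStep_apply, annField_comm B y z]
  ring

/-- The normally ordered product, with a field `F`, of the fields belonging to a polynomial
in the `h(-m)`:
`h₁(-m₁) ⋯ h_k(-m_k)` gives `∘∘ ∂^{(m₁-1)}h₁(x) ⋯ ∂^{(m_k-1)}h_k(x) F ∘∘`. -/
def normalOrder (l : Cartan L →ₗ[ℂ] ℂ) :
    Fock L →ₐ[ℂ] Module.End ℂ (FockPoly L →ₗ[ℂ] FockLaurent L) :=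
  fockLiftOfComm (A := Module.End ℂ (FockPoly L →ₗ[ℂ] FockLaurent L)) (normalStep B l)
    (normalStep_comm B l)

/-- The variable `x` as a unit of the Laurent series. -/
def unitX : (FockLaurent L)ˣ where
  val := HahnSeries.single 1 1
  inv := HahnSeries.single (-1) 1
  val_inv := by simp
  inv_val := by simp

/-- `E⁻(-a, x) = exp (∑_{n > 0} a(-n)/n · xⁿ)`, a power series over the Fock space
(acting by multiplication). -/
def expMinus (a : Cartan L) : PowerSeries (Fock L) :=
  (PowerSeries.exp ℂ).subst (PowerSeries.mk fun n : ℕ =>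
    if hn : 0 < n then (n : ℂ)⁻¹ • create ⟨n, hn⟩ a else (0 : Fock L))

/-- `E⁺(-a, x) = exp (-∑_{n > 0} a(n)/n · x⁻ⁿ)`. The exponent is a derivation with
`h(-n) ↦ -⟨a, h⟩ x⁻ⁿ`, so its exponential is the algebra homomorphism with
`h(-n) ↦ h(-n) - ⟨a, h⟩ x⁻ⁿ`; see `expPlus_eq_exp` for the proof that this is the exponential. -/
def expPlus (a : Cartan L) : FockPoly L →ₐ[ℂ] FockPoly L := 
  polyLift
    ((AddMonoidAlgebra.singleZeroAlgHom (R := ℂ) (A := Fock L) (M := ℤ)).toLinearMap ∘ₗ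
      gen +
      annFun B (fun n => -(n : ℂ)⁻¹ • LaurentPolynomial.T (-(n : ℤ))) a)
    (unitT (Fock L))

/-- The inclusion of Laurent polynomials into Laurent series. -/
def toSeries : FockPoly L →ₐ[ℂ] FockLaurent L :=
  polyLift (HahnSeries.single.linearMap 0 ∘ₗ gen) unitX

/-- The coefficient `-x⁻ⁿ/n` of `a(n)` in the exponent of `E⁺(-a, x)`. -/
def expPlusCoeff (n : ℕ+) : FockPoly L := -(n : ℂ)⁻¹ • LaurentPolynomial.T (-(n : ℤ))

lemma annSeries_C_gen (c : ℕ+ → FockPoly L) (a : Cartan L) (y : HeisMinus L) :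
    annSeries B c a (LaurentPolynomial.C (gen y)) = annFun B c a y :=
  polyDeriv_C_ι _ _

lemma annSeries_T (c : ℕ+ → FockPoly L) (a : Cartan L) (k : ℤ) :
    annSeries B c a (LaurentPolynomial.T k) = 0 :=
  polyDeriv_T _ _

lemma expPlus_C_gen (a : Cartan L) (y : HeisMinus L) :
    expPlus B a (LaurentPolynomial.C (gen y)) =
      LaurentPolynomial.C (gen y) + annFun B expPlusCoeff a y := by
  rw [expPlus, polyLift_C_ι]
  rfl

lemma annFun_expPlus (a : Cartan L) (y : HeisMinus L) :
    annSeries B expPlusCoeff a (annFun B expPlusCoeff a y) = 0 := by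
  induction y using Finsupp.induction_linear with
  | zero => simp
  | add y₁ y₂ h₁ h₂ => rw [map_add, map_add, h₁, h₂, add_zero]
  | single n g =>
    rw [annFun_single, expPlusCoeff, Derivation.map_smul, Derivation.map_smul, annSeries_T]
    simp

/-- `E⁺(-a, x)` is the (locally finite) exponential of `-∑_{n > 0} a(n)/n · x⁻ⁿ`. -/
lemma expPlus_eq_exp (a : Cartan L) (Q : FockPoly L) : ∃ N : ℕ, ∀ n, N ≤ n →
    (annSeries B expPlusCoeff a)^[n] Q = 0 ∧
    expPlus B a Q = ∑ k ∈ Finset.range n,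
      ((k.factorial : ℂ)⁻¹) • (annSeries B expPlusCoeff a)^[k] Q := by
  set D := annSeries B expPlusCoeff a with hD
  let p : FockPoly L → Prop := fun Q => ∃ N : ℕ, ∀ n, N ≤ n → D^[n] Q = 0 ∧
    expPlus B a Q = ∑ k ∈ Finset.range n, ((k.factorial : ℂ)⁻¹) • D^[k] Q
  -- the property is stable under sums and under multiplication by generators
  have hadd : ∀ u v, p u → p v → p (u + v) := by
    rintro u v ⟨N, hN⟩ ⟨M, hM⟩
    refine ⟨max N M, fun n hn => ?_⟩
    have h1 := hN n (le_trans (le_max_left _ _) hn)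
    have h2 := hM n (le_trans (le_max_right _ _) hn)
    refine ⟨by rw [iterate_map_add, h1.1, h2.1, add_zero], ?_⟩
    rw [map_add, h1.2, h2.2, ← Finset.sum_add_distrib]
    exact Finset.sum_congr rfl fun k _ => by rw [iterate_map_add, smul_add]
  have key : ∀ u v : FockPoly L, D (D u) = 0 → ∀ k : ℕ,
      D^[k + 1] (u * v) = u * D^[k + 1] v + ((k : ℂ) + 1) • (D u * D^[k] v) := by
    intro u v hu k
    induction k with
    | zero => simp [mul_comm]
    | succ k ih =>
      rw [Function.iterate_succ_apply', ih]
      simp only [map_add, Derivation.leibniz, smul_eq_mul, Derivation.map_smul, hu,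
        ← Function.iterate_succ_apply' D]
      simp only [mul_zero, add_zero, Nat.cast_add, Nat.cast_one, Algebra.smul_def, map_add, map_one,
        map_natCast]
      ring
  have hmul1 : ∀ u, D (D u) = 0 → expPlus B a u = u + D u → ∀ v, p v → p (u * v) := by
    rintro u hu hE v ⟨N, hN⟩
    refine ⟨N + 1, fun n hn => ?_⟩
    obtain ⟨m, rfl⟩ : ∃ m, n = m + 1 := ⟨n - 1, by omega⟩
    have h1 := hN m (by omega)
    have h2 := hN (m + 1) (by omega)
    refine ⟨by rw [key u v hu, h1.1, h2.1]; simp, ?_⟩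
    rw [map_mul, hE, add_mul, Finset.sum_range_succ']
    have : ∀ k : ℕ, (((k + 1).factorial : ℂ)⁻¹) • D^[k + 1] (u * v) =
        u * ((((k + 1).factorial : ℂ)⁻¹) • D^[k + 1] v) +
          D u * (((k.factorial : ℂ)⁻¹) • D^[k] v) := by
      intro k
      rw [key u v hu, smul_add, mul_smul_comm, mul_smul_comm, smul_smul]
      congr 2
      rw [Nat.factorial_succ]
      have : (k : ℂ) + 1 ≠ 0 := by exact_mod_cast Nat.succ_ne_zero k
      have : (k.factorial : ℂ) ≠ 0 := by exact_mod_cast Nat.factorial_ne_zero k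
      push_cast
      field_simp
    simp only [this]
    rw [Finset.sum_add_distrib, ← Finset.mul_sum, ← Finset.mul_sum, ← h1.2]
    rw [h2.2, Finset.sum_range_succ', mul_add]
    simp
    ring
  have hgen : ∀ u v, p v → p (u * v) := by
    intro u
    induction u using poly_induction with
    | hι y =>
      refine hmul1 _ ?_ ?_
      · rw [hD, annSeries_C_gen]
        exact annFun_expPlus B a y
      · rw [expPlus_C_gen]
        congr 1
        exact (annSeries_C_gen B _ a y).symm
    | hc c =>
      refine hmul1 _ ?_ ?_
      · rw [Derivation.map_algebraMap, map_zero]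
      · rw [Derivation.map_algebraMap, add_zero, AlgHom.commutes]
    | hT k =>
      have : D (LaurentPolynomial.T k) = 0 := annSeries_T B _ a k
      refine hmul1 _ ?_ ?_
      · rw [this, map_zero]
      · rw [this, add_zero, expPlus, polyLift_T, unitT_zpow]
    | hadd u v hu hv => intro w hw; rw [add_mul]; exact hadd _ _ (hu w hw) (hv w hw)
    | hmul u v hu hv => intro w hw; rw [mul_assoc]; exact hu _ (hv w hw)
  have h1 : p 1 := ⟨1, fun n hn => by
    obtain ⟨m, rfl⟩ : ∃ m, n = m + 1 := ⟨n - 1, by omega⟩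
    have h0 : ∀ k, D^[k + 1] 1 = 0 := fun k => by
      rw [Function.iterate_succ_apply, Derivation.map_one_eq_zero, iterate_map_zero]
    refine ⟨h0 m, ?_⟩
    rw [Finset.sum_range_succ']
    simp [h0]⟩
  simpa using hgen Q 1 h1

section Lattice

/-- The inclusion of `L` into `𝔥`. -/
def toCartan : L →+ Cartan L := (TensorProduct.mk ℤ ℂ L 1).toAddMonoidHom

lemma form_toCartan (α β : L) : form B (toCartan α) (toCartan β) = (B α β : ℂ) := by
  simp [form, toCartan]

/-- The dual lattice `L° = {x ∈ 𝔥 | ⟨x, α⟩ ∈ ℤ for all α ∈ L}`. -/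
def dualLattice : AddSubgroup (Cartan L) where
  carrier := {x | ∀ α : L, ∃ k : ℤ, form B x (toCartan α) = k}
  zero_mem' α := ⟨0, by simp⟩
  add_mem' {x y} hx hy α := by
    obtain ⟨k, hk⟩ := hx α
    obtain ⟨l, hl⟩ := hy α
    exact ⟨k + l, by simp [hk, hl]⟩
  neg_mem' {x} hx α := by
    obtain ⟨k, hk⟩ := hx α
    exact ⟨-k, by simp [hk]⟩

/-- The inclusion of `L` into its dual lattice. -/
def toDual : L →+ dualLattice B :=
  toCartan.codRestrict (dualLattice B) fun α γ => ⟨B α γ, form_toCartan B α γ⟩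

/-- A central extension `1 → ⟨κ⟩ → G → L° → 1` of the dual lattice by a cyclic group of even
order `s`, with a primitive `s`-th root of unity `root` such that the commutator map `c₀` satisfies
`root ^ c₀(α, β) = (-1) ^ ⟨α, β⟩` for `α, β ∈ L`, and with a section `γ ↦ e γ` such that `e 0 = 1` and
the cocycle of the section, which is defined by `e α * e β = e (α + β) * κ ^ ε₀(α, β)`, satisfies
`root ^ ε₀(α, β) = ±1` for `α, β ∈ L`. -/
structure CentralExtension (G : Type*) [Group G] where
  s : ℕ
  s_pos : 0 < s
  s_even : Even s
  root : ℂ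
  root_primitive : IsPrimitiveRoot root s
  κ : G
  orderOf_κ : orderOf κ = s
  κ_central : ∀ g, κ * g = g * κ
  bar : G →* Multiplicative (dualLattice B)
  bar_surjective : Function.Surjective bar
  ker_bar : bar.ker = Subgroup.zpowers κ
  commutator : ∀ (a b : G) (α β : L), (bar a).toAdd = toDual B α → (bar b).toAdd = toDual B β →
    ∃ c : ℤ, a * b = b * a * κ ^ c ∧ root ^ c = (-1) ^ B α β
  e : dualLattice B → G
  bar_e : ∀ γ, (bar (e γ)).toAdd = γ
  e_zero : e 0 = 1
  cocycle : ∀ α β : L, ∃ c : ℤ, e (toDual B α) * e (toDual B β) = e (toDual B (α + β)) * κ ^ c ∧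
    (root ^ c = 1 ∨ root ^ c = -1)

variable {B} {G : Type*} [Group G] (E : CentralExtension B G)

namespace CentralExtension

/-- The element of `L°` under an element of the extension. -/
def deg (g : G) : dualLattice B := (E.bar g).toAdd

lemma deg_mul (g h : G) : E.deg (g * h) = E.deg g + E.deg h := by simp [deg]

lemma deg_κ : E.deg E.κ = 0 := by
  have h : E.κ ∈ E.bar.ker := by rw [E.ker_bar]; exact Subgroup.mem_zpowers _
  rw [MonoidHom.mem_ker] at h
  simp [deg, h]

lemma deg_one : E.deg 1 = 0 := by simp [deg]

lemma deg_e (γ : dualLattice B) : E.deg (E.e γ) = γ := E.bar_e γ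

/-- The elements of the extension lying over the coset `β + L`; for `β = 0` this is the
restriction of the extension to `L`. -/
abbrev Coset (β : dualLattice B) : Type _ := {g : G // E.deg g - β ∈ (toDual B).range}

variable {E} in
/-- Multiplication by `κ`. -/
def kap {β : dualLattice B} (g : E.Coset β) : E.Coset β :=
  ⟨E.κ * g.1, by rw [deg_mul, deg_κ, zero_add]; exact g.2⟩

variable {E} in
/-- Left multiplication of elements over `β + L` by elements over `L`. -/
def act {β : dualLattice B} (a : E.Coset 0) (g : E.Coset β) : E.Coset β :=
  ⟨a.1 * g.1, by
    rw [deg_mul, add_sub_assoc]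
    exact add_mem (by simpa using a.2) g.2⟩

/-- The element `e_β`, as an element over `β + L`. -/
def secCoset (β : dualLattice B) : E.Coset β := ⟨E.e β, by rw [deg_e, sub_self]; exact zero_mem _⟩

/-- The element `e_α` for `α ∈ L`, as an element over `L`. -/
def secLattice (α : L) : E.Coset 0 := ⟨E.e (toDual B α), by rw [deg_e, sub_zero]; exact ⟨α, rfl⟩⟩

/-- The identity of the extension, as an element over `L`. -/
def oneCoset : E.Coset 0 := ⟨1, by rw [deg_one, sub_zero]; exact zero_mem _⟩

lemma secLattice_zero : E.secLattice 0 = E.oneCoset :=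
  Subtype.ext (by simp [secLattice, oneCoset, E.e_zero])

/-- The space `ℂ{β + L}` spanned by symbols `g ⊗ 1`, for `g` in the extension over `β + L`, with
the relations `κ g ⊗ 1 = root • (g ⊗ 1)`. For `β = 0` it is the twisted group algebra `ℂ{L}`. -/
def Twisted (β : dualLattice B) : Type _ :=
  (E.Coset β →₀ ℂ) ⧸ Submodule.span ℂ (Set.range fun g : E.Coset β =>
    Finsupp.single (kap g) (1 : ℂ) - Finsupp.single g E.root)

instance (β : dualLattice B) : AddCommGroup (E.Twisted β) :=
  inferInstanceAs (AddCommGroup ((E.Coset β →₀ ℂ) ⧸ Submodule.span ℂ _))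

instance (β : dualLattice B) : Module ℂ (E.Twisted β) :=
  inferInstanceAs (Module ℂ ((E.Coset β →₀ ℂ) ⧸ Submodule.span ℂ _))

variable {E}

/-- The symbol `g ⊗ 1`. -/
def tw {β : dualLattice B} (g : E.Coset β) : E.Twisted β :=
  Submodule.Quotient.mk (Finsupp.single g (1 : ℂ))

lemma tw_kap {β : dualLattice B} (g : E.Coset β) : tw (kap g) = E.root • tw g := by
  refine (Submodule.Quotient.eq _).2 (Submodule.subset_span ⟨g, ?_⟩)
  simp

/-- Universal property of `ℂ{β + L}`. -/
def twLift {β : dualLattice B} {M : Type*} [AddCommGroup M] [Module ℂ M] (f : E.Coset β → M)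
    (hf : ∀ g, f (kap g) = E.root • f g) : E.Twisted β →ₗ[ℂ] M :=
  Submodule.liftQ _ (Finsupp.linearCombination ℂ f) (by
    rw [Submodule.span_le]
    rintro _ ⟨g, rfl⟩
    simp [hf])

lemma twLift_tw {β : dualLattice B} {M : Type*} [AddCommGroup M] [Module ℂ M] (f : E.Coset β → M)
    (hf : ∀ g, f (kap g) = E.root • f g) (g : E.Coset β) : twLift f hf (tw g) = f g := by
  change Submodule.liftQ _ _ _ (Submodule.Quotient.mk _) = _
  rw [Submodule.liftQ_apply]
  simp

lemma twLift_ext {β : dualLattice B} {M : Type*} [AddCommGroup M] [Module ℂ M]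
    {f f' : E.Twisted β →ₗ[ℂ] M} (h : ∀ g, f (tw g) = f' (tw g)) : f = f' := by
  refine Submodule.linearMap_qext _ (Finsupp.lhom_ext' fun g => LinearMap.ext_ring ?_)
  exact h g

lemma exists_pairing {β : dualLattice B} (a : E.Coset 0) (g : E.Coset β) :
    ∃ k : ℤ, form B (E.deg g.1) (E.deg a.1) = k := by
  obtain ⟨α, hα⟩ := a.2
  rw [sub_zero] at hα
  rw [← hα]
  exact (E.deg g.1).2 α

/-- The integer `⟨ā, ḡ⟩`, for `a` over `L` and `g` over `β + L`. -/
def pairing {β : dualLattice B} (a : E.Coset 0) (g : E.Coset β) : ℤ := (exists_pairing a g).choose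

lemma pairing_spec {β : dualLattice B} (a : E.Coset 0) (g : E.Coset β) :
    form B (E.deg g.1) (E.deg a.1) = pairing a g := (exists_pairing a g).choose_spec

lemma deg_kap {β : dualLattice B} (g : E.Coset β) : E.deg (kap g).1 = E.deg g.1 := by
  simp [kap, deg_mul, deg_κ]

lemma pairing_kap_left {β : dualLattice B} (a : E.Coset 0) (g : E.Coset β) :
    pairing (kap a) g = pairing a g := by
  have h := pairing_spec (kap a) g
  rw [deg_kap, pairing_spec] at h
  exact_mod_cast h.symm

lemma pairing_kap_right {β : dualLattice B} (a : E.Coset 0) (g : E.Coset β) :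
    pairing a (kap g) = pairing a g := by
  have h := pairing_spec a (kap g)
  rw [deg_kap, pairing_spec] at h
  exact_mod_cast h.symm

/-- The field `Y(ι(a), x) = E⁻(-ā, x) E⁺(-ā, x) a x^ā` on `S ⊗ ι(g)`, with values in
`S((x)) ⊗ ι(a g)`; only the part on the Fock space `S` is recorded. -/
def iotaField {β : dualLattice B} (a : E.Coset 0) (g : E.Coset β) :
    FockPoly L →ₗ[ℂ] FockLaurent L :=
  LinearMap.mulLeft ℂ (HahnSeries.single (pairing a g) (1 : Fock L) *
      HahnSeries.ofPowerSeries ℤ (Fock L) (expMinus (E.deg a.1 : Cartan L))) ∘ₗ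
    toSeries.toLinearMap ∘ₗ (expPlus B (E.deg a.1 : Cartan L)).toLinearMap

/-- The field `Y(P ⊗ ι(a), x)` on `S ⊗ ι(g)`, with values in `S((x)) ⊗ ι(a g)`: the normally
ordered product of the fields `(1/(m-1)!) (d/dx)^{m-1} h(x)` for the factors `h(-m)` of `P`, and
`Y(ι(a), x)`. -/
def fockField {β : dualLattice B} (a : E.Coset 0) (g : E.Coset β) (P : Fock L) :
    FockPoly L →ₗ[ℂ] FockLaurent L :=
  normalOrder B (form B (E.deg g.1 : Cartan L)) P (iotaField a g)

/-- The coefficient of `x^{-n-1}` of `Y(P ⊗ ι(a), x) (Q ⊗ ι(g))` in `S ⊗ ι(a g)`. -/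
def fockMode (n : ℤ) {β : dualLattice B} (a : E.Coset 0) (g : E.Coset β) (P Q : Fock L) :
    Fock L :=
  (fockField a g P (LaurentPolynomial.C Q)).coeff (-n - 1)

lemma fockMode_kap_left (n : ℤ) {β : dualLattice B} (a : E.Coset 0) (g : E.Coset β)
    (P Q : Fock L) : fockMode n (kap a) g P Q = fockMode n a g P Q := by
  simp [fockMode, fockField, iotaField, deg_kap, pairing_kap_left]

lemma fockMode_kap_right (n : ℤ) {β : dualLattice B} (a : E.Coset 0) (g : E.Coset β)
    (P Q : Fock L) : fockMode n a (kap g) P Q = fockMode n a g P Q := by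
  simp [fockMode, fockField, iotaField, deg_kap, pairing_kap_right]

lemma act_kap_left {β : dualLattice B} (a : E.Coset 0) (g : E.Coset β) :
    act (kap a) g = kap (act a g) := Subtype.ext (mul_assoc _ _ _)

lemma act_kap_right {β : dualLattice B} (a : E.Coset 0) (g : E.Coset β) :
    act a (kap g) = kap (act a g) := Subtype.ext (by
  change a.1 * (E.κ * g.1) = E.κ * (a.1 * g.1)
  rw [← mul_assoc, ← E.κ_central, mul_assoc])

variable (E) in
/-- The space `V_{β+L} = S ⊗ ℂ{β + L}`. -/
def LatticeModule (β : dualLattice B) : Type _ := Fock L ⊗[ℂ] E.Twisted β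

instance (β : dualLattice B) : AddCommGroup (E.LatticeModule β) :=
  inferInstanceAs (AddCommGroup (Fock L ⊗[ℂ] E.Twisted β))

instance (β : dualLattice B) : Module ℂ (E.LatticeModule β) :=
  inferInstanceAs (Module ℂ (Fock L ⊗[ℂ] E.Twisted β))

variable (E) in
/-- The space `V_L = S ⊗ ℂ{L}` of the lattice vertex algebra. -/
abbrev LatticeAlgebra : Type _ := E.LatticeModule 0

/-- The pure tensors of `V_{β+L}`. -/
def tens {β : dualLattice B} : Fock L →ₗ[ℂ] E.Twisted β →ₗ[ℂ] E.LatticeModule β :=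
  TensorProduct.mk ℂ (Fock L) (E.Twisted β)

/-- Universal property of the tensor product. -/
def tensLift {β : dualLattice B} {M : Type*} [AddCommGroup M] [Module ℂ M]
    (f : Fock L →ₗ[ℂ] E.Twisted β →ₗ[ℂ] M) : E.LatticeModule β →ₗ[ℂ] M :=
  TensorProduct.lift f

lemma tensLift_tens {β : dualLattice B} {M : Type*} [AddCommGroup M] [Module ℂ M]
    (f : Fock L →ₗ[ℂ] E.Twisted β →ₗ[ℂ] M) (P : Fock L) (c : E.Twisted β) :
    tensLift f (tens P c) = f P c :=
  TensorProduct.lift.tmul P c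

lemma tensLift_ext {β : dualLattice B} {M : Type*} [AddCommGroup M] [Module ℂ M]
    {f f' : E.LatticeModule β →ₗ[ℂ] M} (h : ∀ P c, f (tens P c) = f' (tens P c)) : f = f' :=
  TensorProduct.ext' h

/-- `fockMode` as a bilinear map. -/
def fockModeₗ (n : ℤ) {β : dualLattice B} (a : E.Coset 0) (g : E.Coset β) :
    Fock L →ₗ[ℂ] Fock L →ₗ[ℂ] E.LatticeModule β :=
  LinearMap.mk₂ ℂ (fun P Q => tens (fockMode n a g P Q) (tw (act a g)))
    (fun P P' Q => by simp [fockMode, fockField])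
    (fun r P Q => by simp [fockMode, fockField])
    (fun P Q Q' => by simp [fockMode])
    (fun r P Q => by
      have : (LaurentPolynomial.C (r • Q) : FockPoly L) = r • LaurentPolynomial.C Q :=
        (AddMonoidAlgebra.smul_single r (0 : ℤ) Q).symm
      simp [fockMode, this])

lemma fockModeₗ_apply (n : ℤ) {β : dualLattice B} (a : E.Coset 0) (g : E.Coset β) (P Q : Fock L) :
    fockModeₗ n a g P Q = tens (fockMode n a g P Q) (tw (act a g)) := rfl

/-- The modes, as a multilinear map in all four tensor factors. -/
def twMode (n : ℤ) (β : dualLattice B) :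
    E.Twisted 0 →ₗ[ℂ] E.Twisted β →ₗ[ℂ] Fock L →ₗ[ℂ] Fock L →ₗ[ℂ] E.LatticeModule β :=
  twLift (fun a => twLift (fun g : E.Coset β => fockModeₗ n a g) (fun g => by
      refine LinearMap.ext₂ fun P Q => ?_
      simp [fockModeₗ_apply, fockMode_kap_right, act_kap_right, tw_kap]))
    (fun a => twLift_ext fun g => by
      refine LinearMap.ext₂ fun P Q => ?_
      simp [twLift_tw, fockModeₗ_apply, fockMode_kap_left, act_kap_left, tw_kap])

/-- The vertex algebra products `u_n w`, for `u ∈ V_L` and `w ∈ V_{β+L}`: they are the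
coefficients of the vertex operator `Y(u, x) w = ∑ₙ u_n w x^{-n-1}`. For `β = 0` this is the vertex
algebra structure of `V_L`, in general it is the `V_L`-module structure of `V_{β+L}`. -/
def nthProduct (n : ℤ) (β : dualLattice B) :
    E.LatticeAlgebra →ₗ[ℂ] E.LatticeModule β →ₗ[ℂ] E.LatticeModule β :=
  tensLift (LinearMap.mk₂ ℂ
    (fun P c => tensLift (LinearMap.mk₂ ℂ (fun Q d => twMode n β c d P Q)
      (by simp) (by simp) (by simp) (by simp)))
    (fun _ _ _ => tensLift_ext fun _ _ => by simp [tensLift_tens])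
    (fun _ _ _ => tensLift_ext fun _ _ => by simp [tensLift_tens])
    (fun _ _ _ => tensLift_ext fun _ _ => by simp [tensLift_tens])
    (fun _ _ _ => tensLift_ext fun _ _ => by simp [tensLift_tens]))

/-- The products on pure tensors. -/
lemma nthProduct_tens (n : ℤ) {β : dualLattice B} (a : E.Coset 0) (g : E.Coset β) (P Q : Fock L) :
    nthProduct n β (tens P (tw a)) (tens Q (tw g)) = tens (fockMode n a g P Q) (tw (act a g)) := by
  simp [nthProduct, twMode, twLift_tw, fockModeₗ_apply, tensLift_tens]


/-- The vector `ι(g) = 1 ⊗ (g ⊗ 1)`. -/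
def iota {β : dualLattice B} (g : E.Coset β) : E.LatticeModule β := tens 1 (tw g)

variable (E) in
/-- The vacuum vector `ι(1)`. -/
def vacuum : E.LatticeAlgebra := iota E.oneCoset

variable (E) in
/-- The vector `½ ∑ⱼ aⱼ(-1) a'ⱼ(-1) 𝟏`; it is the conformal vector of `V_L` when `a` is a basis of
`𝔥` and `a'` is the dual basis. -/
def conformalVector {J : Type*} [Fintype J] (a a' : J → Cartan L) : E.LatticeAlgebra :=
  (1 / 2 : ℂ) • ∑ j, tens (create 1 (a j) * create 1 (a' j)) (tw E.oneCoset)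

/-- The weight space: the eigenspace, with eigenvalue `n`, of `L(0)` on `V_{β+L}`, where
`L(0) = w_1` is the coefficient of `x⁻²` in `Y(w, x)`, for the conformal vector `w`. -/
def weightSpace (w : E.LatticeAlgebra) (β : dualLattice B) (n : ℂ) :
    Submodule ℂ (E.LatticeModule β) :=
  Module.End.eigenspace (nthProduct 1 β w) n

variable (E) in
/-- The homogeneous subspace `V^γ = S ⊗ ι(g)` of `V_{β+L}`, where `g` lies over `γ`. -/
def degreeSpace (β γ : dualLattice B) : Submodule ℂ (E.LatticeModule β) :=
  Submodule.span ℂ {v | ∃ (P : Fock L) (g : E.Coset β), E.deg g.1 = γ ∧ v = tens P (tw g)}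

/-- A vertex subring of `V_L`: an additive subgroup containing the vacuum and closed under all
products `u_n v`. -/
structure IsVertexSubring (M : AddSubgroup E.LatticeAlgebra) : Prop where
  vacuum_mem : E.vacuum ∈ M
  nthProduct_mem : ∀ u ∈ M, ∀ v ∈ M, ∀ n : ℤ, nthProduct n 0 u v ∈ M

/-- An additive subgroup of `V_{β+L}` preserved by all `u_n`, for `u ∈ R`. -/
def IsVertexSubmodule (R : AddSubgroup E.LatticeAlgebra) {β : dualLattice B}
    (M : AddSubgroup (E.LatticeModule β)) : Prop :=
  ∀ u ∈ R, ∀ w ∈ M, ∀ n : ℤ, nthProduct n β u w ∈ M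

/-- The vertex subring generated by a set. -/
def vertexSubringClosure (S : Set E.LatticeAlgebra) : AddSubgroup E.LatticeAlgebra :=
  sInf {M | IsVertexSubring M ∧ S ⊆ M}

/-- The `R`-submodule of `V_{β+L}` generated by a set. -/
def vertexSubmoduleClosure (R : AddSubgroup E.LatticeAlgebra) {β : dualLattice B}
    (S : Set (E.LatticeModule β)) : AddSubgroup (E.LatticeModule β) :=
  sInf {M | IsVertexSubmodule R M ∧ S ⊆ M}

variable (E) in
/-- `V_{L,ℤ}`: the vertex subring of `V_L` generated by the `ι(e_α)`, for `α ∈ L`. -/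
def integralAlgebra : AddSubgroup E.LatticeAlgebra :=
  vertexSubringClosure (Set.range fun α : L => iota (E.secLattice α))

variable (E) in
/-- `V_{β+L,ℤ}`: the `V_{L,ℤ}`-submodule of `V_{β+L}` generated by `ι(e_β)`. -/
def integralModule (β : dualLattice B) : AddSubgroup (E.LatticeModule β) :=
  vertexSubmoduleClosure E.integralAlgebra {iota (E.secCoset β)}

end CentralExtension

/-- An integral form of a complex vector space `W`: a free abelian subgroup `M` such that the
canonical map `ℂ ⊗_ℤ M → W` is an isomorphism. -/
structure IsIntegralFormOfSpace {W : Type*} [AddCommGroup W] [Module ℂ W]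
    (M : AddSubgroup W) : Prop where
  free : Module.Free ℤ M
  bijective : IsBaseChange ℂ (M.subtype.toIntLinearMap)

/-- The subgroup `M` is the direct sum of its intersections with the subspaces `V i`. -/
structure IsCompatibleWithGrading {W : Type*} [AddCommGroup W] [Module ℂ W] {I : Type*}
    (V : I → Submodule ℂ W) (M : AddSubgroup W) : Prop where
  independent : iSupIndep fun i => (V i).toAddSubgroup ⊓ M
  sum_eq : ⨆ i, (V i).toAddSubgroup ⊓ M = M

namespace CentralExtension

/-- An integral form of the vertex algebra `V_L` with conformal vector `w`: a vertex subring that is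
an integral form of the vector space and is compatible with the grading by `L` and by weights
in `ℤ`. -/
structure IsIntegralFormOfAlgebra (w : E.LatticeAlgebra) (M : AddSubgroup E.LatticeAlgebra) :
    Prop where
  subring : IsVertexSubring M
  integralForm : IsIntegralFormOfSpace M
  compatible : IsCompatibleWithGrading
    (fun p : L × ℤ => E.degreeSpace 0 (toDual B p.1) ⊓ weightSpace w 0 (p.2 : ℂ)) M

/-- An integral form of the module `V_{β+L}`, over the vertex subring `R` of `V_L`: an `R`-submodule
that is an integral form of the vector space and is compatible with the grading by `β + L` and by
weights in `ℚ`. -/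
structure IsIntegralFormOfModule (w : E.LatticeAlgebra) (R : AddSubgroup E.LatticeAlgebra)
    (β : dualLattice B) (M : AddSubgroup (E.LatticeModule β)) : Prop where
  submodule : IsVertexSubmodule R M
  integralForm : IsIntegralFormOfSpace M
  compatible : IsCompatibleWithGrading
    (fun p : {γ : dualLattice B // γ - β ∈ (toDual B).range} × ℚ =>
      E.degreeSpace β p.1 ⊓ weightSpace w β (p.2 : ℂ)) M

end CentralExtension
end Lattice

end LatticeVertex

end

/-! Write `E(α, x) = exp (∑_{n>0} α(-n)/n · xⁿ)` and let `s_n(α)` be its coefficients. The integral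
form is written down explicitly: `integralFock` is the subring of the Fock space generated by all
`s_n(α)`, `α ∈ L`, and `integralSpan β` is the group spanned by the `P ⊗ ι(e_α e_β)` with `P` in
`integralFock`. The two groups of the theorem are shown to equal `integralSpan 0` and `integralSpan
β` (`integralAlgebra_eq`, `integralModule_eq`), and everything else is read off a basis.

Basis. Since `E(α + β, x) = E(α, x) E(β, x)`, the `s_n(b_i)` with `n ≥ 1` and `b` a basis of `L`
already generate `integralFock`. A series with constant term 1 and its logarithmic derivative
determine each other over `ℂ`, so the Fock space is the polynomial ring over `ℂ` in these elements
(`fockEquiv`). Their monomials are therefore a `ℂ`-basis whose `ℤ`-span is `integralFock`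
(`mem_integralFock_iff`).

Closure under products. Vertex operators are evaluated on generating series, where every exponential
becomes a product of series `E` and of integral powers of binomials. The operator `E⁺(-α, x)`
multiplies `E(γ, z)` by `(1 - z/x)^⟨α,γ⟩` (`map_expPlus_expMinus`). The normally ordered field of
`E(α, y)` multiplies by `E(α, x+y)/E(α, x) · (1 + y/x)^⟨α,g⟩` on the left (`exists_isExp_mulGen`),
and on the right it multiplies `E(γ, z)` by `(1 - z/(x+y))^k (1 - z/x)^(-k)`, `k = ⟨α,γ⟩`
(`map_annExp_expMinus`). Integral powers of binomials have integral coefficients, so no denominators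
survive (`fockMode_mem`). These identities are never proved by expanding exponentials: both sides
have constant term 1 and the same logarithmic derivative (`IsExp.unique`).

Generation. If `Q` is replaced by `E⁺(α, x) Q`, the operator of `ι(e_α)` loses its annihilation
part, and its coefficients become `s_n(α) Q`. As `E⁺` does not increase the number of factors `s_n`,
induction on that number produces all of `integralSpan β` from `ι(e_β)` (`integralSpan_le`).

Grading. The basis vectors are homogeneous: `L(0)` acts as half the norm of the lattice degree plus
the derivation `h(-n) ↦ n h(-n)`, for which `s_n(α)` has weight `n`. Evenness makes the weights on
`V_L` integral, and Cramer's rule for the Gram matrix makes those on `V_{β+L}` rational. -/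

noncomputable section

namespace LatticeVertex

/-! ### Formal exponentials through logarithmic derivatives, and integrality of power series -/

section FormalExp

open PowerSeries

/-- `H` is the formal exponential with logarithmic derivative `A`. -/
structure IsExp {R : Type*} [CommRing R] (A H : R⟦X⟧) : Prop where
  constantCoeff_eq : constantCoeff H = 1
  derivative_eq : d⁄dX R H = A * H

variable {R : Type*} [CommRing R]

lemma derivative_mul (f g : R⟦X⟧) : d⁄dX R (f * g) = f * d⁄dX R g + g * d⁄dX R f := by
  rw [Derivation.leibniz, smul_eq_mul, smul_eq_mul]

/-- The power series with coefficients in a subring. -/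
def coeffSubring (S : Subring R) : Subring R⟦X⟧ where
  carrier := {f | ∀ n, coeff n f ∈ S}
  mul_mem' {f g} hf hg n := by
    rw [coeff_mul]
    exact sum_mem fun p _ => mul_mem (hf _) (hg _)
  one_mem' n := by
    rw [coeff_one]; split_ifs
    exacts [one_mem _, zero_mem _]
  add_mem' {f g} hf hg n := by rw [map_add]; exact add_mem (hf n) (hg n)
  zero_mem' n := by rw [map_zero]; exact zero_mem _
  neg_mem' {f} hf n := by rw [map_neg]; exact neg_mem (hf n)

/-- Because `f` has constant term 1, solving `f * g = 1` coefficient by coefficient never divides.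
-/
lemma coeffSubring_inv {S : Subring R} {f g : R⟦X⟧} (hf : f ∈ coeffSubring S)
    (h1 : constantCoeff f = 1) (hfg : f * g = 1) : g ∈ coeffSubring S := by
  intro n
  induction n using Nat.strong_induction_on with
  | _ n ih =>
    have h := congrArg (coeff n) hfg
    rw [coeff_mul, ← Finset.add_sum_erase _ _
      (show ((0 : ℕ), n) ∈ Finset.HasAntidiagonal.antidiagonal n by simp),
      coeff_zero_eq_constantCoeff_apply, h1, one_mul] at h
    rw [eq_sub_of_add_eq h]
    refine sub_mem ((coeffSubring S).one_mem n) (sum_mem fun p hp => mul_mem (hf _) (ih _ ?_))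
    rw [Finset.mem_erase, Finset.HasAntidiagonal.mem_antidiagonal, ne_eq, Prod.ext_iff] at hp
    grind

lemma coeffSubring_zpow {S : Subring R} {u : (R⟦X⟧)ˣ} (hu : (u : R⟦X⟧) ∈ coeffSubring S)
    (h1 : constantCoeff (u : R⟦X⟧) = 1) (k : ℤ) : ((u ^ k : (R⟦X⟧)ˣ) : R⟦X⟧) ∈ coeffSubring S := by
  obtain ⟨n, rfl | rfl⟩ := k.eq_nat_or_neg
  · simpa using pow_mem hu n
  · have := coeffSubring_inv hu h1 u.mul_inv
    simpa using pow_mem this n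

namespace IsExp

variable {A A' H H' : R⟦X⟧}

lemma mul (h : IsExp A H) (h' : IsExp A' H') : IsExp (A + A') (H * H') where
  constantCoeff_eq := by rw [map_mul, h.1, h'.1, one_mul]
  derivative_eq := by
    rw [Derivation.leibniz, h.2, h'.2, smul_eq_mul, smul_eq_mul]; ring

lemma one : IsExp (0 : R⟦X⟧) 1 := ⟨by simp, by simp⟩

lemma inv (h : IsExp A H) {K : R⟦X⟧} (hK : H * K = 1) : IsExp (-A) K where
  constantCoeff_eq := by
    have := congrArg constantCoeff hK
    rwa [map_mul, h.1, one_mul, map_one] at this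
  derivative_eq := by
    have := congrArg (d⁄dX R) hK
    rw [Derivation.leibniz, h.2, Derivation.map_one_eq_zero, smul_eq_mul, smul_eq_mul] at this
    linear_combination K * this - (A * K + d⁄dX R K) * hK

lemma zpow {u : (R⟦X⟧)ˣ} (h : IsExp A u) (k : ℤ) : IsExp (k • A) ((u ^ k : (R⟦X⟧)ˣ) : R⟦X⟧) := by
  induction k using Int.induction_on with
  | zero => simpa using one
  | succ n ih =>
    rw [zpow_add_one, add_smul, one_smul, Units.val_mul]
    exact ih.mul h
  | pred n ih =>
    rw [zpow_sub_one, sub_smul, one_smul, Units.val_mul, sub_eq_add_neg]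
    exact ih.mul (h.inv u.mul_inv)

lemma map (h : IsExp A H) {R' : Type*} [CommRing R'] (f : R →+* R') :
    IsExp (PowerSeries.map f A) (PowerSeries.map f H) where
  constantCoeff_eq := by rw [← coeff_zero_eq_constantCoeff_apply, coeff_map, coeff_zero_eq_constantCoeff_apply, h.1,
      map_one]
  derivative_eq := by
    rw [← map_mul, ← h.2]
    ext n
    simp [coeff_derivative]

lemma isUnit (h : IsExp A H) : IsUnit H := by
  rw [PowerSeries.isUnit_iff_constantCoeff, h.1]; exact isUnit_one

lemma coeff_succ (h : IsExp A H) (n : ℕ) :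
    coeff (n + 1) H * (n + 1) = ∑ p ∈ Finset.HasAntidiagonal.antidiagonal n, coeff p.1 A * coeff p.2 H := by
  rw [← coeff_derivative, h.2, coeff_mul]

lemma exists_mul_eq_one (h : IsExp A H) : ∃ K, H * K = 1 := h.isUnit.exists_right_inv

/-- The quotient of two solutions has derivative zero and constant term 1, so it is 1 when the
coefficients have no torsion. All later product formulas for exponentials are instances of this. -/
lemma unique [IsAddTorsionFree R] (h : IsExp A H) (h' : IsExp A H') : H = H' := by
  obtain ⟨K, hK⟩ := h'.exists_mul_eq_one
  have h1 := h.mul (h'.inv hK)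
  rw [add_neg_cancel] at h1
  have h2 : H * K = 1 := derivative.ext (by rw [h1.2]; simp) (by rw [h1.1, map_one])
  linear_combination H' * h2 - H * hK

lemma of_derivative {D : R⟦X⟧} {K : R⟦X⟧} (h1 : constantCoeff H = 1) (hK : H * K = 1)
    (hD : d⁄dX R H = D) : IsExp (D * K) H :=
  ⟨h1, by rw [hD]; linear_combination -D * hK⟩

end IsExp

/-- The power series `1 + u X`, as a unit. -/
def onePlus (u : R) : (R⟦X⟧)ˣ where
  val := 1 + C u * X
  inv := mk fun n => (-u) ^ n
  val_inv := by
    ext n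
    rw [add_mul, mul_assoc, one_mul, map_add, coeff_C_mul, coeff_one]
    cases n with
    | zero => simp
    | succ n => rw [coeff_succ_X_mul]; simp [pow_succ]; ring
  inv_val := by
    ext n
    rw [mul_add, mul_comm, mul_comm (mk _), mul_assoc, one_mul, map_add, coeff_C_mul, coeff_one]
    cases n with
    | zero => simp
    | succ n => rw [coeff_succ_X_mul]; simp [pow_succ]; ring

lemma coe_onePlus (u : R) : (onePlus u : R⟦X⟧) = 1 + C u * X := rfl

lemma coe_onePlus_inv (u : R) : ((onePlus u)⁻¹ : (R⟦X⟧)ˣ) = mk fun n => (-u) ^ n := rfl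

lemma constantCoeff_onePlus (u : R) : constantCoeff (onePlus u : R⟦X⟧) = 1 := by
  simp [coe_onePlus]

/-- The logarithmic derivative is `u / (1 + u X)`, a geometric series; its coefficient `u (-u)ⁿ` is
written `-(-u)^(n+1)`, the shape in which it meets the modes `h(n+1)`. -/
lemma isExp_onePlus (u : R) : IsExp (mk fun n => -(-u) ^ (n + 1)) (onePlus u : R⟦X⟧) where
  constantCoeff_eq := constantCoeff_onePlus u
  derivative_eq := by
    have h : (mk fun n => -(-u) ^ (n + 1)) = C u * (((onePlus u)⁻¹ : (R⟦X⟧)ˣ) : R⟦X⟧) := by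
      ext n; rw [coe_onePlus_inv, coeff_C_mul]; simp [pow_succ]; ring
    rw [h, mul_assoc, Units.inv_mul, mul_one, coe_onePlus, map_add, Derivation.leibniz]
    simp

lemma isExp_onePlus_zpow (u : R) (k : ℤ) :
    IsExp (mk fun n => -(k * (-u) ^ (n + 1))) ((onePlus u ^ k : (R⟦X⟧)ˣ) : R⟦X⟧) := by
  convert (isExp_onePlus u).zpow k using 1
  ext n
  rw [map_zsmul]
  simp

lemma onePlus_zpow_mem {S : Subring R} {u : R} (hu : u ∈ S) (k : ℤ) :
    ((onePlus u ^ k : (R⟦X⟧)ˣ) : R⟦X⟧) ∈ coeffSubring S := by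
  refine coeffSubring_zpow (fun n => ?_) (constantCoeff_onePlus u) k
  rw [coe_onePlus, map_add, coeff_C_mul, coeff_X]
  refine add_mem ((coeffSubring S).one_mem n) (mul_mem hu ?_)
  split_ifs
  exacts [one_mem _, zero_mem _]

/-- The Taylor expansion `f(x + y)`, as a power series in `y` over the power series in `x`. -/
def taylor (f : R⟦X⟧) : R⟦X⟧⟦X⟧ := mk fun n => mk fun m => (n + m).choose n * coeff (n + m) f

lemma coeff_taylor (f : R⟦X⟧) (n m : ℕ) :
    coeff m (coeff n (taylor f)) = (n + m).choose n * coeff (n + m) f := by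
  simp [taylor]

lemma constantCoeff_taylor (f : R⟦X⟧) : constantCoeff (taylor f) = f := by
  ext m
  rw [← coeff_zero_eq_constantCoeff_apply, coeff_taylor]
  simp

lemma derivative_taylor (f : R⟦X⟧) : d⁄dX _ (taylor f) = taylor (d⁄dX R f) := by
  ext n m
  rw [coeff_derivative, coeff_taylor, coeff_derivative]
  have h1 : ((n : R⟦X⟧) + 1) = C ((n : R) + 1) := by simp
  rw [h1, coeff_mul_C, coeff_taylor]
  have h2 := Nat.add_one_mul_choose_eq (n + m) n
  have h3 : n + 1 + m = n + m + 1 := by ring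
  rw [h3]
  have h4 : ((n + m + 1 : ℕ) : R) * ((n + m).choose n : R) =
    ((n + m + 1).choose (n + 1) : R) * ((n + 1 : ℕ) : R) := by
    rw [← Nat.cast_mul, ← Nat.cast_mul, ← h2]
  push_cast at h4 ⊢
  linear_combination -coeff (n + m + 1) f * h4

lemma taylor_add (f g : R⟦X⟧) : taylor (f + g) = taylor f + taylor g := by
  ext n m; simp [taylor, mul_add]

/-- Substituting `x + y` is multiplicative. In place of a binomial convolution, the coefficients of
`yⁿ` are compared by induction: `d/dy` turns into `d/dx` under `taylor`, so degree `n + 1` for `f,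
g` follows from degree `n` for the two terms of the product rule, after cancelling `n + 1`. -/
lemma taylor_mul [IsAddTorsionFree R] (f g : R⟦X⟧) : taylor (f * g) = taylor f * taylor g := by
  ext1 n
  induction n generalizing f g with
  | zero =>
    rw [coeff_zero_eq_constantCoeff_apply, coeff_zero_eq_constantCoeff_apply, map_mul]
    simp only [constantCoeff_taylor]
  | succ n ih =>
    have h : coeff (n + 1) (taylor (f * g)) * (n + 1) =
        coeff (n + 1) (taylor f * taylor g) * (n + 1) := by
      rw [← coeff_derivative, ← coeff_derivative, derivative_taylor, derivative_mul,
        derivative_mul, derivative_taylor, derivative_taylor, taylor_add, map_add, ih, ih, ← map_add]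
    have hn : ((n : R⟦X⟧) + 1) = C (((n + 1 : ℕ) : R)) := by simp
    rw [hn] at h
    ext m
    have h' := congrArg (coeff m) h
    rw [coeff_mul_C, coeff_mul_C, mul_comm _ (Nat.cast _), mul_comm _ (Nat.cast _),
      ← nsmul_eq_mul, ← nsmul_eq_mul] at h'
    exact nsmul_right_injective (Nat.succ_ne_zero n) h'

lemma taylor_mem {S : Subring R} {f : R⟦X⟧} (hf : f ∈ coeffSubring S) (n : ℕ) :
    coeff n (taylor f) ∈ coeffSubring S := fun m => by
  rw [coeff_taylor]
  exact mul_mem (natCast_mem _ _) (hf _)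

/-- The exponential `H(x + y) / H(x)`. -/
lemma IsExp.taylor [IsAddTorsionFree R] {A H K : R⟦X⟧} (h : IsExp A H) (hK : H * K = 1) :
    IsExp (taylor A) (taylor H * C K) where
  constantCoeff_eq := by rw [map_mul, constantCoeff_taylor, constantCoeff_C, hK]
  derivative_eq := by
    rw [derivative_mul, derivative_C, derivative_taylor, h.2, taylor_mul]
    ring

end FormalExp

end LatticeVertex
end

noncomputable section

namespace LatticeVertex

variable {L : Type*} [AddCommGroup L]

/-! ### The integral form of the Fock space as a polynomial ring -/

section FockForm

open PowerSeries

lemma isAddTorsionFree_of_algebra (R : Type*) [CommRing R] [Algebra ℂ R] : IsAddTorsionFree R := by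
  let _ : Module ℚ R := Module.compHom R (algebraMap ℚ ℂ)
  exact .of_module_rat _

lemma IsExp.unique_left {R : Type*} [CommRing R] {A A' H : R⟦X⟧} (h : IsExp A H)
    (h' : IsExp A' H) : A = A' := by
  have := h.2.symm.trans h'.2
  exact h.isUnit.mul_right_cancel this

/-- The generating series `∑_{n ≥ 0} h(-n-1) zⁿ`. -/
def createGen (h : Cartan L) : PowerSeries (Fock L) := mk fun n => create n.succPNat h

lemma createGen_add (h h' : Cartan L) : createGen (h + h') = createGen h + createGen h' := by
  ext n; simp [createGen]

lemma createGen_zero : createGen (0 : Cartan L) = 0 := by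
  ext n; simp [createGen]

instance : IsAddTorsionFree (Fock L) := isAddTorsionFree_of_algebra _

lemma isExp_expMinus (h : Cartan L) : IsExp (createGen h) (expMinus h) := by
  let _ : Algebra ℚ (Fock L) := Algebra.compHom _ (algebraMap ℚ ℂ)
  set g : PowerSeries (Fock L) := mk fun n : ℕ =>
    if hn : 0 < n then (n : ℂ)⁻¹ • create ⟨n, hn⟩ h else (0 : Fock L) with hg
  have hg0 : constantCoeff g = 0 := by
    rw [← coeff_zero_eq_constantCoeff_apply, hg, coeff_mk]; simp
  have hs : HasSubst g := HasSubst.of_constantCoeff_zero' hg0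
  -- The exponential is moved to the coefficient ring of `g`, where the chain rule
  -- `derivative_subst` applies.
  have he : expMinus h = (exp (Fock L)).subst g := by
    ext n
    rw [expMinus, coeff_subst' hs, coeff_subst' hs]
    refine finsum_congr fun d => ?_
    rw [coeff_exp, coeff_exp, smul_eq_mul, Algebra.smul_def]
    rfl
  have hd : d⁄dX _ g = createGen h := by
    ext n
    rw [coeff_derivative, hg, coeff_mk, createGen, coeff_mk, dif_pos (Nat.succ_pos n)]
    have : ((n : Fock L) + 1) = algebraMap ℂ _ ((n : ℂ) + 1) := by simp
    rw [this, mul_comm, ← Algebra.smul_def, smul_smul]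
    have h2 : (n : ℂ) + 1 ≠ 0 := by exact_mod_cast Nat.succ_ne_zero n
    push_cast
    rw [mul_inv_cancel₀ h2, one_smul]
    rfl
  refine ⟨?_, ?_⟩
  · rw [he, ← coeff_zero_eq_constantCoeff_apply, coeff_subst' hs,
      finsum_eq_single _ 0]
    · simp
    · intro n hn
      simp [hg0, hn]
  · rw [he, derivative_subst hs, derivative_exp, hd, mul_comm]

lemma expMinus_zero : expMinus (0 : Cartan L) = 1 := by
  refine (isExp_expMinus 0).unique ?_
  rw [createGen_zero]
  exact IsExp.one

lemma expMinus_add (h h' : Cartan L) : expMinus (h + h') = expMinus h * expMinus h' := by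
  refine (isExp_expMinus _).unique ?_
  rw [createGen_add]
  exact (isExp_expMinus h).mul (isExp_expMinus h')

lemma expMinus_mul_neg (h : Cartan L) : expMinus h * expMinus (-h) = 1 := by
  rw [← expMinus_add, add_neg_cancel, expMinus_zero]

variable (L) in
/-- The subring of the Fock space generated by the coefficients of the series
`exp (∑_{n > 0} α(-n)/n · xⁿ)`, for `α ∈ L`. -/
def integralFock : Subring (Fock L) :=
  Subring.closure {P | ∃ (α : L) (n : ℕ), P = coeff n (expMinus (toCartan α))}

lemma expMinus_mem_integralFock (α : L) : expMinus (toCartan α) ∈ coeffSubring (integralFock L) :=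
  fun n => Subring.subset_closure ⟨α, n, rfl⟩

variable {I : Type*} (b : Module.Basis I ℤ L)

/-- The basis of `𝔥` coming from a basis of the lattice. -/
def cartanBasis : Module.Basis I ℂ (Cartan L) := b.baseChange ℂ

lemma cartanBasis_apply (i : I) : cartanBasis b i = toCartan (b i) :=
  Module.Basis.baseChange_apply ℂ b i

variable (I) in
/-- The series with indeterminate coefficients and constant coefficient `1`. -/
def genericSeries (i : I) : PowerSeries (MvPolynomial (I × ℕ) ℂ) :=
  mk fun | 0 => 1 | n + 1 => MvPolynomial.X (i, n)

lemma constantCoeff_genericSeries (i : I) : constantCoeff (genericSeries I i) = 1 := by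
  rw [← coeff_zero_eq_constantCoeff_apply, genericSeries, coeff_mk]

variable (I) in
/-- The logarithmic derivative of the generic series. -/
def genericLog (i : I) : PowerSeries (MvPolynomial (I × ℕ) ℂ) :=
  d⁄dX _ (genericSeries I i) * invOfUnit (genericSeries I i) 1

lemma isExp_genericSeries (i : I) : IsExp (genericLog I i) (genericSeries I i) :=
  IsExp.of_derivative (constantCoeff_genericSeries i)
    (mul_invOfUnit _ _ (by simp [constantCoeff_genericSeries])) rfl

/-- The algebra map from polynomials sending the variables to the coefficients of the series
`exp (∑_{n > 0} b_i(-n)/n · xⁿ)`. -/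
def polyToFock : MvPolynomial (I × ℕ) ℂ →ₐ[ℂ] Fock L :=
  MvPolynomial.aeval fun p => coeff (p.2 + 1) (expMinus (toCartan (b p.1)))

/-- The inverse of `polyToFock`. -/
def fockToPoly : Fock L →ₐ[ℂ] MvPolynomial (I × ℕ) ℂ :=
  fockLift (Finsupp.lsum ℂ fun n : ℕ+ =>
    (cartanBasis b).constr ℂ fun i => coeff n.natPred (genericLog I i))

lemma map_polyToFock (i : I) :
    PowerSeries.map (polyToFock b).toRingHom (genericSeries I i) = expMinus (toCartan (b i)) := by
  ext n
  rw [coeff_map]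
  cases n with
  | zero =>
    rw [coeff_zero_eq_constantCoeff_apply, coeff_zero_eq_constantCoeff_apply,
      (isExp_expMinus _).1, constantCoeff_genericSeries, map_one]
  | succ n => simp [genericSeries, polyToFock]

lemma fockToPoly_create (i : I) (n : ℕ) :
    fockToPoly b (create n.succPNat (toCartan (b i))) = coeff n (genericLog I i) := by
  rw [create, LinearMap.comp_apply, fockToPoly, fockLift_gen, Finsupp.lsingle_apply,
    Finsupp.lsum_single, ← cartanBasis_apply, Module.Basis.constr_basis, Nat.natPred_succPNat]

lemma map_fockToPoly_createGen (i : I) :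
    PowerSeries.map (fockToPoly b).toRingHom (createGen (toCartan (b i))) = genericLog I i := by
  ext1 n
  rw [coeff_map, createGen, coeff_mk]
  exact fockToPoly_create b i n

/-- `fockToPoly` is defined on the `h(-n)` so as to match logarithmic derivatives; by uniqueness it
then matches the exponentials themselves. -/
lemma map_fockToPoly (i : I) :
    PowerSeries.map (fockToPoly b).toRingHom (expMinus (toCartan (b i))) = genericSeries I i := by
  have h := (isExp_expMinus (toCartan (b i))).map (fockToPoly b).toRingHom
  rw [map_fockToPoly_createGen] at h
  have : IsAddTorsionFree (MvPolynomial (I × ℕ) ℂ) := isAddTorsionFree_of_algebra _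
  exact h.unique (isExp_genericSeries i)

lemma polyToFock_genericLog (i : I) :
    PowerSeries.map (polyToFock b).toRingHom (genericLog I i) = createGen (toCartan (b i)) := by
  have h := (isExp_genericSeries i).map (polyToFock b).toRingHom
  rw [map_polyToFock] at h
  exact h.unique_left (isExp_expMinus _)

/-- The Fock space is the polynomial ring on the coefficients of the series
`exp (∑_{n > 0} b_i(-n)/n · xⁿ)`, for a basis `b` of the lattice. -/
def fockEquiv : MvPolynomial (I × ℕ) ℂ ≃ₐ[ℂ] Fock L :=
  AlgEquiv.ofAlgHom (polyToFock b) (fockToPoly b)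
    (by
      -- It suffices to recover the `b_i(-n)`. They are coefficients of the logarithmic derivative
      -- of `E(b_i, x)`, and `polyToFock` carries the generic series to `E(b_i, x)`, hence the
      -- generic logarithmic derivative to this one.
      have h : (polyToFock b).toLinearMap ∘ₗ (fockToPoly b).toLinearMap ∘ₗ gen = gen := by
        refine Finsupp.lhom_ext' fun n => (cartanBasis b).ext fun i => ?_
        have h1 := fockToPoly_create b i n.natPred
        rw [PNat.succPNat_natPred] at h1
        have h2 := congrArg (coeff n.natPred) (polyToFock_genericLog b i)
        rw [coeff_map, createGen, coeff_mk, PNat.succPNat_natPred] at h2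
        rw [cartanBasis_apply]
        exact (congrArg (polyToFock b) h1).trans h2
      refine AlgHom.ext fun P => ?_
      induction P using fock_induction with
      | hc c => rw [AlgHom.commutes, AlgHom.commutes]
      | hg y => exact LinearMap.congr_fun h y
      | hmul u v hu hv => rw [map_mul, map_mul, hu, hv]
      | hadd u v hu hv => rw [map_add, map_add, hu, hv])
    (by
      refine MvPolynomial.algHom_ext fun p => ?_
      have h := congrArg (coeff (p.2 + 1)) (map_fockToPoly b p.1)
      rw [coeff_map, genericSeries, coeff_mk] at h
      simpa [polyToFock] using h)

/-- The basis of the Fock space formed by the monomials in the coefficients of the series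
`exp (∑_{n > 0} b_i(-n)/n · xⁿ)`. -/
def fockBasis : Module.Basis (I × ℕ →₀ ℕ) ℂ (Fock L) :=
  (MvPolynomial.basisMonomials (I × ℕ) ℂ).map (fockEquiv b).toLinearEquiv

lemma fockBasis_apply (m : I × ℕ →₀ ℕ) :
    fockBasis b m = polyToFock b (MvPolynomial.monomial m 1) := by
  rw [fockBasis, Module.Basis.map_apply, MvPolynomial.coe_basisMonomials]
  rfl

lemma fockBasis_eq_prod (m : I × ℕ →₀ ℕ) :
    fockBasis b m = m.prod fun p k => coeff (p.2 + 1) (expMinus (toCartan (b p.1))) ^ k := by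
  rw [fockBasis_apply, polyToFock, MvPolynomial.aeval_monomial, map_one, one_mul]

lemma fockBasis_mul (m m' : I × ℕ →₀ ℕ) :
    fockBasis b m * fockBasis b m' = fockBasis b (m + m') := by
  rw [fockBasis_apply, fockBasis_apply, fockBasis_apply, ← map_mul, MvPolynomial.monomial_mul,
    one_mul]

/-- `α ↦ E(α, x)` turns sums into products and negatives into inverses. Both operations preserve
integral series with constant term 1, so the basis vectors of `L` are enough. -/
lemma expMinus_mem_closure (α : L) : expMinus (toCartan α) ∈ coeffSubring
    (Subring.closure (Set.range fun p : I × ℕ => coeff (p.2 + 1) (expMinus (toCartan (b p.1))))) := by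
  set S := Subring.closure
    (Set.range fun p : I × ℕ => coeff (p.2 + 1) (expMinus (toCartan (b p.1)))) with hS
  have hneg : ∀ β : L, expMinus (toCartan β) ∈ coeffSubring S →
      expMinus (toCartan (-β)) ∈ coeffSubring S := by
    intro β hβ
    rw [map_neg]
    exact coeffSubring_inv hβ (isExp_expMinus _).1 (expMinus_mul_neg _)
  have hadd : ∀ β γ : L, expMinus (toCartan β) ∈ coeffSubring S →
      expMinus (toCartan γ) ∈ coeffSubring S → expMinus (toCartan (β + γ)) ∈ coeffSubring S := by
    intro β γ hβ hγ
    rw [map_add, expMinus_add]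
    exact mul_mem hβ hγ
  have h0 : expMinus (toCartan (0 : L)) ∈ coeffSubring S := by
    rw [map_zero, expMinus_zero]; exact one_mem _
  induction b.mem_span α using Submodule.span_induction with
  | mem x hx =>
    obtain ⟨i, rfl⟩ := hx
    intro n
    cases n with
    | zero =>
      rw [coeff_zero_eq_constantCoeff_apply, (isExp_expMinus _).1]
      exact one_mem _
    | succ n => exact Subring.subset_closure ⟨(i, n), rfl⟩
  | zero => exact h0
  | add x y _ _ hx hy => exact hadd _ _ hx hy
  | smul k x _ hx =>
    induction k using Int.induction_on with
    | zero => rw [zero_smul]; exact h0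
    | succ n ih => rw [add_smul, one_smul]; exact hadd _ _ ih hx
    | pred n ih => rw [sub_smul, one_smul, sub_eq_add_neg]; exact hadd _ _ ih (hneg _ hx)

lemma integralFock_eq_closure : integralFock L =
    Subring.closure (Set.range fun p : I × ℕ => coeff (p.2 + 1) (expMinus (toCartan (b p.1)))) := by
  refine le_antisymm (Subring.closure_le.2 ?_) (Subring.closure_le.2 ?_)
  · rintro _ ⟨α, n, rfl⟩
    exact expMinus_mem_closure b α n
  · rintro _ ⟨p, rfl⟩
    exact expMinus_mem_integralFock _ _

/-- Products of monomials are monomials, so their `ℤ`-span is already a ring. This turns the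
multiplicative description of the integral form into a basis. -/
lemma mem_integralFock_iff (P : Fock L) :
    P ∈ integralFock L ↔ P ∈ Submodule.span ℤ (Set.range (fockBasis b)) := by
  constructor
  · intro hP
    rw [integralFock_eq_closure b] at hP
    induction hP using Subring.closure_induction with
    | mem x hx =>
      obtain ⟨p, rfl⟩ := hx
      refine Submodule.subset_span ⟨Finsupp.single p 1, ?_⟩
      rw [fockBasis_eq_prod, Finsupp.prod_single_index (by simp), pow_one]
    | zero => exact zero_mem _
    | one =>
      refine Submodule.subset_span ⟨0, ?_⟩
      rw [fockBasis_eq_prod, Finsupp.prod_zero_index]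
    | add x y _ _ hx hy => exact add_mem hx hy
    | neg x _ hx => exact neg_mem hx
    | mul x y _ _ hx hy =>
      have h := Submodule.mul_mem_mul hx hy
      rw [Submodule.span_mul_span] at h
      refine Submodule.span_mono ?_ h
      rintro _ ⟨_, ⟨m, rfl⟩, _, ⟨m', rfl⟩, rfl⟩
      exact ⟨m + m', (fockBasis_mul b m m').symm⟩
  · intro hP
    induction hP using Submodule.span_induction with
    | mem x hx =>
      obtain ⟨m, rfl⟩ := hx
      rw [fockBasis_eq_prod]
      exact prod_mem fun p _ => pow_mem (expMinus_mem_integralFock _ _) _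
    | zero => exact zero_mem _
    | add x y _ _ hx hy => exact add_mem hx hy
    | smul k x _ hx => exact zsmul_mem hx k

end FockForm

end LatticeVertex
end

noncomputable section

namespace LatticeVertex

/-! ### Binomial series and diagonals of sequences of power series -/

section Binomial

open PowerSeries

variable {R : Type*} [CommRing R]

lemma coeff_onePlus_zpow (u : R) (k : ℤ) (n : ℕ) :
    coeff n ((onePlus u ^ k : (R⟦X⟧)ˣ) : R⟦X⟧) = (Ring.choose k n : ℤ) * u ^ n := by
  have h : ((onePlus u ^ k : (R⟦X⟧)ˣ) : R⟦X⟧) = rescale u (binomialSeries R k) := by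
    have hnat : ∀ d : ℕ, (onePlus u : R⟦X⟧) ^ d = rescale u (binomialSeries R (d : ℤ)) := by
      intro d
      rw [binomialSeries_nat, map_pow, map_add, map_one, rescale_X, coe_onePlus]
    obtain ⟨d, rfl | rfl⟩ := k.eq_nat_or_neg
    · rw [zpow_natCast, Units.val_pow_eq_pow_val, hnat]
    · rw [zpow_neg, zpow_natCast, Units.inv_eq_of_mul_eq_one_right]
      rw [Units.val_pow_eq_pow_val, hnat, ← map_mul, ← binomialSeries_add, add_neg_cancel,
        binomialSeries_zero, map_one]
  rw [h, coeff_rescale, binomialSeries_coeff, zsmul_eq_mul, mul_one, mul_comm]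

/-- This compares coefficients in `d/dX (1 + X)^r = r (1 + X)^(r-1)`, for any integer `r`. -/
lemma succ_mul_choose (r : ℤ) (n : ℕ) :
    (n + 1) * Ring.choose r (n + 1) = r * Ring.choose (r - 1) n := by
  have h := congrArg (coeff n) ((isExp_onePlus (1 : ℤ)).zpow r).2
  have h2 : (mk fun n => -(-1 : ℤ) ^ (n + 1)) = (((onePlus (1 : ℤ))⁻¹ : (ℤ⟦X⟧)ˣ) : ℤ⟦X⟧) := by
    ext n; rw [coe_onePlus_inv]; simp [pow_succ]
  rw [h2, smul_mul_assoc, ← Units.val_mul, ← zpow_neg_one, ← zpow_add, coeff_derivative,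
    map_zsmul, coeff_onePlus_zpow, coeff_onePlus_zpow, neg_add_eq_sub] at h
  simp at h
  linarith

/-- The diagonal specialization `∑ᵢ Fᵢ yⁱ` of a sequence of power series in `y`. -/
def diagonal (F : ℕ → R⟦X⟧) : R⟦X⟧ :=
  mk fun n => ∑ p ∈ Finset.HasAntidiagonal.antidiagonal n, coeff p.2 (F p.1)

lemma coeff_diagonal (F : ℕ → R⟦X⟧) (n : ℕ) : coeff n (diagonal F) =
    ∑ p ∈ Finset.HasAntidiagonal.antidiagonal n, coeff p.2 (F p.1) := by
  rw [diagonal, coeff_mk]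

/-- Up to a given degree the infinite sum `∑ᵢ Fᵢ yⁱ` is finite, so the diagonal commutes with
multiplication by a series. -/
lemma coeff_diagonal_of_lt (F : ℕ → R⟦X⟧) {n N : ℕ} (h : n < N) :
    coeff n (diagonal F) = coeff n (∑ i ∈ Finset.range N, X ^ i * F i) := by
  rw [coeff_diagonal, map_sum, Finset.Nat.sum_antidiagonal_eq_sum_range_succ_mk]
  simp only [coeff_X_pow_mul']
  rw [← Finset.sum_subset (Finset.range_subset_range.2 h)]
  · exact Finset.sum_congr rfl fun i hi => by
      rw [if_pos (Nat.lt_succ_iff.1 (Finset.mem_range.1 hi))]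
  · intro i _ hi
    rw [if_neg]
    rw [Finset.mem_range] at hi
    omega

lemma diagonal_add (F F' : ℕ → R⟦X⟧) :
    diagonal (fun i => F i + F' i) = diagonal F + diagonal F' := by
  ext n
  simp [coeff_diagonal, Finset.sum_add_distrib]

lemma diagonal_mul (F : ℕ → R⟦X⟧) (g : R⟦X⟧) :
    diagonal (fun i => F i * g) = diagonal F * g := by
  ext n
  rw [coeff_diagonal_of_lt _ (Nat.lt_succ_self n)]
  simp only [← mul_assoc]
  rw [← Finset.sum_mul, coeff_mul, coeff_mul]
  refine Finset.sum_congr rfl fun p hp => ?_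
  rw [coeff_diagonal_of_lt]
  exact Nat.lt_succ_of_le (Finset.HasAntidiagonal.antidiagonal.fst_le hp)

lemma diagonal_C (f : ℕ → R) : diagonal (fun i => C (f i)) = mk f := by
  ext n
  rw [coeff_diagonal, coeff_mk, Finset.sum_eq_single (n, 0)]
  · simp
  · rintro ⟨i, j⟩ hp hne
    rw [Finset.HasAntidiagonal.mem_antidiagonal] at hp
    rw [coeff_C, if_neg]
    rintro rfl
    exact hne (by simpa using hp)
  · simp

/-- A linear map applied to the coefficients of a power series. -/
def mapCoeff {R' : Type*} [CommRing R'] (F : R → R') (f : R⟦X⟧) : R'⟦X⟧ :=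
  mk fun n => F (coeff n f)

end Binomial

variable {L : Type*} [AddCommGroup L]

open PowerSeries

instance : IsAddTorsionFree (FockPoly L) := isAddTorsionFree_of_algebra _
instance : IsAddTorsionFree (FockLaurent L) := isAddTorsionFree_of_algebra _
instance : IsAddTorsionFree (PowerSeries (FockPoly L)) := isAddTorsionFree_of_algebra _

/-! ### Integral forms of Laurent polynomials and Laurent series -/

section Forms

variable (L) in
/-- The integral form of the Laurent polynomials over the Fock space. -/
def integralPoly : Subring (FockPoly L) :=
  Subring.closure ({u | ∃ (α : L) (n : ℕ), u = LaurentPolynomial.C (coeff n (expMinus (toCartan α)))} ∪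
    Set.range LaurentPolynomial.T)

lemma T_mem_integralPoly (k : ℤ) : (LaurentPolynomial.T k : FockPoly L) ∈ integralPoly L :=
  Subring.subset_closure (Or.inr ⟨k, rfl⟩)

lemma C_expMinus_mem_integralPoly (α : L) (n : ℕ) :
    (LaurentPolynomial.C (coeff n (expMinus (toCartan α))) : FockPoly L) ∈ integralPoly L :=
  Subring.subset_closure (Or.inl ⟨α, n, rfl⟩)

lemma C_mem_integralPoly {P : Fock L} (hP : P ∈ integralFock L) :
    (LaurentPolynomial.C P : FockPoly L) ∈ integralPoly L := by
  have : integralFock L ≤ (integralPoly L).comap LaurentPolynomial.C := by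
    refine Subring.closure_le.2 ?_
    rintro _ ⟨α, n, rfl⟩
    exact C_expMinus_mem_integralPoly α n
  exact this hP

/-- The hypothesis on `f` concerns the whole series `E(α, z)`, because the images met below are
given by product formulas for that series, not coefficient by coefficient. -/
lemma integralPoly_le_comap {R : Type*} [CommRing R] (f : FockPoly L →+* R) (S : Subring R)
    (h1 : ∀ α : L, PowerSeries.map (f.comp LaurentPolynomial.C) (expMinus (toCartan α)) ∈
      coeffSubring S) (h2 : ∀ k, f (LaurentPolynomial.T k) ∈ S) {u : FockPoly L}
    (hu : u ∈ integralPoly L) : f u ∈ S := by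
  have : integralPoly L ≤ S.comap f := by
    refine Subring.closure_le.2 ?_
    rintro _ (⟨α, n, rfl⟩ | ⟨k, rfl⟩)
    · have := h1 α n
      rwa [coeff_map] at this
    · exact h2 k
  exact this hu

variable (L) in
/-- The integral form of the Laurent series over the Fock space. -/
def integralLaurent : Subring (FockLaurent L) where
  carrier := {f | ∀ n, f.coeff n ∈ integralFock L}
  mul_mem' {f g} hf hg n := by
    rw [HahnSeries.coeff_mul]
    exact sum_mem fun p _ => mul_mem (hf _) (hg _)
  one_mem' n := by
    rw [HahnSeries.coeff_one]; split_ifs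
    exacts [one_mem _, zero_mem _]
  add_mem' {f g} hf hg n := by rw [HahnSeries.coeff_add]; exact add_mem (hf n) (hg n)
  zero_mem' n := by rw [HahnSeries.coeff_zero]; exact zero_mem _
  neg_mem' {f} hf n := by rw [HahnSeries.coeff_neg]; exact neg_mem (hf n)

lemma single_mem_integralLaurent (k : ℤ) {P : Fock L} (hP : P ∈ integralFock L) :
    (HahnSeries.single k P : FockLaurent L) ∈ integralLaurent L := fun n => by
  rw [HahnSeries.coeff_single]; split_ifs
  exacts [hP, zero_mem _]

lemma ofPowerSeries_coeff_of_neg {R : Type*} [CommRing R] (f : R⟦X⟧) {n : ℤ} (hn : n < 0) :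
    (HahnSeries.ofPowerSeries ℤ R f).coeff n = 0 := by
  rw [HahnSeries.ofPowerSeries_apply]
  refine HahnSeries.embDomain_of_notMem_range ?_
  rintro ⟨m, hm⟩
  have : (m : ℤ) = n := hm
  omega

lemma ofPowerSeries_mem_integralLaurent {f : PowerSeries (Fock L)}
    (hf : f ∈ coeffSubring (integralFock L)) :
    HahnSeries.ofPowerSeries ℤ (Fock L) f ∈ integralLaurent L := fun n => by
  rcases lt_or_ge n 0 with hn | hn
  · rw [ofPowerSeries_coeff_of_neg f hn]; exact zero_mem _
  · obtain ⟨m, rfl⟩ := Int.eq_ofNat_of_zero_le hn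
    rw [HahnSeries.ofPowerSeries_apply_coeff]
    exact hf m

end Forms

section Series

lemma toSeries_C (P : Fock L) : toSeries (LaurentPolynomial.C P) = HahnSeries.single 0 P := by
  induction P using fock_induction with
  | hc c =>
    have : (LaurentPolynomial.C (algebraMap ℂ (Fock L) c) : FockPoly L) = algebraMap ℂ _ c := rfl
    rw [this, AlgHom.commutes]
    rfl
  | hg y => rw [toSeries, polyLift_C_ι]; rfl
  | hmul u v hu hv => rw [map_mul, map_mul, hu, hv, HahnSeries.single_mul_single, add_zero]
  | hadd u v hu hv => rw [map_add, map_add, hu, hv, HahnSeries.single_add]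

lemma toSeries_T (k : ℤ) : toSeries (LaurentPolynomial.T k : FockPoly L) =
    HahnSeries.single k 1 := by
  rw [toSeries, polyLift_T]
  have h : ∀ n : ℕ, ((unitX ^ n : (FockLaurent L)ˣ) : FockLaurent L) =
      HahnSeries.single (n : ℤ) 1 := by
    intro n
    rw [Units.val_pow_eq_pow_val]
    change (HahnSeries.single 1 1) ^ n = _
    rw [HahnSeries.single_pow]
    simp
  obtain ⟨n, rfl | rfl⟩ := k.eq_nat_or_neg
  · rw [zpow_natCast, h]
  · rw [zpow_neg, zpow_natCast, Units.inv_eq_of_mul_eq_one_right]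
    rw [h, HahnSeries.single_mul_single]
    simp

lemma toSeries_mem {u : FockPoly L} (hu : u ∈ integralPoly L) :
    toSeries u ∈ integralLaurent L := by
  refine integralPoly_le_comap toSeries.toRingHom (integralLaurent L) (fun α n => ?_) (fun k => ?_)
    hu
  · rw [coeff_map]
    change toSeries (LaurentPolynomial.C _) ∈ _
    rw [toSeries_C]
    exact single_mem_integralLaurent 0 (expMinus_mem_integralFock α n)
  · change toSeries _ ∈ _
    rw [toSeries_T]
    exact single_mem_integralLaurent k (one_mem _)

end Series

/-! ### The creation part and zero modes of normally ordered products -/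

section Creation

/-- The generating series of the operators `h(-n)`, `n ≥ 1`, in the normally ordered products. -/
def mulGen (l : Cartan L →ₗ[ℂ] ℂ) (h : Cartan L) : PowerSeries (FockLaurent L) :=
  mk fun n => mulField l (Finsupp.single n.succPNat h)

/-- The operators `(1/n!) (d/dx)ⁿ` are the Taylor coefficients of the shift `x ↦ x + y`; the mode
`h(-n-1)` carries the `n`-th one. -/
lemma createSeries_succ (n : ℕ) (h : Cartan L) :
    createSeries n.succPNat h = coeff n (taylor (createGen h)) := by
  ext i
  rw [coeff_taylor, createSeries]
  simp only [LinearMap.coe_mk, AddHom.coe_mk]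
  rw [coeff_mk, modeCoeff, createGen, coeff_mk]
  -- With `j = -(i + m)` and `m = n + 1`, the upper entry `-j - 1` of the binomial coefficient is `n
  -- + i`.
  have h1 : -(-((i : ℤ) + (n.succPNat : ℕ))) - 1 = ((n + i : ℕ) : ℤ) := by
    push_cast [Nat.succPNat_coe]; omega
  have h2 : ((n.succPNat : ℕ) - 1) = n := by simp
  have h3 : (⟨i + n.succPNat, Nat.add_pos_right i n.succPNat.pos⟩ : ℕ+) = (n + i).succPNat :=
    PNat.eq (by simp [Nat.succPNat_coe]; omega)
  have h4 : ((n.succPNat : ℕ+) : ℤ) = ((n.succPNat : ℕ) : ℤ) := by simp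
  rw [h4] at *
  rw [h1, h2, h3, Ring.choose_natCast, Int.cast_natCast, Nat.cast_smul_eq_nsmul, nsmul_eq_mul]

lemma modeCoeff_zero (n : ℕ) : modeCoeff n.succPNat 0 = (-1) ^ n := by
  have := coeff_onePlus_zpow (1 : ℤ) (-1) n
  rw [zpow_neg_one, coe_onePlus_inv, coeff_mk, one_pow, mul_one] at this
  simp only [Int.cast_id] at this
  rw [modeCoeff]
  simp [← this]

/-- As a series in `y`, `mulGen` is the creation part of `α(x + y)` plus the zero mode `k/(x + y)`.
Integrating from `0` to `y` and exponentiating gives `E(α, x+y)/E(α, x)` and `(1 + y/x)^k`. Both are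
integral, the second because `k` is an integer. -/
lemma exists_isExp_mulGen (l : Cartan L →ₗ[ℂ] ℂ) (α : L) (k : ℤ) (hk : l (toCartan α) = k) :
    ∃ H ∈ coeffSubring (integralLaurent L), IsExp (mulGen l (toCartan α)) H := by
  set j := HahnSeries.ofPowerSeries ℤ (Fock L) with hj
  have hs := isExp_expMinus (toCartan α)
  have hK := expMinus_mul_neg (toCartan α)
  have h1 := (hs.taylor hK).map j
  have h2 := isExp_onePlus_zpow (HahnSeries.single (-1) 1 : FockLaurent L) k
  have hm := expMinus_mem_integralFock α
  have hA : mulGen l (toCartan α) = PowerSeries.map j (taylor (createGen (toCartan α))) +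
      mk fun n => -(k * (-(HahnSeries.single (-1) 1 : FockLaurent L)) ^ (n + 1)) := by
    ext1 n
    rw [map_add, mulGen, coeff_mk, coeff_mk, coeff_map, mulField, Finsupp.lsum_single,
      LinearMap.add_apply, LinearMap.comp_apply, LinearMap.comp_apply, LinearMap.comp_apply,
      createSeries_succ]
    congr 1
    change HahnSeries.single _ (algebraMap ℂ (Fock L) (modeCoeff _ 0 * l _)) = _
    rw [hk, modeCoeff_zero, ← HahnSeries.single_neg, HahnSeries.single_pow]
    have : (k : FockLaurent L) = HahnSeries.single 0 (k : Fock L) := by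
      rw [← HahnSeries.C_apply, map_intCast]
    rw [this, HahnSeries.single_mul_single, ← HahnSeries.single_neg, zero_add]
    congr 1
    · simp [Nat.succPNat_coe]
    · simp [pow_succ, mul_comm]
  refine ⟨_, ?_, hA ▸ h1.mul h2⟩
  · refine mul_mem (fun n => ?_) (onePlus_zpow_mem (single_mem_integralLaurent _ (one_mem _)) k)
    rw [coeff_map]
    refine ofPowerSeries_mem_integralLaurent ?_
    rw [coeff_mul_C]
    refine mul_mem (taylor_mem hm n) ?_
    exact coeffSubring_inv hm hs.1 hK

end Creation

end LatticeVertex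
end

noncomputable section

namespace LatticeVertex

open PowerSeries

variable {L : Type*} [AddCommGroup L] (B : LinearMap.BilinForm ℤ L)

/-! ### Integrality of the annihilation exponential of a vertex operator -/

section ExpPlus

lemma C_create (n : ℕ+) (h : Cartan L) : (LaurentPolynomial.C (create n h) : FockPoly L) =
    LaurentPolynomial.C (gen (Finsupp.single n h)) := rfl

lemma T_pow_neg (n : ℕ) : (-(-LaurentPolynomial.T (-1) : FockPoly L)) ^ n =
    LaurentPolynomial.T (-(n : ℤ)) := by
  rw [neg_neg, LaurentPolynomial.T_pow]
  congr 1
  ring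

/-- The rule `E⁺(-h, x) E(g, z) = E(g, z) (1 - z/x)^⟨h,g⟩`. In the logarithmic derivative in `z` it
says that `g(-n)` is shifted by `-⟨h,g⟩ x⁻ⁿ`, which defines `expPlus`. -/
lemma map_expPlus_expMinus {h g : Cartan L} {k : ℤ} (hk : form B h g = k) :
    PowerSeries.map ((expPlus B h).toRingHom.comp LaurentPolynomial.C) (expMinus g) =
      PowerSeries.map LaurentPolynomial.C (expMinus g) *
        ((onePlus (-LaurentPolynomial.T (-1)) ^ k : ((FockPoly L)⟦X⟧)ˣ) : (FockPoly L)⟦X⟧) := by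
  refine ((isExp_expMinus g).map _).unique ?_
  convert ((isExp_expMinus g).map LaurentPolynomial.C).mul
    (isExp_onePlus_zpow (-LaurentPolynomial.T (-1)) k) using 1
  ext1 n
  rw [map_add, coeff_map, coeff_map, coeff_mk, createGen, coeff_mk, T_pow_neg]
  change expPlus B h (LaurentPolynomial.C _) = _
  rw [C_create, expPlus_C_gen, annFun_single, hk, expPlusCoeff, smul_smul, Nat.succPNat_coe]
  congr 1
  have hn : ((n.succ : ℕ) : ℂ) ≠ 0 := by exact_mod_cast Nat.succ_ne_zero n
  rw [mul_comm, ← mul_assoc, neg_mul, inv_mul_cancel₀ hn, neg_one_mul, neg_smul, Int.cast_smul_eq_zsmul,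
    zsmul_eq_mul]

lemma expPlus_T (h : Cartan L) (k : ℤ) :
    expPlus B h (LaurentPolynomial.T k) = LaurentPolynomial.T k := by
  rw [expPlus, polyLift_T, unitT_zpow]

lemma neg_T_mem_integralPoly (k : ℤ) :
    (-LaurentPolynomial.T k : FockPoly L) ∈ integralPoly L :=
  neg_mem (T_mem_integralPoly k)

lemma expPlus_mem (α : L) {u : FockPoly L} (hu : u ∈ integralPoly L) :
    expPlus B (toCartan α) u ∈ integralPoly L := by
  refine integralPoly_le_comap (expPlus B (toCartan α)).toRingHom (integralPoly L) (fun β => ?_)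
    (fun k => ?_) hu
  · rw [map_expPlus_expMinus B (form_toCartan B α β)]
    refine mul_mem (fun n => ?_) (onePlus_zpow_mem (neg_T_mem_integralPoly _) _)
    rw [coeff_map]
    exact C_expMinus_mem_integralPoly β n
  · change expPlus B _ _ ∈ _
    rw [expPlus_T]
    exact T_mem_integralPoly k

end ExpPlus

/-! ### The annihilation part of normally ordered products -/

section Annihilation

lemma annField_single (h : Cartan L) (m n : ℕ+) (g : Cartan L) :
    annField B (Finsupp.single m h) (LaurentPolynomial.C (gen (Finsupp.single n g))) =
      (n * form B h g * modeCoeff m n : ℂ) • LaurentPolynomial.T (-(n : ℤ) - m) := by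
  rw [annField, Finsupp.lsum_single, annSeries_C_gen, annFun_single, smul_smul]

/-- The exponential of the generating series of the annihilation operators. -/
def annExp (h : Cartan L) : FockPoly L →ₐ[ℂ] (FockPoly L)⟦X⟧ :=
  polyLift
    -- The factor `1/(n+1)` and the shift by `X` integrate the generating series from `0`. The
    -- exponential stops after the linear term on generators, because the annihilation fields send
    -- these to combinations of powers of `x`, which they kill.
    { toFun := fun y => C (LaurentPolynomial.C (gen y)) + X * mk fun n =>
        ((n : ℂ) + 1)⁻¹ • annField B (Finsupp.single n.succPNat h) (LaurentPolynomial.C (gen y))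
      map_add' := fun y z => by
        ext n : 1
        cases n with
        | zero => simp
        | succ n => simp only [map_add, coeff_succ_X_mul, coeff_mk, smul_add]; ring
      map_smul' := fun r y => by
        have hr : (LaurentPolynomial.C (gen (r • y)) : FockPoly L) =
            r • LaurentPolynomial.C (gen y) := by
          rw [map_smul]
          exact (AddMonoidAlgebra.smul_single r (0 : ℤ) (gen y)).symm
        ext n : 1
        rw [hr]
        cases n with
        | zero => simp
        | succ n =>
          simp only [map_add, coeff_succ_X_mul, coeff_mk, smul_add, Derivation.map_smul,
            coeff_C, RingHom.id_apply, coeff_smul]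
          simp [smul_comm r] }
    (Units.map (C : FockPoly L →+* _) (unitT (Fock L)))

lemma annExp_T (h : Cartan L) (k : ℤ) :
    annExp B h (LaurentPolynomial.T k) = C (LaurentPolynomial.T k) := by
  rw [annExp, polyLift_T, ← map_zpow]
  change C ((unitT (Fock L) ^ k : (FockPoly L)ˣ) : FockPoly L) = _
  rw [unitT_zpow]

lemma annExp_C_gen (h : Cartan L) (y : HeisMinus L) : annExp B h (LaurentPolynomial.C (gen y)) =
    C (LaurentPolynomial.C (gen y)) + X * mk fun n =>
        ((n : ℂ) + 1)⁻¹ • annField B (Finsupp.single n.succPNat h) (LaurentPolynomial.C (gen y)) := by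
  rw [annExp, polyLift_C_ι]
  rfl

lemma annExp_annField (h : Cartan L) (y z : HeisMinus L) :
    annExp B h (annField B y (LaurentPolynomial.C (gen z))) =
      C (annField B y (LaurentPolynomial.C (gen z))) := by
  have hsm : ∀ (c : ℂ) (u : FockPoly L), annExp B h u = C u → annExp B h (c • u) = C (c • u) := by
    intro c u hu
    rw [map_smul, hu]
    ext n : 1
    simp [coeff_C]
  induction y using Finsupp.induction_linear with
  | zero => simp
  | add y₁ y₂ h₁ h₂ => simp only [map_add, Derivation.add_apply, h₁, h₂]
  | single m g =>
    induction z using Finsupp.induction_linear with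
    | zero => simp
    | add y₁ y₂ h₁ h₂ => simp only [map_add, h₁, h₂]
    | single n g' =>
      rw [annField_single]
      exact hsm _ _ (annExp_T B h _)

lemma constantCoeff_annExp (h : Cartan L) (u : FockPoly L) :
    constantCoeff (annExp B h u) = u := by
  induction u using poly_induction with
  | hι y => rw [annExp_C_gen]; simp
  | hc c => rw [AlgHom.commutes]; simp [PowerSeries.algebraMap_apply]
  | hT k => rw [annExp_T, constantCoeff_C]
  | hadd u v hu hv => rw [map_add, map_add, hu, hv]
  | hmul u v hu hv => rw [map_mul, map_mul, hu, hv]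

/-- The differential equation of the exponential. The exponent depends on the same variable as the
exponential, hence the diagonal. Both sides satisfy the product rule along `annExp`, so generators
suffice. -/
lemma derivative_annExp (h : Cartan L) (u : FockPoly L) :
    d⁄dX _ (annExp B h u) =
      diagonal fun n => annExp B h (annField B (Finsupp.single n.succPNat h) u) := by
  induction u using poly_induction with
  | hι y =>
    simp only [annExp_annField]
    rw [diagonal_C, annExp_C_gen]
    ext n : 1
    rw [coeff_derivative, map_add, coeff_succ_X_mul, coeff_mk, coeff_mk, coeff_C,
      if_neg (Nat.succ_ne_zero n), zero_add, mul_comm]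
    have : ((n : FockPoly L) + 1) = algebraMap ℂ _ ((n : ℂ) + 1) := by simp
    have hn : (n : ℂ) + 1 ≠ 0 := by exact_mod_cast Nat.succ_ne_zero n
    rw [this, ← Algebra.smul_def, smul_smul, mul_inv_cancel₀ hn, one_smul]
  | hc c =>
    simp only [AlgHom.commutes, Derivation.map_algebraMap, map_zero]
    have : algebraMap ℂ (FockPoly L)⟦X⟧ c = C (algebraMap ℂ _ c) := PowerSeries.algebraMap_apply
    rw [this, derivative_C]
    ext n : 1
    rw [coeff_diagonal, map_zero]
    simp
  | hT k =>
    rw [annExp_T, derivative_C]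
    ext n : 1
    simp [coeff_diagonal, annField_T]
  | hadd u v hu hv => simp only [map_add, hu, hv, diagonal_add]
  | hmul u v hu hv =>
    rw [map_mul, derivative_mul, hu, hv]
    simp only [Derivation.leibniz, smul_eq_mul, map_add, map_mul, diagonal_add]
    rw [mul_comm (annExp B h u), mul_comm (annExp B h v), ← diagonal_mul, ← diagonal_mul]
    simp only [mul_comm]

/-- The inverse of `x + y`, as a power series in `y`. -/
def invShift : (FockPoly L)⟦X⟧ :=
  C (LaurentPolynomial.T (-1)) *
    ((onePlus (LaurentPolynomial.T (-1)) ^ (-1 : ℤ) : ((FockPoly L)⟦X⟧)ˣ) : (FockPoly L)⟦X⟧)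

/-- The expansion of `(x + y)^(-m)` in powers of `y`. -/
lemma coeff_invShift_pow (m n : ℕ) : coeff n ((invShift : (FockPoly L)⟦X⟧) ^ m) =
    (Ring.choose (-m : ℤ) n : ℤ) * (LaurentPolynomial.T (-(m : ℤ) - n) : FockPoly L) := by
  rw [invShift, mul_pow, ← map_pow, coeff_C_mul, ← Units.val_pow_eq_pow_val, ← zpow_natCast,
    ← zpow_mul, coeff_onePlus_zpow, LaurentPolynomial.T_pow, LaurentPolynomial.T_pow, mul_left_comm,
    ← LaurentPolynomial.T_add]
  congr 2
  · simp
  · ring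

/-- Integrating the annihilation part of `h(x + y)` over `y` gives the difference of the exponents
of `E⁺` at `x + y` and at `x`. So `E(g, z)` acquires the factor `(1 - z/(x+y))^k` divided by `(1 -
z/x)^k`. -/
lemma map_annExp_expMinus {h g : Cartan L} {k : ℤ} (hk : form B h g = k) :
    PowerSeries.map ((annExp B h).toRingHom.comp LaurentPolynomial.C) (expMinus g) =
      PowerSeries.map (C.comp LaurentPolynomial.C) (expMinus g) *
        (((onePlus (-invShift) ^ k : ((FockPoly L)⟦X⟧⟦X⟧)ˣ) : (FockPoly L)⟦X⟧⟦X⟧) *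
          ((onePlus (-C (LaurentPolynomial.T (-1))) ^ (-k) : ((FockPoly L)⟦X⟧⟦X⟧)ˣ) :
            (FockPoly L)⟦X⟧⟦X⟧)) := by
  refine ((isExp_expMinus g).map _).unique ?_
  convert ((isExp_expMinus g).map (C.comp LaurentPolynomial.C)).mul
    ((isExp_onePlus_zpow (-invShift) k).mul
      (isExp_onePlus_zpow (-C (LaurentPolynomial.T (-1))) (-k))) using 1
  ext1 m
  rw [map_add, map_add, coeff_map, coeff_map, coeff_mk, coeff_mk, createGen, coeff_mk, neg_neg,
    neg_neg]
  change annExp B h (LaurentPolynomial.C _) = C (LaurentPolynomial.C _) + _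
  rw [C_create, annExp_C_gen]
  congr 1
  have hT : (C (LaurentPolynomial.T (-1)) : (FockPoly L)⟦X⟧) ^ (m + 1) =
      C (LaurentPolynomial.T (-(m + 1 : ℤ))) := by
    rw [← map_pow, LaurentPolynomial.T_pow]
    congr 2
    push_cast; ring
  have hC : ∀ z : ℤ, (z : (FockPoly L)⟦X⟧) = C (z : FockPoly L) := fun z => by simp
  rw [hT]
  ext1 n
  rw [map_add, map_neg, map_neg, hC, hC, coeff_C_mul, coeff_C_mul, coeff_invShift_pow]
  cases n with
  -- At `y = 0` the two binomial factors cancel.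
  | zero =>
    rw [coeff_zero_X_mul, Ring.choose_zero_right, coeff_C, if_pos rfl]
    push_cast
    simp
  | succ n =>
    rw [coeff_succ_X_mul, coeff_mk, annField_single, hk, coeff_C, if_neg (Nat.succ_ne_zero n),
      mul_zero, neg_zero, add_zero, smul_smul, modeCoeff, Nat.succPNat_coe, Nat.succPNat_coe]
    -- With `r = -(m+1)`, the identity `(n+1) binom(r, n+1) = r binom(r-1, n)` absorbs the
    -- denominator `n + 1` left by the integration.
    have h1 := succ_mul_choose (-((m + 1 : ℕ) : ℤ)) n
    have h2 : ((n + 1 : ℂ)) * (Ring.choose (-((m + 1 : ℕ) : ℤ)) (n + 1) : ℤ) =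
        -((m + 1 : ℕ) : ℂ) * (Ring.choose (-((m + 1 : ℕ) : ℤ) - 1) n : ℤ) := by
      exact_mod_cast congrArg (Int.cast : ℤ → ℂ) h1
    have hn : (n : ℂ) + 1 ≠ 0 := by exact_mod_cast Nat.succ_ne_zero n
    have h3 : ((n : ℂ) + 1)⁻¹ * (((m.succ : ℕ) : ℂ) * k *
        ((Ring.choose (-((m.succ : ℕ) : ℤ) - 1) (n.succ - 1) : ℤ) : ℂ)) =
        ((-(k * Ring.choose (-((m + 1 : ℕ) : ℤ)) (n + 1)) : ℤ) : ℂ) := by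
      rw [inv_mul_eq_iff_eq_mul₀ hn]
      push_cast at h2 ⊢
      linear_combination (k : ℂ) * h2
    rw [h3, Int.cast_smul_eq_zsmul, zsmul_eq_mul]
    push_cast
    ring

lemma annExp_mem (α : L) {u : FockPoly L} (hu : u ∈ integralPoly L) :
    annExp B (toCartan α) u ∈ coeffSubring (integralPoly L) := by
  have hC : ∀ v ∈ integralPoly L, C v ∈ coeffSubring (integralPoly L) := by
    intro v hv n
    rw [coeff_C]; split_ifs
    exacts [hv, zero_mem _]
  refine integralPoly_le_comap (annExp B (toCartan α)).toRingHom (coeffSubring (integralPoly L))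
    (fun β => ?_) (fun k => ?_) hu
  · rw [map_annExp_expMinus B (form_toCartan B α β)]
    have hw : (invShift : (FockPoly L)⟦X⟧) ∈ coeffSubring (integralPoly L) :=
      mul_mem (hC _ (T_mem_integralPoly _)) (onePlus_zpow_mem (T_mem_integralPoly _) _)
    refine mul_mem (fun n => ?_) (mul_mem (onePlus_zpow_mem (neg_mem hw) _)
      (onePlus_zpow_mem (neg_mem (hC _ (T_mem_integralPoly _))) _))
    rw [coeff_map]
    exact hC _ (C_expMinus_mem_integralPoly β n)
  · change annExp B _ _ ∈ _
    rw [annExp_T]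
    exact hC _ (T_mem_integralPoly k)

end Annihilation

/-! ### Normally ordered products on generating series -/

section NormalOrder

lemma normalOrder_gen (l : Cartan L →ₗ[ℂ] ℂ) (y : HeisMinus L) :
    normalOrder B l (gen y) = normalStep B l y := by
  unfold normalOrder
  exact fockLiftOfComm_gen (A := Module.End ℂ (FockPoly L →ₗ[ℂ] FockLaurent L)) _ _ y

lemma mapCoeff_diagonal {R R' : Type*} [CommRing R] [CommRing R'] [Algebra ℂ R] [Algebra ℂ R']
    (F : R →ₗ[ℂ] R') (f : ℕ → R⟦X⟧) :
    mapCoeff F (diagonal f) = diagonal fun n => mapCoeff F (f n) := by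
  ext n
  simp [mapCoeff, coeff_diagonal, map_sum]

lemma derivative_mapCoeff {R R' : Type*} [CommRing R] [CommRing R'] [Algebra ℂ R] [Algebra ℂ R']
    (F : R →ₗ[ℂ] R') (f : R⟦X⟧) :
    d⁄dX R' (mapCoeff F f) = mapCoeff F (d⁄dX R f) := by
  ext n
  rw [coeff_derivative, mapCoeff, mapCoeff, coeff_mk, coeff_mk, coeff_derivative]
  have := map_nsmul F (n + 1) (coeff (n + 1) f)
  rw [nsmul_eq_mul, nsmul_eq_mul, mul_comm, mul_comm _ (F _)] at this
  push_cast at this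
  exact this.symm

/-- Summed over `n` against `yⁿ`, both sides solve the same differential equation: `E(h, y)` has
logarithmic derivative `createGen h`, and each generator contributes a left multiplication (the
logarithmic derivative of `H`) plus a precomposition (the one of `annExp`). The induction runs over
all `u` at once, since the annihilation fields change `u`. -/
lemma normalOrder_expMinus (l : Cartan L →ₗ[ℂ] ℂ) (h : Cartan L) {H : (FockLaurent L)⟦X⟧}
    (hH : IsExp (mulGen l h) H) (F : FockPoly L →ₗ[ℂ] FockLaurent L) (n : ℕ) (u : FockPoly L) :
    normalOrder B l (coeff n (expMinus h)) F u = coeff n (H * mapCoeff F (annExp B h u)) := by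
  induction n using Nat.strong_induction_on generalizing u with
  | _ n ih =>
    cases n with
    | zero =>
      rw [coeff_zero_eq_constantCoeff_apply, (isExp_expMinus h).1, map_one,
        coeff_zero_eq_constantCoeff_apply, map_mul, hH.1, one_mul,
        ← coeff_zero_eq_constantCoeff_apply, mapCoeff, coeff_mk,
        coeff_zero_eq_constantCoeff_apply, constantCoeff_annExp]
      rfl
    | succ n =>
      -- Differentiation multiplies the coefficient by `n + 1`; the factor is cancelled at the end,
      -- by torsion-freeness.
      have h1 : normalOrder B l (coeff (n + 1) (expMinus h) * ((n + 1 : ℕ) : Fock L)) F u =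
          coeff (n + 1) (H * mapCoeff F (annExp B h u)) * ((n + 1 : ℕ) : FockLaurent L) := by
        have h2 := (isExp_expMinus h).coeff_succ n
        push_cast
        rw [h2, ← coeff_derivative, derivative_mul, hH.2,
          derivative_mapCoeff F (annExp B h u), derivative_annExp,
          mapCoeff_diagonal, mul_comm H, ← diagonal_mul, map_add, coeff_diagonal, mul_comm (mapCoeff _ _),
          mul_assoc, coeff_mul, map_sum, LinearMap.sum_apply, LinearMap.sum_apply, add_comm,
          ← Finset.sum_add_distrib]
        refine Finset.sum_congr rfl fun p hp => ?_
        have hp2 : p.2 < n + 1 :=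
          Nat.lt_succ_of_le (Finset.HasAntidiagonal.antidiagonal.snd_le hp)
        rw [map_mul, createGen, coeff_mk]
        change (normalOrder B l (gen (Finsupp.single _ h)) * _) F u = _
        rw [normalOrder_gen, Module.End.mul_apply, normalStep_apply, ih _ hp2, ih _ hp2, mulGen,
          coeff_mk, mul_comm H (mapCoeff _ _), mul_comm H (mapCoeff _ _)]
      have h3 : ∀ P : Fock L, normalOrder B l (P * ((n + 1 : ℕ) : Fock L)) F u =
          (n + 1) • normalOrder B l P F u := by
        intro P
        rw [mul_comm, ← nsmul_eq_mul, map_nsmul]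
        rfl
      rw [h3, mul_comm, ← nsmul_eq_mul] at h1
      exact nsmul_right_injective (Nat.succ_ne_zero n) h1

/-- A product `x * y` acts by applying `x` to the field already modified by `y`, so the statement is
proved for every field preserving integrality. -/
lemma normalOrder_mem {l : Cartan L →ₗ[ℂ] ℂ} (hl : ∀ α : L, ∃ k : ℤ, l (toCartan α) = k)
    {P : Fock L} (hP : P ∈ integralFock L) (F : FockPoly L →ₗ[ℂ] FockLaurent L)
    (hF : ∀ u ∈ integralPoly L, F u ∈ integralLaurent L) {u : FockPoly L}
    (hu : u ∈ integralPoly L) : normalOrder B l P F u ∈ integralLaurent L := by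
  induction hP using Subring.closure_induction generalizing F u with
  | mem x hx =>
    obtain ⟨α, n, rfl⟩ := hx
    obtain ⟨k, hk⟩ := hl α
    obtain ⟨H, hHm, hH⟩ := exists_isExp_mulGen l α k hk
    rw [normalOrder_expMinus B l _ hH]
    refine (mul_mem hHm fun m => ?_ : _ ∈ coeffSubring (integralLaurent L)) n
    rw [mapCoeff, coeff_mk]
    exact hF _ (annExp_mem B α hu m)
  | zero => rw [map_zero]; exact zero_mem _
  | one => rw [map_one]; exact hF u hu
  | add x y _ _ hx hy => rw [map_add]; exact add_mem (hx F hF hu) (hy F hF hu)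
  | neg x _ hx => rw [map_neg]; exact neg_mem (hx F hF hu)
  | mul x y _ _ hx hy =>
    rw [map_mul, Module.End.mul_apply]
    exact hx _ (fun v hv => hy F hF hv) hu

end NormalOrder

/-! ### Integrality of the modes -/

section Modes

namespace CentralExtension

variable {B} {G : Type*} [Group G] {E : CentralExtension B G}

lemma exists_deg_eq (a : E.Coset 0) : ∃ α : L, toDual B α = E.deg a.1 := by
  obtain ⟨α, hα⟩ := a.2
  exact ⟨α, by rw [hα, sub_zero]⟩

lemma iotaField_mem {β : dualLattice B} (a : E.Coset 0) (g : E.Coset β) {u : FockPoly L}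
    (hu : u ∈ integralPoly L) : iotaField a g u ∈ integralLaurent L := by
  obtain ⟨α, hα⟩ := exists_deg_eq a
  rw [iotaField, ← hα]
  refine mul_mem (mul_mem (single_mem_integralLaurent _ (one_mem _))
    (ofPowerSeries_mem_integralLaurent (expMinus_mem_integralFock α))) ?_
  exact toSeries_mem (expPlus_mem B α hu)

lemma fockMode_mem (n : ℤ) {β : dualLattice B} (a : E.Coset 0) (g : E.Coset β) {P Q : Fock L}
    (hP : P ∈ integralFock L) (hQ : Q ∈ integralFock L) :
    fockMode n a g P Q ∈ integralFock L := by
  refine normalOrder_mem B (fun α => ?_) hP _ (fun u hu => iotaField_mem a g hu)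
    (C_mem_integralPoly hQ) _
  -- The zero modes are integers because `g` lies over the dual lattice.
  exact (E.deg g.1).2 α

end CentralExtension

end Modes

end LatticeVertex
end

noncomputable section

namespace LatticeVertex

open PowerSeries

variable {L : Type*} [AddCommGroup L] (B : LinearMap.BilinForm ℤ L)

/-! ### Filtration of the integral Fock space by the number of generators -/

section Generation

/-- The Laurent polynomials with coefficients in a subgroup of the Fock space. -/
def laurentSpan (N : Submodule ℤ (Fock L)) : Submodule ℤ (FockPoly L) :=
  Submodule.span ℤ {u | ∃ Q ∈ N, ∃ m : ℤ, u = LaurentPolynomial.C Q * LaurentPolynomial.T m}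

lemma laurentSpan_mul_mem {N N' : Submodule ℤ (Fock L)} {u v : FockPoly L}
    (hu : u ∈ laurentSpan N) (hv : v ∈ laurentSpan N') : u * v ∈ laurentSpan (N * N') := by
  have h := Submodule.mul_mem_mul hu hv
  rw [laurentSpan, laurentSpan, Submodule.span_mul_span] at h
  refine Submodule.span_mono ?_ h
  rintro _ ⟨_, ⟨P, hP, m, rfl⟩, _, ⟨Q, hQ, m', rfl⟩, rfl⟩
  refine ⟨P * Q, Submodule.mul_mem_mul hP hQ, m + m', ?_⟩
  rw [map_mul, LaurentPolynomial.T_add]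
  ring

variable (L) in
/-- The span of the generators of the integral form of the Fock space. -/
def generatorSpan : Submodule ℤ (Fock L) :=
  Submodule.span ℤ {P | ∃ (α : L) (n : ℕ), P = coeff n (expMinus (toCartan α))}

lemma one_mem_generatorSpan : (1 : Fock L) ∈ generatorSpan L :=
  Submodule.subset_span ⟨0, 0, by rw [map_zero, expMinus_zero, coeff_zero_one]⟩

/-- By the factor `(1 - z/x)^⟨γ,α⟩`, a generator `s_n(α)` goes to an integral combination of `s_p(α)
x^{p-n}`, `p ≤ n`: it stays linear in the generators. The filtration by number of factors is
therefore stable. -/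
lemma expPlus_mem_laurentSpan (γ : L) {Q : Fock L} (hQ : Q ∈ generatorSpan L) :
    expPlus B (toCartan γ) (LaurentPolynomial.C Q) ∈ laurentSpan (generatorSpan L) := by
  induction hQ using Submodule.span_induction with
  | mem x hx =>
    obtain ⟨α, n, rfl⟩ := hx
    have h := congrArg (coeff n) (map_expPlus_expMinus B (form_toCartan B γ α))
    rw [coeff_map, coeff_mul] at h
    change expPlus B _ _ = _ at h
    rw [h]
    refine sum_mem fun p _ => ?_
    rw [coeff_map, coeff_onePlus_zpow, neg_pow, LaurentPolynomial.T_pow]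
    have : (LaurentPolynomial.C (coeff p.1 (expMinus (toCartan α))) : FockPoly L) *
        (((Ring.choose (B γ α) p.2 : ℤ) : FockPoly L) * ((-1) ^ p.2 *
          LaurentPolynomial.T (p.2 * -1))) = (Ring.choose (B γ α) p.2 * (-1) ^ p.2 : ℤ) •
        (LaurentPolynomial.C (coeff p.1 (expMinus (toCartan α))) *
          LaurentPolynomial.T (p.2 * -1)) := by
      rw [zsmul_eq_mul]
      push_cast
      ring
    rw [this]
    exact Submodule.smul_mem _ _ (Submodule.subset_span
      ⟨_, Submodule.subset_span ⟨α, p.1, rfl⟩, _, rfl⟩)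
  | zero => rw [map_zero, map_zero]; exact zero_mem _
  | add x y _ _ hx hy => rw [map_add, map_add]; exact add_mem hx hy
  | smul k x _ hx => rw [map_zsmul, map_zsmul]; exact Submodule.smul_mem _ _ hx

lemma expPlus_mem_laurentSpan_pow (γ : L) (k : ℕ) {Q : Fock L} (hQ : Q ∈ generatorSpan L ^ k) :
    expPlus B (toCartan γ) (LaurentPolynomial.C Q) ∈ laurentSpan (generatorSpan L ^ k) := by
  induction k generalizing Q with
  | zero =>
    rw [pow_zero] at hQ ⊢
    obtain ⟨z, rfl⟩ := Submodule.mem_one.1 hQ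
    rw [eq_intCast, map_intCast, map_intCast]
    refine Submodule.subset_span ⟨_, hQ, 0, ?_⟩
    simp
  | succ k ih =>
    rw [pow_succ'] at hQ ⊢
    induction hQ using Submodule.mul_induction_on' with
    | mem_mul_mem m hm n hn =>
      rw [map_mul, map_mul]
      exact laurentSpan_mul_mem (expPlus_mem_laurentSpan B γ hm) (ih hn)
    | add x _ y _ hx hy => rw [map_add, map_add]; exact add_mem hx hy

lemma generatorSpan_pow_le {k l : ℕ} (h : k ≤ l) : generatorSpan L ^ k ≤ generatorSpan L ^ l := by
  induction l, h using Nat.le_induction with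
  | base => exact le_rfl
  | succ l _ ih =>
    refine ih.trans fun x hx => ?_
    rw [pow_succ', ← one_mul x]
    exact Submodule.mul_mem_mul one_mem_generatorSpan hx

lemma exists_mem_generatorSpan_pow {Q : Fock L} (hQ : Q ∈ integralFock L) :
    ∃ k, Q ∈ generatorSpan L ^ k := by
  induction hQ using Subring.closure_induction with
  | mem x hx => exact ⟨1, by rw [pow_one]; exact Submodule.subset_span hx⟩
  | zero => exact ⟨0, zero_mem _⟩
  | one => exact ⟨0, by rw [pow_zero]; exact Submodule.one_le.1 le_rfl⟩
  | add x y _ _ hx hy =>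
    obtain ⟨k, hk⟩ := hx
    obtain ⟨l, hl⟩ := hy
    exact ⟨max k l, add_mem (generatorSpan_pow_le (le_max_left _ _) hk)
      (generatorSpan_pow_le (le_max_right _ _) hl)⟩
  | neg x _ hx => obtain ⟨k, hk⟩ := hx; exact ⟨k, neg_mem hk⟩
  | mul x y _ _ hx hy =>
    obtain ⟨k, hk⟩ := hx
    obtain ⟨l, hl⟩ := hy
    exact ⟨k + l, by rw [pow_add]; exact Submodule.mul_mem_mul hk hl⟩

lemma expPlus_annFun (h h' : Cartan L) (y : HeisMinus L) :
    expPlus B h (annFun B expPlusCoeff h' y) = annFun B expPlusCoeff h' y := by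
  induction y using Finsupp.induction_linear with
  | zero => simp
  | add y₁ y₂ h₁ h₂ => rw [map_add, map_add, h₁, h₂]
  | single n g => rw [annFun_single, expPlusCoeff, map_smul, map_smul, expPlus_T]

lemma expPlus_expPlus_neg (h : Cartan L) (u : FockPoly L) :
    expPlus B h (expPlus B (-h) u) = u := by
  induction u using poly_induction with
  | hι y =>
    rw [expPlus_C_gen, map_add, expPlus_C_gen, expPlus_annFun, map_neg, LinearMap.neg_apply]
    ring
  | hc c => rw [AlgHom.commutes, AlgHom.commutes]
  | hT k => rw [expPlus_T, expPlus_T]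
  | hadd u v hu hv => rw [map_add, map_add, hu, hv]
  | hmul u v hu hv => rw [map_mul, map_mul, hu, hv]

end Generation

namespace CentralExtension

variable {B} {G : Type*} [Group G] {E : CentralExtension B G}

/-! ### Representatives of the cosets in the central extension -/

section Representatives

lemma root_ne_zero : E.root ≠ 0 := E.root_primitive.ne_zero E.s_pos.ne'

lemma κ_zpow_central (c : ℤ) (g : G) : E.κ ^ c * g = g * E.κ ^ c :=
  ((show Commute E.κ g from E.κ_central g).zpow_left c).eq

lemma deg_κ_zpow (c : ℤ) : E.deg (E.κ ^ c) = 0 := by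
  have : E.κ ^ c ∈ E.bar.ker := by rw [E.ker_bar]; exact ⟨c, rfl⟩
  rw [MonoidHom.mem_ker] at this
  rw [deg, this]
  rfl

lemma tw_zpow {β : dualLattice B} (g g' : E.Coset β) (c : ℤ) (h : g'.1 = E.κ ^ c * g.1) :
    tw g' = E.root ^ c • tw g := by
  induction c using Int.induction_on generalizing g' with
  | zero =>
    rw [zpow_zero, one_smul]
    rw [zpow_zero, one_mul] at h
    rw [Subtype.ext h]
  | succ n ih =>
    let k : E.Coset β := ⟨E.κ ^ (n : ℤ) * g.1, by
      rw [deg_mul, deg_κ_zpow, zero_add]; exact g.2⟩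
    have hk : g' = kap k := Subtype.ext (by
      rw [h]; change _ = E.κ * (E.κ ^ (n : ℤ) * g.1)
      rw [← mul_assoc, zpow_add_one, E.κ_central])
    rw [hk, tw_kap, ih k rfl, smul_smul, zpow_add_one₀ root_ne_zero, mul_comm]
  | pred n ih =>
    have hk := ih (kap g') (by
      change E.κ * g'.1 = _
      rw [h, ← mul_assoc, ← zpow_one_add, add_sub_cancel])
    rw [tw_kap] at hk
    rw [zpow_sub_one₀ root_ne_zero, mul_comm, ← smul_smul, ← hk, smul_smul,
      inv_mul_cancel₀ root_ne_zero, one_smul]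

variable (E) in
/-- The representative `e_α e_β` of the class of `α + β`. -/
def cosetRep (β : dualLattice B) (α : L) : E.Coset β := act (E.secLattice α) (E.secCoset β)

lemma coe_cosetRep (β : dualLattice B) (α : L) :
    (E.cosetRep β α).1 = E.e (toDual B α) * E.e β := rfl

lemma deg_cosetRep (β : dualLattice B) (α : L) :
    E.deg (E.cosetRep β α).1 = toDual B α + β := by
  rw [coe_cosetRep, deg_mul, deg_e, deg_e]

lemma cosetRep_zero_left (α : L) : E.cosetRep 0 α = E.secLattice α :=
  Subtype.ext (by rw [coe_cosetRep, E.e_zero, mul_one]; rfl)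

lemma cosetRep_zero_right (β : dualLattice B) : E.cosetRep β 0 = E.secCoset β :=
  Subtype.ext (by rw [coe_cosetRep, map_zero, E.e_zero, one_mul]; rfl)

/-- Associativity moves the product into `e_α e_α'`, where the cocycle is a sign. Taking `e_α e_β`
and not `e_{α+β}` as representative avoids any cocycle outside `L`. -/
lemma tw_act_cosetRep (β : dualLattice B) (α α' : L) :
    tw (act (E.secLattice α) (E.cosetRep β α')) = tw (E.cosetRep β (α + α')) ∨
      tw (act (E.secLattice α) (E.cosetRep β α')) = -tw (E.cosetRep β (α + α')) := by
  obtain ⟨c, hc, hr⟩ := E.cocycle α α'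
  have h := tw_zpow (E.cosetRep β (α + α')) (act (E.secLattice α) (E.cosetRep β α')) c (by
    change E.e (toDual B α) * (E.e (toDual B α') * E.e β) =
      E.κ ^ c * (E.e (toDual B (α + α')) * E.e β)
    rw [← mul_assoc, hc, ← mul_assoc, κ_zpow_central])
  rcases hr with hr | hr
  · left; rw [h, hr, one_smul]
  · right; rw [h, hr, neg_one_smul]

lemma tens_act_mem_iff {β : dualLattice B} (M : AddSubgroup (E.LatticeModule β)) (α α' : L)
    (Q : Fock L) : tens Q (tw (act (E.secLattice α) (E.cosetRep β α'))) ∈ M ↔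
      tens Q (tw (E.cosetRep β (α + α'))) ∈ M := by
  rcases tw_act_cosetRep (E := E) β α α' with h | h
  · rw [h]
  · rw [h, map_neg, neg_mem_iff]

end Representatives

/-! ### Identification of the generated subring and submodules -/

section IntegralSpan

variable (E) in
/-- The subgroup of `V_{β+L}` spanned by the products of integral elements of the Fock space and
the vectors `ι(e_α e_β)`. -/
def integralSpan (β : dualLattice B) : AddSubgroup (E.LatticeModule β) :=
  AddSubgroup.closure {v | ∃ P ∈ integralFock L, ∃ α, v = tens P (tw (E.cosetRep β α))}

lemma tens_mem_integralSpan {β : dualLattice B} {P : Fock L} (hP : P ∈ integralFock L) (α : L) :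
    tens P (tw (E.cosetRep β α)) ∈ E.integralSpan β :=
  AddSubgroup.subset_closure ⟨P, hP, α, rfl⟩

lemma nthProduct_mem_integralSpan {β : dualLattice B} (n : ℤ) {u : E.LatticeAlgebra}
    (hu : u ∈ E.integralSpan 0) {w : E.LatticeModule β} (hw : w ∈ E.integralSpan β) :
    nthProduct n β u w ∈ E.integralSpan β := by
  induction hu using AddSubgroup.closure_induction with
  | mem x hx =>
    obtain ⟨P, hP, α, rfl⟩ := hx
    induction hw using AddSubgroup.closure_induction with
    | mem y hy =>
      obtain ⟨Q, hQ, α', rfl⟩ := hy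
      rw [nthProduct_tens, cosetRep_zero_left, tens_act_mem_iff]
      exact tens_mem_integralSpan (fockMode_mem n _ _ hP hQ) _
    | zero => rw [map_zero]; exact zero_mem _
    | add x y _ _ hx hy => rw [map_add]; exact add_mem hx hy
    | neg x _ hx => rw [map_neg]; exact neg_mem hx
  | zero => rw [map_zero, LinearMap.zero_apply]; exact zero_mem _
  | add x y _ _ hx hy => rw [map_add, LinearMap.add_apply]; exact add_mem hx hy
  | neg x _ hx => rw [map_neg, LinearMap.neg_apply]; exact neg_mem hx

lemma iota_secCoset_mem (β : dualLattice B) : iota (E.secCoset β) ∈ E.integralSpan β := by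
  rw [iota, ← cosetRep_zero_right]
  exact tens_mem_integralSpan (one_mem _) 0

lemma iota_secLattice_mem (α : L) : iota (E.secLattice α) ∈ E.integralSpan 0 := by
  rw [iota, ← cosetRep_zero_left]
  exact tens_mem_integralSpan (one_mem _) α

lemma vacuum_eq : E.vacuum = iota (E.secCoset 0) := by
  rw [vacuum, ← E.secLattice_zero, ← cosetRep_zero_right, cosetRep_zero_left]

lemma nthProduct_iota (n : ℤ) {β : dualLattice B} (a : E.Coset 0) (g : E.Coset β) (Q : Fock L) :
    nthProduct n β (iota a) (tens Q (tw g)) =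
      tens ((iotaField a g (LaurentPolynomial.C Q)).coeff (-n - 1)) (tw (act a g)) := by
  rw [iota, nthProduct_tens, fockMode, fockField, map_one, Module.End.one_apply]

lemma iotaField_mul_T {β : dualLattice B} (a : E.Coset 0) (g : E.Coset β) (u : FockPoly L)
    (m q : ℤ) : (iotaField a g (u * LaurentPolynomial.T m)).coeff q =
      (iotaField a g u).coeff (q - m) := by
  simp only [iotaField, LinearMap.comp_apply, LinearMap.mulLeft_apply, AlgHom.toLinearMap_apply,
    map_mul, expPlus_T, toSeries_T]
  rw [← mul_assoc, HahnSeries.coeff_mul_single, mul_one]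

/-- The argument is chosen so that the factor `E⁺(-α, x)` of the field cancels. What remains is
`x^⟨α,g⟩ E(α, x) Q`, from which multiplication by `s_n(α)` is read off. -/
lemma coeff_iotaField_expPlus_neg {β : dualLattice B} (α : L) (g : E.Coset β) (Q : Fock L)
    (n : ℕ) : (iotaField (E.secLattice α) g (expPlus B (-toCartan α) (LaurentPolynomial.C Q))).coeff
        (pairing (E.secLattice α) g + n) = coeff n (expMinus (toCartan α)) * Q := by
  have hd : (E.deg (E.secLattice α).1 : Cartan L) = toCartan α := by
    rw [secLattice, deg_e]; rfl
  simp only [iotaField, LinearMap.comp_apply, LinearMap.mulLeft_apply, AlgHom.toLinearMap_apply, hd,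
    expPlus_expPlus_neg, toSeries_C]
  rw [HahnSeries.coeff_mul_single_zero, HahnSeries.coeff_single_mul, add_sub_cancel_left, one_mul,
    HahnSeries.ofPowerSeries_apply_coeff]

/-- The subgroup `integralSpan` is generated by `ι(e_β)` under the modes of the `ι(e_α)`. -/
lemma integralSpan_le {β : dualLattice B} {M : AddSubgroup (E.LatticeModule β)}
    (h0 : iota (E.secCoset β) ∈ M)
    (hM : ∀ (α : L) (n : ℤ), ∀ w ∈ M, nthProduct n β (iota (E.secLattice α)) w ∈ M) :
    E.integralSpan β ≤ M := by
  have key : ∀ (k : ℕ) (Q : Fock L), Q ∈ generatorSpan L ^ k → ∀ α,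
      tens Q (tw (E.cosetRep β α)) ∈ M := by
    -- The field of `ι(e_α)` is linear over powers of `x`, so on Laurent polynomials its
    -- coefficients are still integral combinations of modes.
    have hstep : ∀ N : Submodule ℤ (Fock L), (∀ Q ∈ N, ∀ α, tens Q (tw (E.cosetRep β α)) ∈ M) →
        ∀ (α α' : L), ∀ u ∈ laurentSpan N, ∀ q : ℤ,
        tens ((iotaField (E.secLattice α) (E.cosetRep β α') u).coeff q)
          (tw (E.cosetRep β (α + α'))) ∈ M := by
      intro N hN α α' u hu
      induction hu using Submodule.span_induction with
      | mem x hx =>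
        obtain ⟨Q, hQ, m, rfl⟩ := hx
        intro q
        have h := hM α (-(q - m) - 1) _ (hN Q hQ α')
        rw [nthProduct_iota, tens_act_mem_iff] at h
        rw [iotaField_mul_T]
        convert h using 3
        ring_nf
      | zero => intro q; simp
      | add x y _ _ hx hy =>
        intro q
        rw [map_add, HahnSeries.coeff_add, map_add, LinearMap.add_apply]
        exact add_mem (hx q) (hy q)
      | smul z x _ hx =>
        intro q
        rw [map_zsmul]
        have : (z • iotaField (E.secLattice α) (E.cosetRep β α') x).coeff q =
          z • (iotaField (E.secLattice α) (E.cosetRep β α') x).coeff q := rfl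
        rw [this, map_zsmul, LinearMap.smul_apply]
        exact zsmul_mem (hx q) z
    have hgen : ∀ N : Submodule ℤ (Fock L), (∀ Q ∈ N, ∀ α, tens Q (tw (E.cosetRep β α)) ∈ M) →
        ∀ Q, (∀ γ : L, expPlus B (toCartan γ) (LaurentPolynomial.C Q) ∈ laurentSpan N) →
        ∀ (α : L) (n : ℕ) (α' : L),
        tens (coeff n (expMinus (toCartan α)) * Q) (tw (E.cosetRep β (α + α'))) ∈ M := by
      intro N hN Q hQ α n α'
      have h := hstep N hN α α' _ (hQ (-α)) (pairing (E.secLattice α) (E.cosetRep β α') + n)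
      rwa [map_neg, coeff_iotaField_expPlus_neg] at h
    have h1 : ∀ α, tens 1 (tw (E.cosetRep β α)) ∈ M := by
      intro α
      -- This mode is the leading coefficient, at `x^⟨α,β⟩`, of the field applied to `ι(e_β)`; there
      -- `s_0(α) = 1`.
      have h := hM α (-(pairing (E.secLattice α) (E.cosetRep β 0) : ℤ) - 1) _ h0
      rw [iota, iota, nthProduct_tens] at h
      rw [← cosetRep_zero_right, tens_act_mem_iff, add_zero] at h
      convert h using 3
      have h2 := coeff_iotaField_expPlus_neg α (E.cosetRep β 0) 1 0
      rw [fockMode, fockField, map_one, Module.End.one_apply]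
      rw [map_one, map_one, Nat.cast_zero, add_zero, coeff_zero_eq_constantCoeff_apply,
        (isExp_expMinus _).1, one_mul] at h2
      rw [map_one, ← h2]
      congr 1
      ring
    intro k
    induction k with
    | zero =>
      intro Q hQ α
      rw [pow_zero] at hQ
      obtain ⟨z, rfl⟩ := Submodule.mem_one.1 hQ
      rw [eq_intCast, ← zsmul_one, map_zsmul, LinearMap.smul_apply]
      exact zsmul_mem (h1 α) z
    | succ k ih =>
      intro Q hQ α'
      rw [pow_succ'] at hQ
      induction hQ using Submodule.mul_induction_on' with
      | mem_mul_mem m hm n hn =>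
        induction hm using Submodule.span_induction with
        | mem x hx =>
          obtain ⟨α, j, rfl⟩ := hx
          -- Multiplying by `s_j(α)` shifts the lattice degree by `α`, so the argument starts from
          -- `α' - α`.
          have h := hgen _ ih n (fun γ => expPlus_mem_laurentSpan_pow B γ k hn) α j (α' - α)
          rwa [add_sub_cancel] at h
        | zero => simp
        | add x y _ _ hx hy => rw [add_mul, map_add, LinearMap.add_apply]; exact add_mem hx hy
        | smul z x _ hx =>
          rw [smul_mul_assoc, map_zsmul, LinearMap.smul_apply]
          exact zsmul_mem hx z
      | add x _ y _ hx hy => rw [map_add, LinearMap.add_apply]; exact add_mem hx hy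
  refine (AddSubgroup.closure_le _).2 ?_
  rintro _ ⟨P, hP, α, rfl⟩
  obtain ⟨k, hk⟩ := exists_mem_generatorSpan_pow hP
  exact key k P hk α

lemma isVertexSubring_integralSpan : IsVertexSubring (E.integralSpan 0) where
  vacuum_mem := by rw [vacuum_eq]; exact iota_secCoset_mem 0
  nthProduct_mem _ hu _ hv n := nthProduct_mem_integralSpan n hu hv

lemma integralAlgebra_eq : E.integralAlgebra = E.integralSpan 0 := by
  refine le_antisymm (sInf_le ⟨isVertexSubring_integralSpan, ?_⟩) (le_sInf ?_)
  · rintro _ ⟨α, rfl⟩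
    exact iota_secLattice_mem α
  · rintro M ⟨hM, hS⟩
    refine integralSpan_le ?_ fun α n w hw => hM.nthProduct_mem _ (hS ⟨α, rfl⟩) _ hw n
    rw [← vacuum_eq]
    exact hM.vacuum_mem

lemma isVertexSubmodule_integralSpan (β : dualLattice B) :
    IsVertexSubmodule E.integralAlgebra (E.integralSpan β) := by
  intro u hu w hw n
  rw [integralAlgebra_eq] at hu
  exact nthProduct_mem_integralSpan n hu hw

lemma integralModule_eq (β : dualLattice B) : E.integralModule β = E.integralSpan β := by
  refine le_antisymm (sInf_le ⟨isVertexSubmodule_integralSpan β, ?_⟩) (le_sInf ?_)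
  · rintro _ rfl
    exact iota_secCoset_mem β
  · rintro M ⟨hM, hS⟩
    refine integralSpan_le (hS rfl) fun α n w hw => hM _ ?_ _ hw n
    rw [integralAlgebra_eq]
    exact iota_secLattice_mem α

end IntegralSpan

end CentralExtension

end LatticeVertex
end

noncomputable section

namespace LatticeVertex

/-! ### Integral forms and gradings from a basis -/

section IntegralForms

variable {W : Type*} [AddCommGroup W] [Module ℂ W] {ι : Type*} (b : Module.Basis ι ℂ W)
  {M : AddSubgroup W}

lemma isIntegralFormOfSpace_of_basis
    (hM : ∀ v, v ∈ M ↔ v ∈ Submodule.span ℤ (Set.range b)) : IsIntegralFormOfSpace M := by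
  have hMs : AddSubgroup.toIntSubmodule M = Submodule.span ℤ (Set.range b) :=
    Submodule.ext fun v => hM v
  let e : M ≃ₗ[ℤ] (ι →₀ ℤ) :=
    (LinearEquiv.ofEq _ _ hMs).trans (b.restrictScalars ℤ).repr
  refine ⟨Module.Free.of_basis (Module.Basis.ofRepr e), ?_⟩
  -- A `ℂ`-basis exhibits `W` as the base change of the free abelian group on its index set;
  -- transported along `e`, this map becomes the inclusion of `M`.
  have h := (IsBaseChange.of_basis ℤ b).comp_equiv e
  convert h using 1
  refine LinearMap.ext fun v => ?_
  have h2 := congrArg Subtype.val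
    ((b.restrictScalars ℤ).linearCombination_repr (LinearEquiv.ofEq _ _ hMs v))
  rw [Finsupp.linearCombination_apply] at h2
  change (v : W) = Finsupp.linearCombination ℤ b ((b.restrictScalars ℤ).repr _)
  rw [Finsupp.linearCombination_apply]
  refine Eq.trans h2.symm ?_
  rw [Finsupp.sum, Finsupp.sum, AddSubmonoidClass.coe_finsetSum]
  exact Finset.sum_congr rfl fun i _ => by
    rw [Submodule.coe_smul, Module.Basis.restrictScalars_apply]
    rfl

/-- The relation `r j i` assigns at most one piece to each basis vector, and a vector of the piece
`i` has coordinates only at indices assigned to `i`. Distinct pieces thus have disjoint supports. -/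
lemma isCompatibleWithGrading_of_basis {K : Type*} (V : K → Submodule ℂ W)
    (hM : ∀ v, v ∈ M ↔ v ∈ Submodule.span ℤ (Set.range b)) (r : ι → K → Prop)
    (hr : ∀ j i i', r j i → r j i' → i = i') (hex : ∀ j, ∃ i, b j ∈ V i)
    (hV : ∀ i, ∀ v ∈ V i, ∀ j, b.repr v j ≠ 0 → r j i) : IsCompatibleWithGrading V M where
  independent i := by
    rw [AddSubgroup.disjoint_def]
    intro v hv hv'
    -- `N` collects the vectors without coordinates in the piece `i`; it contains all the other
    -- pieces.
    let N : AddSubgroup W :=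
      { carrier := {v | ∀ j, r j i → b.repr v j = 0}
        zero_mem' := fun j _ => by simp
        add_mem' := fun {x y} hx hy j hj => by simp [hx j hj, hy j hj]
        neg_mem' := fun {x} hx j hj => by simp [hx j hj] }
    have hN : ⨆ i', ⨆ _ : i' ≠ i, (V i').toAddSubgroup ⊓ M ≤ N := by
      refine iSup₂_le fun i' hi' x hx j hj => ?_
      by_contra h
      exact hi' (hr j _ _ (hV i' x hx.1 j h) hj)
    refine (b.ext_elem_iff).2 fun j => ?_
    rw [map_zero, Finsupp.zero_apply]
    by_contra h
    exact h (hN hv' j (hV i v hv.1 j h))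
  sum_eq := by
    refine le_antisymm (iSup_le fun i => inf_le_right) fun v hv => ?_
    rw [hM] at hv
    induction hv using Submodule.span_induction with
    | mem x hx =>
      obtain ⟨j, rfl⟩ := hx
      obtain ⟨i, hi⟩ := hex j
      exact AddSubgroup.mem_iSup_of_mem i
        ⟨hi, (hM _).2 (Submodule.subset_span ⟨j, rfl⟩)⟩
    | zero => exact zero_mem _
    | add x y _ _ hx hy => exact add_mem hx hy
    | smul k x _ hx => exact zsmul_mem hx k

end IntegralForms

variable {L : Type*} [AddCommGroup L] {B : LinearMap.BilinForm ℤ L}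

lemma toDual_injective (hB : B.Nondegenerate) : Function.Injective (toDual B) := by
  rw [injective_iff_map_eq_zero]
  intro α hα
  refine hB.1 α fun γ => ?_
  have h1 : toCartan α = 0 := congrArg Subtype.val hα
  have h := form_toCartan B α γ
  rw [h1, map_zero, LinearMap.zero_apply] at h
  exact_mod_cast h.symm

/-- Elements of the dual lattice have rational norm. -/
lemma exists_rat_form_self [Module.Free ℤ L] [Module.Finite ℤ L] (hB : B.Nondegenerate)
    (γ : dualLattice B) : ∃ q : ℚ, form B (γ : Cartan L) γ = q := by
  classical
  let b := Module.Free.chooseBasis ℤ L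
  set c := (cartanBasis b).repr (γ : Cartan L) with hc
  let A := LinearMap.BilinForm.toMatrix b B
  have hdet : A.det ≠ 0 := (LinearMap.BilinForm.nondegenerate_iff_det_ne_zero b).1 hB
  choose k hk using fun i => γ.2 (b i)
  have hγ : (γ : Cartan L) = ∑ i, c i • toCartan (b i) := by
    rw [← (cartanBasis b).sum_repr (γ : Cartan L)]
    simp only [cartanBasis_apply, hc]
  have h1 : Matrix.vecMul c (A.map (Int.cast : ℤ → ℂ)) = fun i => (k i : ℂ) := by
    funext j
    rw [← hk j, hγ, map_sum, LinearMap.sum_apply]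
    refine Finset.sum_congr rfl fun i _ => ?_
    rw [map_smul, LinearMap.smul_apply, form_toCartan, smul_eq_mul,
      ← LinearMap.BilinForm.toMatrix_apply]
    rfl
  -- Cramer's rule: the coordinates of `γ` times the Gram matrix give the integral vector `k`, so
  -- the adjugate clears denominators up to the determinant.
  have h2 : ∀ i, (A.det : ℂ) * c i = (∑ j, k j * A.adjugate j i : ℤ) := by
    intro i
    have h3 : A.map (Int.cast : ℤ → ℂ) * A.adjugate.map (Int.cast : ℤ → ℂ) =
        (A.det : ℂ) • (1 : Matrix _ _ ℂ) := by
      have := congrArg (fun M : Matrix _ _ ℤ => (Int.castRingHom ℂ).mapMatrix M) A.mul_adjugate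
      simp only [map_mul] at this
      refine this.trans ?_
      ext i j
      rw [RingHom.mapMatrix_apply, Matrix.map_apply, Matrix.smul_apply, Matrix.smul_apply,
        Matrix.one_apply, Matrix.one_apply]
      split_ifs <;> simp
    have h4 := congrArg (fun v => Matrix.vecMul v (A.adjugate.map (Int.cast : ℤ → ℂ)) i) h1
    simp only [Matrix.vecMul_vecMul, h3] at h4
    rw [Matrix.vecMul_smul, Matrix.vecMul_one] at h4
    refine h4.trans ?_
    push_cast
    rfl
  have hdC : (A.det : ℂ) ≠ 0 := by exact_mod_cast hdet
  refine ⟨∑ i, ((∑ j, k j * A.adjugate j i : ℤ) : ℚ) / (A.det : ℚ) * k i, ?_⟩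
  have h5 : form B (γ : Cartan L) (∑ i, c i • toCartan (b i)) = ∑ i, c i * k i := by
    rw [map_sum]
    exact Finset.sum_congr rfl fun i _ => by rw [map_smul, hk, smul_eq_mul]
  rw [← hγ] at h5
  rw [h5, Rat.cast_sum]
  refine Finset.sum_congr rfl fun i _ => ?_
  rw [Rat.cast_mul, Rat.cast_div, Rat.cast_intCast, Rat.cast_intCast, Rat.cast_intCast, ← h2 i,
    mul_div_cancel_left₀ _ hdC]

namespace CentralExtension

variable {G : Type*} [Group G] {E : CentralExtension B G}

/-! ### A basis of the module compatible with the lattice degree -/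

section Bases

lemma exists_eq_zpow_mul_cosetRep {β : dualLattice B} (g : E.Coset β) :
    ∃ (α : L) (c : ℤ), g.1 = E.κ ^ c * (E.cosetRep β α).1 := by
  obtain ⟨α, hα⟩ := g.2
  have h : g.1 * (E.cosetRep β α).1⁻¹ ∈ E.bar.ker := by
    have hd : E.deg g.1 = E.deg (E.cosetRep β α).1 := by
      rw [deg_cosetRep, hα, sub_add_cancel]
    rw [MonoidHom.mem_ker, map_mul, map_inv, mul_inv_eq_one]
    exact hd
  rw [E.ker_bar] at h
  obtain ⟨c, hc⟩ := Subgroup.mem_zpowers_iff.1 h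
  exact ⟨α, c, by rw [hc, inv_mul_cancel_right]⟩

/-- `κ` and the root of unity have the same order `s`, so imposing `κ = root` collapses nothing in
`ℂ{β + L}`. -/
lemma root_zpow_eq {c c' : ℤ} (h : E.κ ^ c = E.κ ^ c') : E.root ^ c = E.root ^ c' := by
  have h1 : (E.s : ℤ) ∣ c - c' := by
    rw [← E.orderOf_κ, orderOf_dvd_iff_zpow_eq_one, zpow_sub, h, mul_inv_cancel]
  have h2 := (E.root_primitive.zpow_eq_one_iff_dvd (c - c')).2 h1
  rw [zpow_sub₀ root_ne_zero, div_eq_one_iff_eq (zpow_ne_zero _ root_ne_zero)] at h2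
  exact h2

/-- The coordinates of the symbol `ι(g)` in the basis of the `ι(e_α e_β)`. -/
def twCoord {β : dualLattice B} (g : E.Coset β) : L →₀ ℂ :=
  Finsupp.single (exists_eq_zpow_mul_cosetRep g).choose
    (E.root ^ (exists_eq_zpow_mul_cosetRep g).choose_spec.choose)

/-- Independence of the choices in `twCoord`: the degree fixes `α`, as `L` embeds into its dual, and
then `κ ^ c` is fixed. -/
lemma single_root_eq (hB : B.Nondegenerate) {β : dualLattice B} {α α' : L} {c c' : ℤ}
    (h : E.κ ^ c' * (E.cosetRep β α').1 = E.κ ^ c * (E.cosetRep β α).1) :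
    Finsupp.single α' (E.root ^ c') = Finsupp.single α (E.root ^ c) := by
  have hα : α' = α := by
    have := congrArg E.deg h
    rw [deg_mul, deg_mul, deg_κ_zpow, deg_κ_zpow, deg_cosetRep, deg_cosetRep, zero_add,
      zero_add] at this
    exact toDual_injective hB (add_right_cancel this)
  subst hα
  rw [root_zpow_eq (mul_right_cancel h)]

lemma twCoord_eq (hB : B.Nondegenerate) {β : dualLattice B} {g : E.Coset β} {α : L} {c : ℤ}
    (h : g.1 = E.κ ^ c * (E.cosetRep β α).1) : twCoord g = Finsupp.single α (E.root ^ c) :=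
  single_root_eq hB ((exists_eq_zpow_mul_cosetRep g).choose_spec.choose_spec.symm.trans h)

variable (E) in
/-- The vectors `ι(e_α e_β)` form a basis of `ℂ{β + L}`. -/
def twBasis (hB : B.Nondegenerate) (β : dualLattice B) : Module.Basis L ℂ (E.Twisted β) :=
  Module.Basis.ofRepr (LinearEquiv.ofLinearMap
    (twLift twCoord fun g => by
      obtain ⟨α, c, h⟩ := exists_eq_zpow_mul_cosetRep g
      rw [twCoord_eq hB h, twCoord_eq hB (c := 1 + c) (α := α) (by
        rw [zpow_one_add, mul_assoc, ← h]; rfl), Finsupp.smul_single, zpow_one_add₀ root_ne_zero,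
        smul_eq_mul])
    (Finsupp.linearCombination ℂ fun α => tw (E.cosetRep β α))
    (by
      refine Finsupp.lhom_ext' fun α => LinearMap.ext_ring ?_
      simp only [LinearMap.comp_apply, Finsupp.lsingle_apply, Finsupp.linearCombination_single,
        one_smul, twLift_tw, LinearMap.id_apply]
      rw [twCoord_eq hB (c := 0) (α := α) (by rw [zpow_zero, one_mul]), zpow_zero])
    (by
      refine twLift_ext fun g => ?_
      obtain ⟨α, c, h⟩ := exists_eq_zpow_mul_cosetRep g
      rw [LinearMap.comp_apply, twLift_tw, twCoord_eq hB h, Finsupp.linearCombination_single,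
        LinearMap.id_apply, tw_zpow _ _ c h]))

lemma twBasis_apply (hB : B.Nondegenerate) (β : dualLattice B) (α : L) :
    E.twBasis hB β α = tw (E.cosetRep β α) := by
  change Finsupp.linearCombination ℂ _ (Finsupp.single α 1) = _
  rw [Finsupp.linearCombination_single, one_smul]

variable {I : Type*} (b : Module.Basis I ℤ L)

variable (E) in
/-- The integral basis of `V_{β+L}`. -/
def latticeBasis (hB : B.Nondegenerate) (β : dualLattice B) :
    Module.Basis ((I × ℕ →₀ ℕ) × L) ℂ (E.LatticeModule β) :=
  (fockBasis b).tensorProduct (E.twBasis hB β)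

lemma latticeBasis_apply (hB : B.Nondegenerate) (β : dualLattice B) (m : I × ℕ →₀ ℕ) (α : L) :
    E.latticeBasis b hB β (m, α) = tens (fockBasis b m) (tw (E.cosetRep β α)) := by
  rw [← twBasis_apply hB]
  exact Module.Basis.tensorProduct_apply _ _ _ _

lemma latticeBasis_repr_tens (hB : B.Nondegenerate) (β : dualLattice B) (P : Fock L) (α : L)
    (j : (I × ℕ →₀ ℕ) × L) (hj : j.2 ≠ α) :
    (E.latticeBasis b hB β).repr (tens P (tw (E.cosetRep β α))) j = 0 := by
  rw [← twBasis_apply hB]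
  refine (Module.Basis.tensorProduct_repr_tmul_apply (fockBasis b) (E.twBasis hB β) P _ j.1
    j.2).trans ?_
  rw [Module.Basis.repr_self, Finsupp.single_eq_of_ne hj, zero_smul]

lemma mem_integralSpan_iff (hB : B.Nondegenerate) (β : dualLattice B) (v : E.LatticeModule β) :
    v ∈ E.integralSpan β ↔ v ∈ Submodule.span ℤ (Set.range (E.latticeBasis b hB β)) := by
  constructor
  · intro hv
    induction hv using AddSubgroup.closure_induction with
    | mem x hx =>
      obtain ⟨P, hP, α, rfl⟩ := hx
      rw [mem_integralFock_iff b] at hP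
      induction hP using Submodule.span_induction with
      | mem x hx =>
        obtain ⟨m, rfl⟩ := hx
        exact Submodule.subset_span ⟨(m, α), latticeBasis_apply b hB β m α⟩
      | zero => rw [map_zero, LinearMap.zero_apply]; exact zero_mem _
      | add x y _ _ hx hy => rw [map_add, LinearMap.add_apply]; exact add_mem hx hy
      | smul k x _ hx =>
        rw [map_zsmul, LinearMap.smul_apply]; exact Submodule.smul_mem _ _ hx
    | zero => exact zero_mem _
    | add x y _ _ hx hy => exact add_mem hx hy
    | neg x _ hx => exact neg_mem hx
  · intro hv
    induction hv using Submodule.span_induction with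
    | mem x hx =>
      obtain ⟨⟨m, α⟩, rfl⟩ := hx
      rw [latticeBasis_apply]
      exact tens_mem_integralSpan
        ((mem_integralFock_iff b _).2 (Submodule.subset_span ⟨m, rfl⟩)) α
    | zero => exact zero_mem _
    | add x y _ _ hx hy => exact add_mem hx hy
    | smul k x _ hx => exact zsmul_mem hx k

lemma latticeBasis_mem_degreeSpace (hB : B.Nondegenerate) (β : dualLattice B)
    (j : (I × ℕ →₀ ℕ) × L) :
    E.latticeBasis b hB β j ∈ E.degreeSpace β (toDual B j.2 + β) := by
  obtain ⟨m, α⟩ := j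
  rw [latticeBasis_apply]
  exact Submodule.subset_span ⟨_, _, deg_cosetRep β α, rfl⟩

lemma toDual_add_eq_of_repr_ne_zero (hB : B.Nondegenerate) {β γ : dualLattice B}
    {v : E.LatticeModule β} (hv : v ∈ E.degreeSpace β γ) {j : (I × ℕ →₀ ℕ) × L}
    (hj : (E.latticeBasis b hB β).repr v j ≠ 0) : toDual B j.2 + β = γ := by
  contrapose! hj
  induction hv using Submodule.span_induction with
  | mem x hx =>
    obtain ⟨P, g, hg, rfl⟩ := hx
    obtain ⟨α, c, h⟩ := exists_eq_zpow_mul_cosetRep g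
    rw [tw_zpow _ _ c h, map_smul, map_smul, Finsupp.smul_apply, latticeBasis_repr_tens b hB,
      smul_zero]
    rintro rfl
    apply hj
    rw [← hg, h, deg_mul, deg_cosetRep, deg_κ_zpow, zero_add]
  | zero => simp
  | add x y _ _ hx hy => rw [map_add, Finsupp.add_apply, hx, hy, add_zero]
  | smul k x _ hx => rw [map_smul, Finsupp.smul_apply, hx, smul_zero]

end Bases

end CentralExtension

end LatticeVertex
end

noncomputable section

namespace LatticeVertex

open PowerSeries

variable {L : Type*} [AddCommGroup L] (B : LinearMap.BilinForm ℤ L)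

/-! ### Degree bounds for annihilation fields -/

section LowDegree

variable (L) in
/-- The Laurent polynomials whose exponents are at most `-d`. -/
def lowPoly (d : ℤ) : Submodule ℂ (FockPoly L) :=
  Submodule.span ℂ {u | ∃ (P : Fock L) (m : ℤ), m ≤ -d ∧
    u = LaurentPolynomial.C P * LaurentPolynomial.T m}

lemma C_mul_mem_lowPoly {d : ℤ} (P : Fock L) {u : FockPoly L} (hu : u ∈ lowPoly L d) :
    LaurentPolynomial.C P * u ∈ lowPoly L d := by
  induction hu using Submodule.span_induction with
  | mem x hx =>
    obtain ⟨Q, m, hm, rfl⟩ := hx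
    exact Submodule.subset_span ⟨P * Q, m, hm, by rw [map_mul, mul_assoc]⟩
  | zero => rw [mul_zero]; exact zero_mem _
  | add x y _ _ hx hy => rw [mul_add]; exact add_mem hx hy
  | smul c x _ hx => rw [mul_smul_comm]; exact Submodule.smul_mem _ _ hx

lemma mul_T_mem_lowPoly {d : ℤ} {m : ℤ} {u : FockPoly L} (hu : u ∈ lowPoly L d) :
    u * LaurentPolynomial.T m ∈ lowPoly L (d - m) := by
  induction hu using Submodule.span_induction with
  | mem x hx =>
    obtain ⟨Q, n, hn, rfl⟩ := hx
    refine Submodule.subset_span ⟨Q, n + m, by linarith, ?_⟩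
    rw [mul_assoc, LaurentPolynomial.T_add]
  | zero => rw [zero_mul]; exact zero_mem _
  | add x y _ _ hx hy => rw [add_mul]; exact add_mem hx hy
  | smul c x _ hx => rw [smul_mul_assoc]; exact Submodule.smul_mem _ _ hx

lemma lowPoly_mono {d d' : ℤ} (h : d ≤ d') : lowPoly L d' ≤ lowPoly L d := by
  refine Submodule.span_mono ?_
  rintro _ ⟨P, m, hm, rfl⟩
  exact ⟨P, m, by linarith, rfl⟩

lemma annField_one_C_gen (n : ℕ+) (h g : Cartan L) :
    annField B (Finsupp.single 1 h) (LaurentPolynomial.C (create n g)) =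
      (n * form B h g : ℂ) • LaurentPolynomial.T (-(n : ℤ) - 1) := by
  rw [C_create, annField_single, modeCoeff, PNat.one_coe, Nat.sub_self, Ring.choose_zero_right,
    Int.cast_one, mul_one]
  rfl

/-- The modes `h(n)` with `n ≥ 1` come with `x^{-n-1}`, of exponent at most `-2`. Two such fields
reach only exponents at most `-4` and cannot contribute to `L(0)`, which is read at `x⁻²`. -/
lemma annField_C_mem_lowPoly (h : Cartan L) (P : Fock L) :
    annField B (Finsupp.single 1 h) (LaurentPolynomial.C P) ∈ lowPoly L 2 := by
  induction P using fock_induction with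
  | hc c =>
    have : (LaurentPolynomial.C (algebraMap ℂ (Fock L) c) : FockPoly L) = algebraMap ℂ _ c := rfl
    rw [this, Derivation.map_algebraMap]
    exact zero_mem _
  | hg y =>
    induction y using Finsupp.induction_linear with
    | zero => simp
    | add y₁ y₂ h₁ h₂ => rw [map_add, map_add, map_add]; exact add_mem h₁ h₂
    | single n g =>
      have := annField_one_C_gen B n h g
      rw [C_create] at this
      rw [this]
      refine Submodule.smul_mem _ _ (Submodule.subset_span ⟨1, -(n : ℤ) - 1, ?_, ?_⟩)
      · have : (1 : ℤ) ≤ (n : ℤ) := by exact_mod_cast n.pos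
        linarith
      · rw [map_one, one_mul]
  | hmul u v hu hv =>
    rw [map_mul, Derivation.leibniz]
    exact add_mem (C_mul_mem_lowPoly _ hv) (C_mul_mem_lowPoly _ hu)
  | hadd u v hu hv => rw [map_add, map_add]; exact add_mem hu hv

lemma annField_mem_lowPoly (h : Cartan L) {d : ℤ} {u : FockPoly L} (hu : u ∈ lowPoly L d) :
    annField B (Finsupp.single 1 h) u ∈ lowPoly L (d + 2) := by
  induction hu using Submodule.span_induction with
  | mem x hx =>
    obtain ⟨Q, m, hm, rfl⟩ := hx
    rw [Derivation.leibniz, annField_T, smul_zero, zero_add, smul_eq_mul, mul_comm]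
    exact lowPoly_mono (by linarith) (mul_T_mem_lowPoly (annField_C_mem_lowPoly B h Q))
  | zero => rw [map_zero]; exact zero_mem _
  | add x y _ _ hx hy => rw [map_add]; exact add_mem hx hy
  | smul c x _ hx => rw [Derivation.map_smul]; exact Submodule.smul_mem _ _ hx

lemma toSeries_coeff_eq_zero {d n : ℤ} (hn : -d < n) {u : FockPoly L} (hu : u ∈ lowPoly L d) :
    (toSeries u).coeff n = 0 := by
  induction hu using Submodule.span_induction with
  | mem x hx =>
    obtain ⟨Q, m, hm, rfl⟩ := hx
    rw [map_mul, toSeries_C, toSeries_T, HahnSeries.single_mul_single, HahnSeries.coeff_single,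
      if_neg]
    linarith
  | zero => rw [map_zero, HahnSeries.coeff_zero]
  | add x y _ _ hx hy => rw [map_add, HahnSeries.coeff_add, hx, hy, add_zero]
  | smul c x _ hx => rw [map_smul, HahnSeries.coeff_smul, hx, smul_zero]

end LowDegree

/-! ### The weight operator on the Fock space -/

section Euler

lemma mulField_one (l : Cartan L →ₗ[ℂ] ℂ) (h : Cartan L) : mulField l (Finsupp.single 1 h) =
    HahnSeries.single (-1) 1 * HahnSeries.ofPowerSeries ℤ (Fock L)
      (C (algebraMap ℂ _ (l h)) + X * createGen h) := by
  have h1 := createSeries_succ 0 h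
  rw [coeff_zero_eq_constantCoeff_apply, constantCoeff_taylor] at h1
  have h2 : modeCoeff 1 0 = 1 := by
    have := modeCoeff_zero 0
    rwa [pow_zero] at this
  rw [map_add, map_mul, HahnSeries.ofPowerSeries_C, HahnSeries.ofPowerSeries_X, mul_add,
    ← mul_assoc, HahnSeries.single_mul_single, HahnSeries.C_apply, HahnSeries.single_mul_single,
    mulField, Finsupp.lsum_single]
  change HahnSeries.ofPowerSeries ℤ (Fock L) (createSeries (Nat.succPNat 0) h) +
    HahnSeries.single _ (algebraMap ℂ (Fock L) (modeCoeff 1 0 * l h)) = _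
  rw [h1, h2, add_comm]
  simp

lemma coeff_mulField_one (l : Cartan L →ₗ[ℂ] ℂ) (h : Cartan L) (n : ℕ+) :
    (mulField l (Finsupp.single 1 h)).coeff ((n : ℤ) - 1) = create n h := by
  rw [mulField_one, HahnSeries.coeff_single_mul, one_mul, sub_neg_eq_add, sub_add_cancel]
  have : ((n : ℕ+) : ℤ) = ((n.natPred + 1 : ℕ) : ℤ) := by
    rw [PNat.natPred_add_one]
  rw [this, HahnSeries.ofPowerSeries_apply_coeff, map_add, coeff_C, if_neg (Nat.succ_ne_zero _),
    zero_add, coeff_succ_X_mul, createGen, coeff_mk, PNat.succPNat_natPred]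

lemma C_smul (r : ℂ) (Q : Fock L) :
    (LaurentPolynomial.C (r • Q) : FockPoly L) = r • LaurentPolynomial.C Q :=
  (AddMonoidAlgebra.smul_single r (0 : ℤ) Q).symm

/-- The operator `∑_{n > 0} h(-n) h'(n)` on the Fock space, as a derivation. -/
def eulerPair (l : Cartan L →ₗ[ℂ] ℂ) (h h' : Cartan L) : Derivation ℂ (Fock L) (Fock L) :=
  Derivation.mk'
    -- The coefficient of `x⁻²` pairs `h(-n) x^{n-1}` with `h'(n) x^{-n-1}`. The zero mode `l h ·
    -- x⁻¹` finds no partner, since no exponent `-1` occurs on the right.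
    { toFun := fun Q => (mulField l (Finsupp.single 1 h) *
        toSeries (annField B (Finsupp.single 1 h') (LaurentPolynomial.C Q))).coeff (-2)
      map_add' := fun P Q => by simp [mul_add]
      map_smul' := fun r Q => by
        rw [C_smul, Derivation.map_smul, map_smul, mul_smul_comm, HahnSeries.coeff_smul]; rfl }
    (fun P Q => by
      simp only [LinearMap.coe_mk, AddHom.coe_mk]
      rw [map_mul, Derivation.leibniz, map_add, smul_eq_mul, smul_eq_mul, map_mul, map_mul,
        toSeries_C, toSeries_C, mul_add, HahnSeries.coeff_add, mul_left_comm,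
        mul_left_comm _ (HahnSeries.single 0 Q), HahnSeries.coeff_single_zero_mul,
        HahnSeries.coeff_single_zero_mul]
      rfl)

lemma eulerPair_apply (l : Cartan L →ₗ[ℂ] ℂ) (h h' : Cartan L) (Q : Fock L) :
    eulerPair B l h h' Q = (mulField l (Finsupp.single 1 h) *
      toSeries (annField B (Finsupp.single 1 h') (LaurentPolynomial.C Q))).coeff (-2) := rfl

lemma eulerPair_create (l : Cartan L →ₗ[ℂ] ℂ) (h h' : Cartan L) (n : ℕ+) (g : Cartan L) :
    eulerPair B l h h' (create n g) = (n * form B h' g : ℂ) • create n h := by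
  rw [eulerPair_apply, annField_one_C_gen, map_smul, mul_smul_comm, HahnSeries.coeff_smul,
    toSeries_T, HahnSeries.coeff_mul_single, mul_one]
  have : (-2 : ℤ) - (-(n : ℤ) - 1) = (n : ℤ) - 1 := by ring
  rw [this, coeff_mulField_one]

/-- Each factor splits into modes with index at most 0 and annihilation modes. At `x⁻²` the
first-kind product leaves only zero modes, the two mixed terms give the Euler operators, and the
pure annihilation term vanishes by degree. -/
lemma coeff_normalOrder_create (l : Cartan L →ₗ[ℂ] ℂ) (h h' : Cartan L) (Q : Fock L) :
    (normalOrder B l (create 1 h * create 1 h') toSeries.toLinearMap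
      (LaurentPolynomial.C Q)).coeff (-2) =
      (l h * l h' : ℂ) • Q + eulerPair B l h h' Q + eulerPair B l h' h Q := by
  have hc : ∀ h : Cartan L, create 1 h = gen (Finsupp.single 1 h) := fun _ => rfl
  rw [map_mul, hc, hc, normalOrder_gen, normalOrder_gen, Module.End.mul_apply, normalStep_apply,
    normalStep_apply, normalStep_apply, AlgHom.toLinearMap_apply, AlgHom.toLinearMap_apply,
    AlgHom.toLinearMap_apply, AlgHom.toLinearMap_apply, mul_add, HahnSeries.coeff_add,
    HahnSeries.coeff_add, HahnSeries.coeff_add, ← eulerPair_apply, ← eulerPair_apply]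
  have h1 : (toSeries (annField B (Finsupp.single 1 h')
      (annField B (Finsupp.single 1 h) (LaurentPolynomial.C Q)))).coeff (-2) = 0 :=
    toSeries_coeff_eq_zero (by norm_num)
      (annField_mem_lowPoly B h' (annField_C_mem_lowPoly B h Q))
  have h2 : (mulField l (Finsupp.single 1 h) * (mulField l (Finsupp.single 1 h') *
      toSeries (LaurentPolynomial.C Q))).coeff (-2) = (l h * l h' : ℂ) • Q := by
    rw [toSeries_C, ← mul_assoc, HahnSeries.coeff_mul_single_zero, mulField_one, mulField_one,
      mul_mul_mul_comm, HahnSeries.single_mul_single, ← map_mul, one_mul,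
      HahnSeries.coeff_single_mul, one_mul]
    have := HahnSeries.ofPowerSeries_apply_coeff (Γ := ℤ)
      ((C (algebraMap ℂ (Fock L) (l h)) + X * createGen h) *
        (C (algebraMap ℂ (Fock L) (l h')) + X * createGen h')) 0
    rw [Nat.cast_zero] at this
    norm_num only
    rw [this, coeff_zero_eq_constantCoeff_apply, Algebra.smul_def]
    simp
  rw [h1, h2, add_zero, add_assoc]

/-- A derivation multiplying `h(-n)` by `n` multiplies the coefficient of `xⁿ` in
`exp (∑_{n > 0} h(-n)/n · xⁿ)` by `n`. -/
lemma derivation_expMinus {D : Derivation ℂ (Fock L) (Fock L)}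
    (hD : ∀ (n : ℕ+) (h : Cartan L), D (create n h) = (n : ℂ) • create n h) (h : Cartan L) (n : ℕ) :
    D (coeff n (expMinus h)) = n • coeff n (expMinus h) := by
  induction n using Nat.strong_induction_on with
  | _ n ih =>
    cases n with
    | zero =>
      rw [coeff_zero_eq_constantCoeff_apply, (isExp_expMinus h).1, Derivation.map_one_eq_zero,
        zero_smul]
    | succ n =>
      have h1 := (isExp_expMinus h).coeff_succ n
      have h2 : (n + 1) • coeff (n + 1) (expMinus h) = ∑ p ∈ Finset.HasAntidiagonal.antidiagonal n,
          coeff p.1 (createGen h) * coeff p.2 (expMinus h) := by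
        rw [← h1, nsmul_eq_mul, mul_comm]; push_cast; rfl
      have h3 := congrArg D h2
      rw [map_nsmul, map_sum] at h3
      refine nsmul_right_injective (Nat.succ_ne_zero n) (h3.trans ?_)
      change _ = (n + 1) • (n + 1) • _
      rw [h2, Finset.smul_sum]
      refine Finset.sum_congr rfl fun p hp => ?_
      have hpn := Finset.HasAntidiagonal.mem_antidiagonal.1 hp
      rw [Derivation.leibniz, ih p.2 (by omega), createGen, coeff_mk, hD, Nat.succPNat_coe,
        Nat.cast_smul_eq_nsmul, ← hpn]
      simp only [smul_eq_mul, nsmul_eq_mul]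
      push_cast
      ring

variable {I : Type*} (b : Module.Basis I ℤ L)

/-- The conformal weight of the monomial with exponents `m`. -/
def fockWeight (m : I × ℕ →₀ ℕ) : ℕ := m.sum fun p k => k * (p.2 + 1)

lemma derivation_fockBasis {D : Derivation ℂ (Fock L) (Fock L)}
    (hD : ∀ (n : ℕ+) (h : Cartan L), D (create n h) = (n : ℂ) • create n h) (m : I × ℕ →₀ ℕ) :
    D (fockBasis b m) = fockWeight m • fockBasis b m := by
  induction m using Finsupp.induction_linear with
  | zero =>
    rw [fockBasis_eq_prod, Finsupp.prod_zero_index, Derivation.map_one_eq_zero, fockWeight,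
      Finsupp.sum_zero_index, zero_smul]
  | add m m' hm hm' =>
    have hw : fockWeight (m + m') = fockWeight m + fockWeight m' :=
      Finsupp.sum_add_index' (by simp) (by intros; ring)
    rw [← fockBasis_mul, Derivation.leibniz, hm, hm', hw]
    simp only [smul_eq_mul, nsmul_eq_mul]
    push_cast
    ring
  | single p k =>
    rw [fockWeight, Finsupp.sum_single_index (by simp), fockBasis_eq_prod,
      Finsupp.prod_single_index (by simp), Derivation.leibniz_pow, derivation_expMinus hD]
    cases k with
    | zero => simp
    | succ k =>
      simp only [smul_eq_mul, nsmul_eq_mul, Nat.add_sub_cancel]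
      push_cast
      ring

end Euler

/-! ### The action of the conformal vector -/

section DualBases

variable {B} {J : Type*} [Fintype J] [DecidableEq J] {a a' : Module.Basis J ℂ (Cartan L)}

lemma form_comm (hsymm : B.IsSymm) (x y : Cartan L) : form B x y = form B y x := by
  induction x using TensorProduct.induction_on with
  | zero => simp
  | add x₁ x₂ h₁ h₂ => rw [map_add, map_add, LinearMap.add_apply, h₁, h₂]
  | tmul c α =>
    induction y using TensorProduct.induction_on with
    | zero => simp
    | add y₁ y₂ h₁ h₂ => rw [map_add, map_add, LinearMap.add_apply, h₁, h₂]
    | tmul c' α' =>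
      rw [form, LinearMap.BilinForm.baseChange_tmul, LinearMap.BilinForm.baseChange_tmul,
        hsymm.eq α α', mul_comm]

lemma sum_form_dual_smul (hdual : ∀ i j, form B (a i) (a' j) = if i = j then 1 else 0)
    (h : Cartan L) : ∑ j, form B (a j) h • a' j = h := by
  have key : ∀ j, form B (a j) h = a'.repr h j := by
    intro j
    conv_lhs => rw [← a'.sum_repr h]
    rw [map_sum, Finset.sum_eq_single j]
    · rw [map_smul, hdual, if_pos rfl, smul_eq_mul, mul_one]
    · intro i _ hi
      rw [map_smul, hdual, if_neg hi.symm, smul_zero]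
    · simp
  simp only [key]
  exact a'.sum_repr h

lemma sum_form_smul (hsymm : B.IsSymm)
    (hdual : ∀ i j, form B (a i) (a' j) = if i = j then 1 else 0)
    (h : Cartan L) : ∑ j, form B (a' j) h • a j = h := by
  refine sum_form_dual_smul (a := a') (a' := a) (fun i j => ?_) h
  rw [form_comm hsymm, hdual]
  simp only [eq_comm]

/-- The operator `∑_j ½ ∑_{n > 0} (a_j(-n) a'_j(n) + a'_j(-n) a_j(n))`. -/
def euler (l : Cartan L →ₗ[ℂ] ℂ) (a a' : J → Cartan L) : Derivation ℂ (Fock L) (Fock L) :=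
  (1 / 2 : ℂ) • ∑ j, (eulerPair B l (a j) (a' j) + eulerPair B l (a' j) (a j))

/-- Expanding `h` in either dual basis, each of the two sums gives `n h(-n)`; the factor `½`
averages them. -/
lemma euler_create (hsymm : B.IsSymm)
    (hdual : ∀ i j, form B (a i) (a' j) = if i = j then 1 else 0) (l : Cartan L →ₗ[ℂ] ℂ)
    (n : ℕ+) (h : Cartan L) :
    euler (B := B) l a a' (create n h) = (n : ℂ) • create n h := by
  have h1 : ∑ j, (n * form B (a' j) h : ℂ) • create n (a j) = (n : ℂ) • create n h := by
    conv_rhs => rw [← sum_form_smul hsymm hdual h]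
    rw [map_sum, Finset.smul_sum]
    exact Finset.sum_congr rfl fun j _ => by rw [map_smul, smul_smul]
  have h2 : ∑ j, (n * form B (a j) h : ℂ) • create n (a' j) = (n : ℂ) • create n h := by
    conv_rhs => rw [← sum_form_dual_smul hdual h]
    rw [map_sum, Finset.smul_sum]
    exact Finset.sum_congr rfl fun j _ => by rw [map_smul, smul_smul]
  rw [euler, Derivation.smul_apply]
  have h3 : (∑ j, (eulerPair B l (a j) (a' j) + eulerPair B l (a' j) (a j))) (create n h) =
      ∑ j, ((n * form B (a' j) h : ℂ) • create n (a j) +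
        (n * form B (a j) h : ℂ) • create n (a' j)) := by
    rw [← Derivation.coeFnAddMonoidHom_apply, map_sum, Finset.sum_apply]
    refine Finset.sum_congr rfl fun j _ => ?_
    rw [Derivation.coeFnAddMonoidHom_apply, Derivation.add_apply, eulerPair_create,
      eulerPair_create]
  rw [h3, Finset.sum_add_distrib, h1, h2, ← two_smul ℂ, smul_smul]
  norm_num

namespace CentralExtension

variable {G : Type*} [Group G] {E : CentralExtension B G}

lemma expPlus_zero (u : FockPoly L) : expPlus B 0 u = u := by
  induction u using poly_induction with
  | hι y => rw [expPlus_C_gen, map_zero, LinearMap.zero_apply, add_zero]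
  | hc c => rw [AlgHom.commutes]
  | hT k => rw [expPlus_T]
  | hadd u v hu hv => rw [map_add, hu, hv]
  | hmul u v hu hv => rw [map_mul, hu, hv]

lemma iotaField_oneCoset {β : dualLattice B} (g : E.Coset β) :
    iotaField E.oneCoset g = toSeries.toLinearMap := by
  have hd : (E.deg E.oneCoset.1 : Cartan L) = 0 := congrArg Subtype.val E.deg_one
  have hp : pairing E.oneCoset g = 0 := by
    have := pairing_spec E.oneCoset g
    rw [hd, map_zero] at this
    exact_mod_cast this.symm
  refine LinearMap.ext fun u => ?_
  rw [iotaField, hd, hp, expMinus_zero, map_one (HahnSeries.ofPowerSeries ℤ (Fock L)), mul_one]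
  simp only [LinearMap.comp_apply, AlgHom.toLinearMap_apply, expPlus_zero, LinearMap.mulLeft_apply]
  exact one_mul _

lemma act_oneCoset {β : dualLattice B} (g : E.Coset β) : act E.oneCoset g = g :=
  Subtype.ext (one_mul g.1)

lemma nthProduct_conformalVector (hsymm : B.IsSymm)
    (hdual : ∀ i j, form B (a i) (a' j) = if i = j then 1 else 0)
    {β : dualLattice B} (g : E.Coset β) (Q : Fock L) :
    nthProduct 1 β (E.conformalVector a a') (tens Q (tw g)) =
      tens ((1 / 2 * form B (E.deg g.1 : Cartan L) (E.deg g.1 : Cartan L)) • Q +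
        euler (B := B) (form B (E.deg g.1 : Cartan L)) a a' Q) (tw g) := by
  set γ : Cartan L := (E.deg g.1).1
  have h1 : ∀ j, nthProduct 1 β (tens (create 1 (a j) * create 1 (a' j)) (tw E.oneCoset))
      (tens Q (tw g)) = tens ((form B γ (a j) * form B γ (a' j) : ℂ) • Q +
        eulerPair B (form B γ) (a j) (a' j) Q + eulerPair B (form B γ) (a' j) (a j) Q) (tw g) := by
    intro j
    rw [nthProduct_tens, act_oneCoset, fockMode, fockField, iotaField_oneCoset,
      ← coeff_normalOrder_create]
    rfl
  -- The zero modes assemble into the norm of `γ`, which is expanded in the basis `a'` with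
  -- coefficients given by `a`.
  have h2 : ∑ j, (form B γ (a j) * form B γ (a' j)) = form B γ γ := by
    conv_rhs => rw [← sum_form_dual_smul hdual γ]
    rw [map_sum]
    exact Finset.sum_congr rfl fun j _ => by
      rw [map_smul, smul_eq_mul, ← form_comm hsymm γ, sum_form_dual_smul hdual]
  have h3 : (∑ j, (eulerPair B (form B γ) (a j) (a' j) + eulerPair B (form B γ) (a' j) (a j))) Q =
      ∑ j, (eulerPair B (form B γ) (a j) (a' j) Q + eulerPair B (form B γ) (a' j) (a j) Q) := by
    rw [← Derivation.coeFnAddMonoidHom_apply, map_sum, Finset.sum_apply]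
    rfl
  rw [conformalVector, map_smul, map_sum, LinearMap.smul_apply, LinearMap.sum_apply]
  simp only [h1]
  rw [euler, Derivation.smul_apply, h3, mul_smul, ← smul_add, ← h2, Finset.sum_smul,
    ← Finset.sum_add_distrib, map_smul, LinearMap.smul_apply, map_sum, LinearMap.sum_apply]
  simp only [add_assoc]

variable {I : Type*} (b : Module.Basis I ℤ L)

lemma nthProduct_conformalVector_latticeBasis (hsymm : B.IsSymm) (hB : B.Nondegenerate)
    (hdual : ∀ i j, form B (a i) (a' j) = if i = j then 1 else 0)
    (β : dualLattice B) (j : (I × ℕ →₀ ℕ) × L) :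
    nthProduct 1 β (E.conformalVector a a') (E.latticeBasis b hB β j) =
      (1 / 2 * form B ((toDual B j.2 + β : dualLattice B) : Cartan L) (toDual B j.2 + β : dualLattice B)
        + fockWeight j.1) • E.latticeBasis b hB β j := by
  obtain ⟨m, α⟩ := j
  rw [latticeBasis_apply, nthProduct_conformalVector hsymm hdual, deg_cosetRep,
    derivation_fockBasis b (euler_create hsymm hdual _), ← Nat.cast_smul_eq_nsmul ℂ, ← add_smul,
    map_smul, LinearMap.smul_apply]

end CentralExtension

end DualBases

end LatticeVertex
end

noncomputable section

namespace LatticeVertex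

variable {L : Type*} [AddCommGroup L] {B : LinearMap.BilinForm ℤ L}

/-! ### Weights of the basis and the final assembly -/

namespace CentralExtension

variable {G : Type*} [Group G] {E : CentralExtension B G}
  {J : Type*} [Fintype J] [DecidableEq J] {a a' : Module.Basis J ℂ (Cartan L)}
  {I : Type*}

/-- The conformal weight of a vector of the integral basis of `V_{β+L}`. -/
def basisWeight (β : dualLattice B) (j : (I × ℕ →₀ ℕ) × L) : ℂ :=
  1 / 2 * form B ((toDual B j.2 + β : dualLattice B) : Cartan L) (toDual B j.2 + β : dualLattice B)
    + fockWeight j.1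

lemma latticeBasis_mem_weightSpace (b : Module.Basis I ℤ L) (hsymm : B.IsSymm) (hB : B.Nondegenerate)
    (hdual : ∀ i j, form B (a i) (a' j) = if i = j then 1 else 0)
    (β : dualLattice B) (j : (I × ℕ →₀ ℕ) × L) :
    E.latticeBasis b hB β j ∈ weightSpace (E.conformalVector a a') β (basisWeight β j) :=
  Module.End.mem_eigenspace_iff.2
    (nthProduct_conformalVector_latticeBasis b hsymm hB hdual β j)

/-- `L(0)` is diagonal in the integral basis, so an eigenvector is supported on basis vectors of its
own eigenvalue. -/
lemma basisWeight_eq_of_repr_ne_zero (b : Module.Basis I ℤ L) (hsymm : B.IsSymm) (hB : B.Nondegenerate)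
    (hdual : ∀ i j, form B (a i) (a' j) = if i = j then 1 else 0)
    {β : dualLattice B} {n : ℂ} {v : E.LatticeModule β}
    (hv : v ∈ weightSpace (E.conformalVector a a') β n) {j : (I × ℕ →₀ ℕ) × L}
    (hj : (E.latticeBasis b hB β).repr v j ≠ 0) : basisWeight β j = n := by
  set c := E.latticeBasis b hB β
  have h1 : ∀ v, c.repr (nthProduct 1 β (E.conformalVector a a') v) j =
      basisWeight β j * c.repr v j := by
    classical
    intro v
    have h2 : Finsupp.lapply j ∘ₗ c.repr.toLinearMap ∘ₗ
        nthProduct 1 β (E.conformalVector a a') =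
        basisWeight β j • (Finsupp.lapply j ∘ₗ c.repr.toLinearMap) := by
      refine c.ext fun i => ?_
      simp only [LinearMap.comp_apply, LinearMap.smul_apply, LinearEquiv.coe_coe,
        Finsupp.lapply_apply, smul_eq_mul]
      rw [Module.End.mem_eigenspace_iff.1
        (latticeBasis_mem_weightSpace b hsymm hB hdual β i), map_smul, Finsupp.smul_apply,
        smul_eq_mul, Module.Basis.repr_self, Finsupp.single_apply]
      split_ifs with h
      · rw [h]
      · rw [mul_zero, mul_zero]
    exact LinearMap.congr_fun h2 v
  have h2 := h1 v
  rw [Module.End.mem_eigenspace_iff.1 hv, map_smul, Finsupp.smul_apply, smul_eq_mul] at h2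
  exact (mul_right_cancel₀ hj h2).symm

/-- The index map `f` serves both gradings, by `L × ℤ` and by `(β + L) × ℚ`. Injectivity keeps the
pieces distinct, and `hex` asks that every degree and weight of a basis vector be indexed. -/
lemma isCompatibleWithGrading_integralSpan (b : Module.Basis I ℤ L) (hsymm : B.IsSymm) (hB : B.Nondegenerate)
    (hdual : ∀ i j, form B (a i) (a' j) = if i = j then 1 else 0)
    (β : dualLattice B) {K : Type*} (f : K → dualLattice B × ℂ) (hf : Function.Injective f)
    (hex : ∀ j : (I × ℕ →₀ ℕ) × L, ∃ k, f k = (toDual B j.2 + β, basisWeight β j)) :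
    IsCompatibleWithGrading
      (fun k => E.degreeSpace β (f k).1 ⊓ weightSpace (E.conformalVector a a') β (f k).2)
      (E.integralSpan β) := by
  refine isCompatibleWithGrading_of_basis (E.latticeBasis b hB β) _
    (mem_integralSpan_iff b hB β) (fun j k => f k = (toDual B j.2 + β, basisWeight β j))
    (fun j k k' h h' => hf (h.trans h'.symm)) (fun j => ?_) (fun k v hv j hj => ?_)
  · obtain ⟨k, hk⟩ := hex j
    refine ⟨k, ?_⟩
    rw [hk]
    exact ⟨latticeBasis_mem_degreeSpace b hB β j,
      latticeBasis_mem_weightSpace b hsymm hB hdual β j⟩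
  · exact Prod.ext (toDual_add_eq_of_repr_ne_zero b hB hv.1 hj).symm
      (basisWeight_eq_of_repr_ne_zero b hsymm hB hdual hv.2 hj).symm

lemma exists_rat_basisWeight [Module.Free ℤ L] [Module.Finite ℤ L] (hB : B.Nondegenerate)
    (β : dualLattice B) (j : (I × ℕ →₀ ℕ) × L) : ∃ q : ℚ, basisWeight β j = q := by
  obtain ⟨q, hq⟩ := exists_rat_form_self hB (toDual B j.2 + β)
  refine ⟨1 / 2 * q + fockWeight j.1, ?_⟩
  rw [basisWeight, hq]
  push_cast
  rfl

lemma exists_int_basisWeight (heven : ∀ α : L, Even (B α α)) (j : (I × ℕ →₀ ℕ) × L) :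
    ∃ n : ℤ, basisWeight (0 : dualLattice B) j = n := by
  obtain ⟨k, hk⟩ := heven j.2
  have h : form B ((toDual B j.2 + 0 : dualLattice B) : Cartan L)
      (toDual B j.2 + 0 : dualLattice B) = (B j.2 j.2 : ℂ) := by
    rw [add_zero]; exact form_toCartan B j.2 j.2
  refine ⟨k + fockWeight j.1, ?_⟩
  rw [basisWeight, h, hk]
  push_cast
  ring

theorem isIntegralFormOfAlgebra_integralAlgebra [Module.Free ℤ L] (hsymm : B.IsSymm)
    (hB : B.Nondegenerate) (heven : ∀ α : L, Even (B α α))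
    (hdual : ∀ i j, form B (a i) (a' j) = if i = j then 1 else 0) :
    E.IsIntegralFormOfAlgebra (E.conformalVector a a') E.integralAlgebra := by
  let b := Module.Free.chooseBasis ℤ L
  rw [integralAlgebra_eq]
  refine ⟨isVertexSubring_integralSpan, isIntegralFormOfSpace_of_basis (E.latticeBasis b hB 0)
    (mem_integralSpan_iff b hB 0), ?_⟩
  refine isCompatibleWithGrading_integralSpan b hsymm hB hdual 0
    (fun p : L × ℤ => (toDual B p.1, (p.2 : ℂ))) (fun p q h => ?_) (fun j => ?_)
  · rw [Prod.ext_iff] at h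
    exact Prod.ext (toDual_injective hB h.1) (Int.cast_injective h.2)
  · obtain ⟨n, hn⟩ := exists_int_basisWeight heven j
    exact ⟨(j.2, n), by rw [hn, add_zero]⟩

theorem isIntegralFormOfModule_integralModule [Module.Free ℤ L] [Module.Finite ℤ L]
    (hsymm : B.IsSymm) (hB : B.Nondegenerate)
    (hdual : ∀ i j, form B (a i) (a' j) = if i = j then 1 else 0) (β : dualLattice B) :
    E.IsIntegralFormOfModule (E.conformalVector a a') E.integralAlgebra β
      (E.integralModule β) := by
  let b := Module.Free.chooseBasis ℤ L
  rw [integralModule_eq]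
  refine ⟨isVertexSubmodule_integralSpan β, isIntegralFormOfSpace_of_basis
    (E.latticeBasis b hB β) (mem_integralSpan_iff b hB β), ?_⟩
  refine isCompatibleWithGrading_integralSpan b hsymm hB hdual β
    (fun p : {γ : dualLattice B // γ - β ∈ (toDual B).range} × ℚ => (p.1.1, (p.2 : ℂ)))
    (fun p q h => ?_) (fun j => ?_)
  · rw [Prod.ext_iff] at h
    exact Prod.ext (Subtype.ext h.1) (Rat.cast_injective h.2)
  · obtain ⟨q, hq⟩ := exists_rat_basisWeight hB β j
    exact ⟨(⟨toDual B j.2 + β, by rw [add_sub_cancel_right]; exact ⟨j.2, rfl⟩⟩, q), by rw [hq]⟩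

end CentralExtension

end LatticeVertex
end

theorem theorem4p3 {L : Type*} [AddCommGroup L] [Module.Free ℤ L] [Module.Finite ℤ L]
    (B : LinearMap.BilinForm ℤ L) (hsymm : B.IsSymm) (hnondeg : B.Nondegenerate)
    (heven : ∀ α : L, Even (B α α))
    {G : Type*} [Group G] (E : LatticeVertex.CentralExtension B G)
    {J : Type*} [Fintype J] [DecidableEq J]
    (a a' : Module.Basis J ℂ (LatticeVertex.Cartan L))
    (hdual : ∀ i j, LatticeVertex.form B (a i) (a' j) = if i = j then 1 else 0) :
    E.IsIntegralFormOfAlgebra (E.conformalVector a a') E.integralAlgebra ∧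
      ∀ β : LatticeVertex.dualLattice B,
        E.IsIntegralFormOfModule (E.conformalVector a a') E.integralAlgebra β
          (E.integralModule β) :=
  ⟨LatticeVertex.CentralExtension.isIntegralFormOfAlgebra_integralAlgebra hsymm hnondeg heven hdual,
    LatticeVertex.CentralExtension.isIntegralFormOfModule_integralModule hsymm hnondeg hdual⟩
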